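/- **Model.** $n$ nodes share one channel in synchronized time steps. Fix a constant $\hat p\in(0,1/24]$ and a parameter $\gamma>0$ common to all nodes. In the AntiJam protocol each node $v$ keeps $(p_v,c_v,T_v)$, initially $(\hat p,1,1)$. In each step every node $v$, independently of the others, transmits (together with its tuple $(p_v,c_v,T_v)$) with probability $p_v$. If $v$ does not transmit, then: (i) if it senses an idle channel (nobody transmits and the step is not jammed), it sets $p_v:=\min\{(1+\gamma)p_v,\hat p\}$ and $T_v:=T_v-1$; (ii) if it receives a tuple $(p_{new},c_{new},T_{new})$ (exactly one node transmits and the step is not jammed: a *successful transmission*), it sets $p_v:=(1+\gamma)^{-1}p_{new}$, $c_v:=c_{new}$, $T_v:=T_{new}$. Afterwards every node sets $c_v:=c_v+1$; if now $c_v>T_v$, it sets $c_v:=1$, and if none of the past $T_v$ steps (including the current one) was idle, it also sets $p_v:=(1+\gamma)^{-1}p_v$ and $T_v:=T_v+2$. An adaptive, reactive jammer decides in each step, possibly at random, whether to jam, knowing the protocol, the entire history, and whether the channel is currently idle or busy (at least one transmission); it does not learn whether a busy channel carries one or several transmissions. It is $(T,1-\varepsilon)$-bounded if, in every execution, every time window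 of size $w\ge T$ contains at most $(1-\varepsilon)w$ jammed steps. **Theorem.** For every constant $\hat p\in(0,1/24]$ there are constants $K,\delta,\gamma_0>0$ such that for every $c>0$ there are constants $B,C>0$ with the following property. Let $T\ge1$, $0<\varepsilon\le1$, $n\ge B/\varepsilon^2$, $0<\gamma\le\gamma_0/(\log T+\log\log n)$ and $N=\max\{T,n\}$. Then for every adaptive, reactive, $(T,1-\varepsilon)$-bounded jammer and every number $t$ of time steps with $$t\ \ge\ C\cdot\frac1\varepsilon\,\log N\cdot\max\Big\{T,\ \frac{e^{\delta/\varepsilon^2}}{\varepsilon\gamma^2}\log^3N\Big\},$$ with probability at least $1-n^{-c}$ the number of successful transmissions in the first $t$ steps is at least $e^{-K/\varepsilon^2}$ times the number of non-jammed steps among them. (AntiJam is $e^{-\Theta(1/\varepsilon^2)}$-competitive with high probability; for constant $\varepsilon$ it is $\Theta(1)$-competitive.) -/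

import Mathlib

open scoped ENNReal NNReal

/-- The local state of a node: access probability, counter, time window threshold estimate. -/
structure NodeState where
  p : ℝ
  c : ℕ
  T : ℕ

/-- What happens in one time step: which nodes transmit, and whether the jammer jams. -/
structure Round (n : ℕ) where
  senders : Finset (Fin n)
  jammed : Bool

/-- The nodes perceive an idle channel: nobody transmits and the step is not jammed. -/
def Round.isIdle {n : ℕ} (r : Round n) : Bool :=
  decide (r.senders = ∅) && !r.jammed

/-- Successful transmission: exactly one node transmits and the step is not jammed. -/
def Round.isSuccess {n : ℕ} (r : Round n) : Bool :=
  decide (r.senders.card = 1) && !r.jammed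

/-- A history of the execution; the most recent time step is the head of the list. -/
abbrev History (n : ℕ) := List (Round n)

theorem Round.exists_sender {n : ℕ} {r : Round n} (h : r.isSuccess = true) :
    ∃ u, r.senders = {u} := by
  simp only [Round.isSuccess, Bool.and_eq_true, decide_eq_true_eq] at h
  exact Finset.card_eq_one.mp h.1

/-- The unique sender of a successful time step. -/
noncomputable def Round.sender {n : ℕ} (r : Round n) (h : r.isSuccess = true) : Fin n :=
  (Round.exists_sender h).choose

/-- First part of a step of the protocol: a node that does not transmit reacts to an idle channel
or to the receipt of the tuple of the sender. A node that transmits, or senses a busy channel,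
changes nothing. (The estimates are `≥ 1` at the beginning of every step, so that the subtraction
is never truncated.) -/
noncomputable def afterSensing {n : ℕ} (γ pHat : ℝ) (s : Fin n → NodeState) (r : Round n)
    (v : Fin n) : NodeState :=
  if v ∈ r.senders then s v
  else if r.isIdle = true then
    { p := min ((1 + γ) * (s v).p) pHat, c := (s v).c, T := (s v).T - 1 }
  else if h : r.isSuccess = true then
    { p := (1 + γ)⁻¹ * (s (r.sender h)).p, c := (s (r.sender h)).c, T := (s (r.sender h)).T }
  else s v

/-- Second part of a step: increment the counter; if it exceeds the threshold estimate, reset it,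
and back off if none of the past `T_v` time steps was idle. Here `h` is the history including the
current step. -/
noncomputable def afterCounting {n : ℕ} (γ : ℝ) (h : History n) (s : NodeState) : NodeState :=
  if s.c + 1 > s.T then
    if ∃ r ∈ h.take s.T, r.isIdle = true then { p := s.p, c := 1, T := s.T }
    else { p := (1 + γ)⁻¹ * s.p, c := 1, T := s.T + 2 }
  else { p := s.p, c := s.c + 1, T := s.T }

/-- The states of all nodes after the history `h` of an execution of the AntiJam protocol. -/
noncomputable def antiJamState {n : ℕ} (γ pHat : ℝ) : History n → Fin n → NodeState
  | [] => fun _ => { p := pHat, c := 1, T := 1 }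
  | r :: h => fun v => afterCounting γ (r :: h) (afterSensing γ pHat (antiJamState γ pHat h) r v)

/-- The real number `x` as a probability (access probabilities always lie in `[0, 1]`, where this
is the identity). -/
noncomputable def toProb (x : ℝ) : ℝ≥0∞ := min (ENNReal.ofReal x) 1

/-- The random set of transmitting nodes, if every node `v` independently transmits with
probability `q v`. -/
noncomputable def sendPMF {n : ℕ} (q : Fin n → ℝ) : PMF (Finset (Fin n)) :=
  PMF.ofFintype
    (fun A => (∏ v ∈ A, toProb (q v)) * ∏ v ∈ Finset.univ \ A, (1 - toProb (q v))) (by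
      have h := Finset.prod_add (fun v => toProb (q v)) (fun v => 1 - toProb (q v))
        (Finset.univ : Finset (Fin n))
      rw [Finset.powerset_univ] at h
      rw [← h]
      exact Finset.prod_eq_one fun v _ => add_tsub_cancel_of_le (min_le_right _ _))

/-- An adaptive, reactive jammer, possibly randomized: it knows the entire history, and it senses
whether the channel is currently busy (`true`: at least one node transmits) or idle (`false`); it
cannot tell a single transmission from a collision. It then decides whether to jam. -/
abbrev Jammer (n : ℕ) := History n → Bool → PMF Bool

/-- The law of the history of the first `t` time steps of AntiJam against the jammer `J`. -/
noncomputable def antiJamRun {n : ℕ} (γ pHat : ℝ) (J : Jammer n) : ℕ → PMF (History n)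
  | 0 => PMF.pure []
  | t + 1 =>
    (antiJamRun γ pHat J t).bind fun h =>
      (sendPMF fun v => (antiJamState γ pHat h v).p).bind fun A =>
        (J h (decide A.Nonempty)).bind fun j =>
          PMF.pure ({ senders := A, jammed := j } :: h)

/-- `(T, 1 - ε)`-bounded jammer: in every execution, every time window of size `w ≥ T` contains at
most `(1 - ε) w` jammed time steps. -/
def Jammer.IsBounded {n : ℕ} (J : Jammer n) (γ pHat : ℝ) (T : ℕ) (ε : ℝ) : Prop :=
  ∀ t : ℕ, ∀ h ∈ (antiJamRun γ pHat J t).support, ∀ W : History n, W <:+: h → T ≤ W.length →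
    (W.countP (fun r => r.jammed) : ℝ) ≤ (1 - ε) * (W.length : ℝ)

/-- The histories in which at least a `κ`-fraction of the non-jammed time steps carry a successful
transmission. -/
def competitiveHistories (n : ℕ) (κ : ℝ) : Set (History n) :=
  {h | κ * (h.countP (fun r => !r.jammed) : ℝ) ≤ (h.countP (fun r => r.isSuccess) : ℝ)}

/-!
The nodes move in lockstep: they always have the same counter and the same threshold estimate, and
the access probabilities are equal but for one node, which may be ahead by a factor `1 + γ`. So the
protocol is a walk of a level `k` and a threshold estimate `T` (`SyncState.antiJamState_eq`), where
`pHat / (1 + γ) ^ k` is the access probability. An idle step decreases `k` and `T` by `1`; a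
successful transmission increases `k` by `1`, unless its sender is the exceptional node; backing off
increases `k` by `1` and `T` by `2`.

Let the load `Y` be such that nobody transmits with probability `exp (-Y)`. Then exactly one node
transmits with probability about `Y * exp (-Y)`. At levels of load below a constant `U` of order
`1 / ε ^ 2`, a constant fraction of the busy steps that are not jammed are successful. Idle steps
are controlled by successes, too: as `T` cannot become negative, many idle steps require many
backings off, and all these idle steps cannot lower the level more often than backings off and
successes raise it (`Setup.countP_add_le_account`). It remains to show that only few steps are spent
at levels of load at least `U`. There, successes are `Y / 2` times as frequent as idle steps, so
that the load tends to decrease. The jammer can prevent this by jamming all busy steps, as long as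
its budget lasts. If the load is so large that neither successes nor idle steps occur, then the
nodes back off.

A potential (`Setup.potential`) puts this together. It charges the reaching of a level `j` by an
idle step with an amount `Setup.slope` of about `exp Y`, capped at a multiple of `T`, as after some
`T` steps the nodes back off anyway; it charges the remaining jamming budget with a price per unit;
it takes into account the position of the counter; and it contains a quadratic function of `T`,
which pays when idle steps are frequent but a reached level would be charged with a multiple of `T`.
The sum of the potential and an account of the steps (`Setup.total`) has bounded increments as long
as `T` is bounded, and a small multiple of it is the exponent of a supermartingale
(`Setup.stepExpect_le`). Deterministically, `T` is at most of the order of the square root of the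
number of steps (`syncState_T_sq_le`). By Markov's inequality, the account is small with high
probability, and then almost all steps that are not jammed are paid for by successes
(`Setup.competitive`).

The analysis needs `1 ≤ ε * T`, where `T` is the window size of the jammer. Otherwise boundedness
only says that every window of size `T` contains a step that is not jammed, and `T` and `ε` can be
replaced by `2 * T` and `1 / (2 * T)` (`Jammer.IsBounded.two_mul`).
-/

/-! ### The synchronized description of an execution -/

/-- A description of the states of all nodes at once. All nodes have the same counter `c` and the
same threshold estimate `T`. The access probabilities are `pHat / (1 + γ) ^ k`, except for at most
one exceptional node `hi`, whose access probability is larger by a factor `1 + γ`. The flag `dirty`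
records whether an idle step occurred since the last reset of the counter. -/
structure SyncState (n : ℕ) where
  k : ℕ
  hi : Option (Fin n)
  c : ℕ
  T : ℕ
  dirty : Bool

namespace SyncState

variable {n : ℕ}

/-- Reaction to what is sensed in a step. An idle step lowers the level by `1`; at level `0` it is
stopped by the cap `pHat`, and at level `1` it is only the exceptional node that is stopped, so that
it ceases to be exceptional. A successful node keeps its access probability while all others adopt
the next lower one; if it is the exceptional node, this changes nothing. -/
noncomputable def sense (s : SyncState n) (r : Round n) : SyncState n :=
  if r.isIdle = true then
    { k := s.k - 1, hi := if s.k ≤ 1 then none else s.hi, c := s.c, T := s.T - 1, dirty := true }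
  else if h : r.isSuccess = true then
    if s.hi = some (r.sender h) then s
    else { k := s.k + 1, hi := some (r.sender h), c := s.c, T := s.T, dirty := s.dirty }
  else s

/-- The counting part of a step: the counter is incremented, possibly reset, and the nodes back off
if no idle step was seen since the last reset (or if the threshold estimate dropped to `0`). -/
def count (s : SyncState n) : SyncState n :=
  if s.T < s.c + 1 then
    if s.dirty = true ∧ s.T ≠ 0 then
      { k := s.k, hi := s.hi, c := 1, T := s.T, dirty := false }
    else { k := s.k + 1, hi := s.hi, c := 1, T := s.T + 2, dirty := false }
  else { k := s.k, hi := s.hi, c := s.c + 1, T := s.T, dirty := s.dirty }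

/-- The synchronized state after a history. -/
noncomputable def _root_.syncState : History n → SyncState n
  | [] => { k := 0, hi := none, c := 1, T := 1, dirty := false }
  | r :: h => ((syncState h).sense r).count

/-- The access probability of a node in a synchronized state. -/
noncomputable def prob (γ pHat : ℝ) (s : SyncState n) (v : Fin n) : ℝ :=
  pHat / (1 + γ) ^ s.k * (if s.hi = some v then 1 + γ else 1)

/-- The invariants of the synchronized state. -/
structure Valid (s : SyncState n) : Prop where
  one_le_c : 1 ≤ s.c
  c_le_T : s.c ≤ s.T
  one_le_k : s.hi ≠ none → 1 ≤ s.k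

theorem Valid.count_sense {s : SyncState n} (hs : s.Valid) (r : Round n) :
    (s.sense r).count.Valid := by
  obtain ⟨h1, h2, h3⟩ := hs
  unfold sense
  split_ifs with hi hk hsucc hh
  · unfold count
    constructor <;> split_ifs <;> simp_all <;> omega
  · unfold count
    constructor <;> split_ifs <;> simp_all <;> omega
  all_goals
    unfold count
    constructor <;> split_ifs <;> simp_all
    omega

theorem _root_.syncState_valid (h : History n) : (syncState h).Valid := by
  induction h with
  | nil => exact ⟨le_rfl, le_rfl, by simp [syncState]⟩
  | cons r h ih => exact ih.count_sense r

/-- The counter tells how many steps ago it was reset, so that the flag `dirty` refers to the last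
`c - 1` steps. -/
theorem _root_.syncState_dirty (h : History n) :
    (syncState h).dirty = true ↔ ∃ r ∈ h.take ((syncState h).c - 1), r.isIdle = true := by
  induction h with
  | nil => simp [syncState]
  | cons r h ih =>
    have hv := syncState_valid h
    obtain ⟨h1, h2, h3⟩ := hv
    show (((syncState h).sense r).count).dirty = true ↔ _
    rw [show (syncState (r :: h)) = ((syncState h).sense r).count from rfl]
    generalize syncState h = s at *
    have key : (s.sense r).dirty = true ↔
        ∃ r' ∈ (r :: h).take s.c, r'.isIdle = true := by
      obtain ⟨m, hm⟩ : ∃ m, s.c = m + 1 := ⟨s.c - 1, by omega⟩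
      rw [hm, List.take_succ_cons]
      rw [hm] at ih
      simp only [Nat.add_sub_cancel] at ih
      unfold sense
      split_ifs with hi hsucc hh <;> simp_all
    have hc : (s.sense r).c = s.c := by unfold sense; split_ifs <;> rfl
    unfold count
    split_ifs <;> simp_all

/-- The test for an idle step among the past `T` steps reduces to the flag `dirty`. If the counter
exceeds the estimate because an idle step has just lowered the estimate, this idle step is itself
among the past `T` steps, unless the estimate is now `0`. -/
theorem afterCounting_eq {γ : ℝ} {r : Round n} {h : History n}
    (x : NodeState) (hc : x.c = ((syncState h).sense r).c) (hT : x.T = ((syncState h).sense r).T) :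
    afterCounting γ (r :: h) x =
      if ((syncState h).sense r).T < ((syncState h).sense r).c + 1 then
        if ((syncState h).sense r).dirty = true ∧ ((syncState h).sense r).T ≠ 0 then
          { p := x.p, c := 1, T := x.T }
        else { p := (1 + γ)⁻¹ * x.p, c := 1, T := x.T + 2 }
      else { p := x.p, c := x.c + 1, T := x.T } := by
  have hd := syncState_dirty h
  obtain ⟨h1, h2, h3⟩ := syncState_valid h
  unfold afterCounting
  rw [hc, hT]
  by_cases hlt : ((syncState h).sense r).T < ((syncState h).sense r).c + 1
  · rw [if_pos hlt, if_pos hlt]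
    have : (∃ r' ∈ (r :: h).take ((syncState h).sense r).T, r'.isIdle = true) ↔
        (((syncState h).sense r).dirty = true ∧ ((syncState h).sense r).T ≠ 0) := by
      generalize syncState h = s at *
      by_cases hi : r.isIdle = true
      · simp only [sense, if_pos hi] at *
        rcases Nat.eq_zero_or_pos (s.T - 1) with h0 | h0
        · simp [h0]
        · obtain ⟨m, hm⟩ : ∃ m, s.T - 1 = m + 1 := ⟨s.T - 2, by omega⟩
          rw [hm, List.take_succ_cons]
          simp [hi]
      · have e1 : (s.sense r).T = s.T := by simp only [sense, if_neg hi]; split_ifs <;> rfl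
        have e2 : (s.sense r).c = s.c := by simp only [sense, if_neg hi]; split_ifs <;> rfl
        have e3 : (s.sense r).dirty = s.dirty := by
          simp only [sense, if_neg hi]; split_ifs <;> rfl
        rw [e1, e2] at hlt
        have hcT : s.c = s.T := by omega
        rw [e1, e3]
        obtain ⟨m, hm⟩ : ∃ m, s.T = m + 1 := ⟨s.T - 1, by omega⟩
        rw [hd, hm, List.take_succ_cons, hcT, hm]
        simp [hi]
    by_cases hx : ∃ r' ∈ (r :: h).take ((syncState h).sense r).T, r'.isIdle = true
    · rw [if_pos hx, if_pos (this.1 hx)]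
    · rw [if_neg hx, if_neg (fun hy => hx (this.2 hy))]
  · rw [if_neg hlt, if_neg hlt]

theorem sender_eq {r : Round n} (h : r.isSuccess = true) : r.senders = {r.sender h} :=
  (Round.exists_sender h).choose_spec

theorem afterSensing_eq {γ pHat : ℝ} (hγ : 0 < γ) (hp : 0 < pHat) {s : SyncState n}
    (hs : s.Valid) (σ : Fin n → NodeState)
    (hσ : ∀ v, σ v = { p := s.prob γ pHat v, c := s.c, T := s.T }) (r : Round n) (v : Fin n) :
    afterSensing γ pHat σ r v =
      { p := (s.sense r).prob γ pHat v, c := (s.sense r).c, T := (s.sense r).T } := by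
  obtain ⟨h1, h2, h3⟩ := hs
  have hg : 0 < 1 + γ := by linarith
  have hgne : (1 + γ) ≠ 0 := hg.ne'
  unfold afterSensing
  by_cases hi : r.isIdle = true
  · have hem : r.senders = ∅ := by
      simp only [Round.isIdle, Bool.and_eq_true, decide_eq_true_eq] at hi; exact hi.1
    rw [if_neg (by simp [hem]), if_pos hi, hσ]
    have hsense : s.sense r = 
        ⟨s.k - 1, if s.k ≤ 1 then none else s.hi, s.c, s.T - 1, true⟩ := by
      unfold sense; rw [if_pos hi]
    rw [hsense]
    simp only [NodeState.mk.injEq, and_true]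
    unfold prob
    dsimp only
    rcases Nat.lt_or_ge 1 s.k with hk | hk
    · rw [if_neg (show ¬ s.k ≤ 1 by omega)]
      obtain ⟨m, hm⟩ : ∃ m, s.k = m + 2 := ⟨s.k - 2, by omega⟩
      rw [hm, show m + 2 - 1 = m + 1 by omega]
      have e : (1 + γ) * (pHat / (1 + γ) ^ (m + 2) * (if s.hi = some v then 1 + γ else 1)) =
          pHat / (1 + γ) ^ (m + 1) * (if s.hi = some v then 1 + γ else 1) := by
        rw [pow_succ (1 + γ) (m + 1)]; field_simp
      rw [e, min_eq_left]
      have hpow : 1 ≤ (1 + γ) ^ m := one_le_pow₀ (by linarith)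
      split_ifs
      · rw [pow_succ, div_mul_eq_mul_div, div_le_iff₀ (by positivity)]
        nlinarith [mul_pos hp hg]
      · rw [mul_one, pow_succ, div_le_iff₀ (by positivity)]
        nlinarith [mul_pos hp hg, mul_pos hp hγ]
    · rw [if_pos (show s.k ≤ 1 from hk)]
      simp only [reduceCtorEq, if_false, mul_one]
      have hk0 : s.k - 1 = 0 := by omega
      rw [hk0, pow_zero, div_one, min_eq_right]
      rcases Nat.eq_zero_or_pos s.k with h0 | h0
      · have : s.hi ≠ some v := by
          intro hh; have := h3 (by simp [hh]); omega
        rw [if_neg this, h0]; simp; nlinarith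
      · have : s.k = 1 := by omega
        rw [this, pow_one]
        have e : (1 + γ) * (pHat / (1 + γ) * (if s.hi = some v then 1 + γ else 1)) =
          pHat * (if s.hi = some v then 1 + γ else 1) := by field_simp
        rw [e]; split_ifs <;> nlinarith
  · by_cases hsu : r.isSuccess = true
    · have hu := sender_eq hsu
      set u := r.sender hsu with hudef
      by_cases hh : s.hi = some u
      · have hsense : s.sense r = s := by
          unfold sense; rw [if_neg hi, dif_pos hsu, if_pos hh]
        rw [hsense]
        by_cases hv : v ∈ r.senders
        · rw [if_pos hv, hσ]
        · rw [if_neg hv, if_neg hi, dif_pos hsu, ← hudef, hσ]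
          have hvu : u ≠ v := by rintro rfl; exact hv (by rw [hu]; simp)
          simp only [NodeState.mk.injEq, and_true]
          unfold prob
          rw [hh, if_pos rfl, if_neg (by simpa using hvu)]
          field_simp
      · have hsense : s.sense r = ⟨s.k + 1, some u, s.c, s.T, s.dirty⟩ := by
          unfold sense; rw [if_neg hi, dif_pos hsu, if_neg hh]
        rw [hsense]
        by_cases hv : v ∈ r.senders
        · rw [if_pos hv, hσ]
          have hvu : v = u := by rw [hu] at hv; simpa using hv
          subst hvu
          simp only [NodeState.mk.injEq, and_true]
          unfold prob
          dsimp only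
          rw [if_pos rfl, if_neg hh, pow_succ]; field_simp
        · rw [if_neg hv, if_neg hi, dif_pos hsu, ← hudef, hσ]
          have hvu : u ≠ v := by rintro rfl; exact hv (by rw [hu]; simp)
          simp only [NodeState.mk.injEq, and_true]
          unfold prob
          dsimp only
          rw [if_neg hh, if_neg (by simpa using hvu), pow_succ]
          field_simp
    · have hsense : s.sense r = s := by
          unfold sense; rw [if_neg hi, dif_neg hsu]
      rw [hsense, if_neg hi, dif_neg hsu, ite_self, hσ]

/-- The synchronized state describes the states of all nodes. -/
theorem antiJamState_eq {γ pHat : ℝ} (hγ : 0 < γ) (hp : 0 < pHat) (h : History n) (v : Fin n) :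
    antiJamState γ pHat h v =
      { p := (syncState h).prob γ pHat v, c := (syncState h).c, T := (syncState h).T } := by
  induction h generalizing v with
  | nil => simp [antiJamState, syncState, prob]
  | cons r h ih =>
    have hg : 0 < 1 + γ := by linarith
    have hgne : (1 + γ) ≠ 0 := hg.ne'
    show afterCounting γ (r :: h) (afterSensing γ pHat (antiJamState γ pHat h) r v) = _
    rw [afterSensing_eq hγ hp (syncState_valid h) _ ih r v, afterCounting_eq _ rfl rfl]
    show _ = NodeState.mk (prob γ pHat (((syncState h).sense r).count) v) _ _
    rw [show (syncState (r :: h)) = ((syncState h).sense r).count from rfl]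
    generalize (syncState h).sense r = s
    unfold count
    split_ifs <;> simp [prob]
    rw [pow_succ]; field_simp

end SyncState

/-! ### Expectations along the random execution -/

/-- The expectation of a nonnegative function under a probability mass function. -/
noncomputable def PMF.expect {α : Type*} (p : PMF α) (f : α → ℝ≥0∞) : ℝ≥0∞ := ∑' a, p a * f a

namespace PMF

variable {α β : Type*}

theorem expect_pure (a : α) (f : α → ℝ≥0∞) : (PMF.pure a).expect f = f a := by
  classical
  unfold expect
  rw [tsum_eq_single a]
  · simp
  · intro b hb; simp [hb]

theorem expect_bind (p : PMF α) (q : α → PMF β) (f : β → ℝ≥0∞) :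
    (p.bind q).expect f = p.expect fun a => (q a).expect f := by
  unfold expect
  simp only [PMF.bind_apply, ← ENNReal.tsum_mul_right, ← ENNReal.tsum_mul_left]
  rw [ENNReal.tsum_comm]
  simp only [mul_assoc]

theorem expect_mono (p : PMF α) {f g : α → ℝ≥0∞} (h : ∀ a ∈ p.support, f a ≤ g a) :
    p.expect f ≤ p.expect g := by
  unfold expect
  refine ENNReal.tsum_le_tsum fun a => ?_
  by_cases ha : a ∈ p.support
  · gcongr; exact h a ha
  · simp [(PMF.apply_eq_zero_iff p a).2 ha]

theorem expect_const_mul (p : PMF α) (c : ℝ≥0∞) (f : α → ℝ≥0∞) :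
    (p.expect fun a => c * f a) = c * p.expect f := by
  unfold expect
  rw [← ENNReal.tsum_mul_left]
  exact tsum_congr fun a => by ring

theorem toOuterMeasure_eq_expect (p : PMF α) (s : Set α) :
    p.toOuterMeasure s = p.expect (s.indicator 1) := by
  rw [PMF.toOuterMeasure_apply]
  unfold expect
  refine tsum_congr fun a => ?_
  by_cases h : a ∈ s <;> simp [h]

theorem toReal_nonneg_le_one (p : PMF α) (a : α) : 0 ≤ (p a).toReal ∧ (p a).toReal ≤ 1 :=
  ⟨ENNReal.toReal_nonneg, ENNReal.toReal_le_of_le_ofReal zero_le_one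
      (by simpa using p.coe_le_one a)⟩

theorem expect_ofReal [Fintype α] (p : PMF α) (f : α → ℝ) (hf : ∀ a, 0 ≤ f a) :
    (p.expect fun a => ENNReal.ofReal (f a)) =
      ENNReal.ofReal (∑ a, (p a).toReal * f a) := by
  unfold expect
  rw [tsum_fintype, ENNReal.ofReal_sum_of_nonneg]
  · refine Finset.sum_congr rfl fun a _ => ?_
    rw [ENNReal.ofReal_mul ENNReal.toReal_nonneg, ENNReal.ofReal_toReal (p.apply_ne_top a)]
  · exact fun a _ => mul_nonneg ENNReal.toReal_nonneg (hf a)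

theorem sum_toReal [Fintype α] (p : PMF α) : ∑ a, (p a).toReal = 1 := by
  have h := p.tsum_coe
  rw [tsum_fintype] at h
  rw [← ENNReal.toReal_sum fun a _ => p.apply_ne_top a, h, ENNReal.toReal_one]

/-- Markov's inequality, in complementary form. -/
theorem one_sub_le_toOuterMeasure (p : PMF α) (s : Set α) (f : α → ℝ≥0∞) (δ : ℝ≥0∞)
    (hf : ∀ a ∈ p.support, a ∉ s → 1 ≤ f a) (hδ : p.expect f ≤ δ) :
    1 - δ ≤ p.toOuterMeasure s := by
  rw [tsub_le_iff_right, toOuterMeasure_eq_expect]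
  calc (1 : ℝ≥0∞) = p.expect fun _ => 1 := by unfold expect; simp [p.tsum_coe]
    _ ≤ p.expect (fun a => s.indicator 1 a + f a) := by
      refine expect_mono p fun a ha => ?_
      by_cases h : a ∈ s
      · simp [h]
      · simpa [h] using hf a ha h
    _ = p.expect (s.indicator 1) + p.expect f := by
      unfold expect; rw [← ENNReal.tsum_add]; exact tsum_congr fun a => by ring
    _ ≤ _ := by gcongr

end PMF

section Run

variable {n : ℕ} (γ pHat : ℝ) (J : Jammer n)

/-- The conditional expectation of `f` after one more step, given the history `h`. -/
noncomputable def stepExpect (h : History n) (f : History n → ℝ≥0∞) : ℝ≥0∞ :=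
  (sendPMF fun v => (antiJamState γ pHat h v).p).expect fun A =>
    (J h (decide A.Nonempty)).expect fun j => f ({ senders := A, jammed := j } :: h)

theorem antiJamRun_succ_expect (t : ℕ) (f : History n → ℝ≥0∞) :
    (antiJamRun γ pHat J (t + 1)).expect f =
      (antiJamRun γ pHat J t).expect fun h => stepExpect γ pHat J h f := by
  simp only [antiJamRun, PMF.expect_bind, PMF.expect_pure, stepExpect]

theorem length_of_mem_support {t : ℕ} {h : History n} (hh : h ∈ (antiJamRun γ pHat J t).support) :
    h.length = t := by
  induction t generalizing h with
  | zero => simp [antiJamRun] at hh; simp [hh]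
  | succ t ih =>
    simp only [antiJamRun, PMF.mem_support_bind_iff, PMF.mem_support_pure_iff] at hh
    obtain ⟨h', hh', A, -, j, -, rfl⟩ := hh
    simp [ih hh']

/-- A function that does not increase in conditional expectation does not increase in
expectation. -/
theorem expect_le_of_stepExpect_le (f : History n → ℝ≥0∞) (t : ℕ)
    (hf : ∀ s < t, ∀ h ∈ (antiJamRun γ pHat J s).support, stepExpect γ pHat J h f ≤ f h) :
    (antiJamRun γ pHat J t).expect f ≤ f [] := by
  induction t with
  | zero => rw [antiJamRun, PMF.expect_pure]
  | succ t ih =>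
    rw [antiJamRun_succ_expect]
    exact (PMF.expect_mono _ (hf t (Nat.lt_succ_self t))).trans
      (ih fun s hs => hf s (hs.trans (Nat.lt_succ_self t)))

end Run

/-! ### Probabilities of idle and successful steps -/

section Send

variable {n : ℕ} {q : Fin n → ℝ}

theorem sendPMF_toReal (h0 : ∀ v, 0 ≤ q v) (h1 : ∀ v, q v ≤ 1) (A : Finset (Fin n)) :
    (sendPMF q A).toReal = (∏ v ∈ A, q v) * ∏ v ∈ Finset.univ \ A, (1 - q v) := by
  have e : ∀ v, (toProb (q v)).toReal = q v := fun v => by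
    unfold toProb
    rw [min_eq_left (by simpa using h1 v), ENNReal.toReal_ofReal (h0 v)]
  have e' : ∀ v, (1 - toProb (q v)).toReal = 1 - q v := fun v => by
    rw [ENNReal.toReal_sub_of_le (show toProb (q v) ≤ 1 from min_le_right _ _) ENNReal.one_ne_top,
      e, ENNReal.toReal_one]
  rw [sendPMF, PMF.ofFintype_apply, ENNReal.toReal_mul, ENNReal.toReal_prod, ENNReal.toReal_prod]
  simp only [e, e']

theorem sendPMF_empty (h0 : ∀ v, 0 ≤ q v) (h1 : ∀ v, q v ≤ 1) :
    (sendPMF q ∅).toReal = ∏ v, (1 - q v) := by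
  rw [sendPMF_toReal h0 h1]; simp

theorem le_sendPMF_singleton (h0 : ∀ v, 0 ≤ q v) (h1 : ∀ v, q v < 1) (u : Fin n) :
    (sendPMF q {u}).toReal = q u / (1 - q u) * (sendPMF q ∅).toReal := by
  rw [sendPMF_toReal h0 fun v => (h1 v).le, sendPMF_empty h0 fun v => (h1 v).le,
    Finset.prod_singleton, ← Finset.prod_sdiff (Finset.subset_univ {u}), Finset.prod_singleton]
  have : 1 - q u ≠ 0 := by have := h1 u; linarith
  field_simp

/-- The probability of an idle step times the probability of a busy step is a lower bound for the
probability of a successful step. -/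
theorem mul_one_sub_le_sum_sendPMF_singleton (h0 : ∀ v, 0 ≤ q v) (h1 : ∀ v, q v < 1) :
    (sendPMF q ∅).toReal * (1 - (sendPMF q ∅).toReal) ≤ ∑ u, (sendPMF q {u}).toReal := by
  have hu : 1 - (sendPMF q ∅).toReal ≤ ∑ u, q u := by
    rw [sendPMF_empty h0 fun v => (h1 v).le]
    have key : ∀ s : Finset (Fin n), 1 - ∑ v ∈ s, q v ≤ ∏ v ∈ s, (1 - q v) := by
      intro s
      induction s using Finset.induction_on with
      | empty => simp
      | insert a s ha ih =>
        rw [Finset.sum_insert ha, Finset.prod_insert ha]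
        have hs : 0 ≤ ∑ v ∈ s, q v := Finset.sum_nonneg fun v _ => h0 v
        nlinarith [h0 a, h1 a]
    have := key Finset.univ
    linarith
  have ha : 0 ≤ (sendPMF q ∅).toReal := ENNReal.toReal_nonneg
  calc _ ≤ (sendPMF q ∅).toReal * ∑ u, q u := by gcongr
    _ = ∑ u, q u * (sendPMF q ∅).toReal := by rw [Finset.mul_sum]; simp only [mul_comm]
    _ ≤ _ := by
      refine Finset.sum_le_sum fun u _ => ?_
      rw [le_sendPMF_singleton h0 h1]
      gcongr
      rw [le_div_iff₀ (by have := h1 u; linarith)]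
      nlinarith [h0 u, h1 u]

/-- A bound for the expectation of a function of the outcome of one step, in terms of bounds for
jammed steps (`fj`), idle steps (`fi`), busy steps (`fb`), and successes of nodes in `G` (`fs`). It
suffices to consider jammers that jam all or none of the busy steps. -/
theorem expect_step_le_one (p : PMF (Finset (Fin n))) (J : Bool → PMF Bool)
    (F : Finset (Fin n) → Bool → ℝ) (G : Finset (Fin n)) {fj fi fb fs m : ℝ}
    (hF : ∀ A j, 0 ≤ F A j)
    (hj : ∀ A, F A true ≤ fj) (hi : F ∅ false ≤ fi) (hb : ∀ A, A ≠ ∅ → F A false ≤ fb)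
    (hs : ∀ u ∈ G, F {u} false ≤ fs) (hjm : fj ≤ m) (him : fi ≤ m)
    (h1 : (p ∅).toReal * m + (1 - (p ∅).toReal) * fj ≤ 1)
    (h2 : (p ∅).toReal * m + (1 - (p ∅).toReal - ∑ u ∈ G, (p {u}).toReal) * fb
      + (∑ u ∈ G, (p {u}).toReal) * fs ≤ 1) :
    (p.expect fun A => (J (decide A.Nonempty)).expect fun j => ENNReal.ofReal (F A j)) ≤ 1 := by
  classical
  have hJ : ∀ b, (J b true).toReal + (J b false).toReal = 1 := fun b => by
    have := (J b).sum_toReal; simpa using this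
  have h0j : ∀ b, 0 ≤ (J b true).toReal := fun b => ENNReal.toReal_nonneg
  have h0j' : ∀ b, 0 ≤ (J b false).toReal := fun b => ENNReal.toReal_nonneg
  have hw : ∀ A, 0 ≤ (p A).toReal := fun A => ENNReal.toReal_nonneg
  have e1 : ∀ A, ((J (decide A.Nonempty)).expect fun j => ENNReal.ofReal (F A j)) =
      ENNReal.ofReal ((J (decide A.Nonempty) true).toReal * F A true +
        (J (decide A.Nonempty) false).toReal * F A false) := fun A => by
    rw [PMF.expect_ofReal _ _ (hF A)]; simp
  simp only [e1]
  rw [PMF.expect_ofReal _ _ fun A => by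
    have := hF A true; have := hF A false; have := h0j (decide A.Nonempty)
    have := h0j' (decide A.Nonempty); positivity]
  rw [← ENNReal.ofReal_one]
  refine ENNReal.ofReal_le_ofReal ?_
  set x := (J true true).toReal with hx
  set y := (J true false).toReal with hy
  have hxy : x + y = 1 := hJ true
  have hx0 : 0 ≤ x := h0j true
  have hy0 : 0 ≤ y := h0j' true
  set S : Finset (Finset (Fin n)) := G.image fun u => {u} with hS
  have hSsum : ∀ f : Finset (Fin n) → ℝ, ∑ A ∈ S, f A = ∑ u ∈ G, f {u} := fun f => by
    rw [hS, Finset.sum_image]; intro a _ b _ hab; simpa using hab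
  have hempS : ∅ ∉ S := by simp [hS]
  have hsplit : ∀ f : Finset (Fin n) → ℝ, ∑ A, f A = f ∅ + (∑ u ∈ G, f {u} +
      ∑ A ∈ (Finset.univ \ insert ∅ S), f A) := fun f => by
    rw [← Finset.sum_sdiff (Finset.subset_univ (insert ∅ S)), Finset.sum_insert hempS, hSsum]
    ring
  set R := ∑ A ∈ (Finset.univ \ insert ∅ S), (p A).toReal with hR
  have hone : (p ∅).toReal + (∑ u ∈ G, (p {u}).toReal + R) = 1 := by
    rw [hR, ← hsplit fun A => (p A).toReal, p.sum_toReal]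
  rw [hsplit]
  have b1 : (p ∅).toReal * ((J (decide (∅ : Finset (Fin n)).Nonempty) true).toReal * F ∅ true +
      (J (decide (∅ : Finset (Fin n)).Nonempty) false).toReal * F ∅ false) ≤
      (p ∅).toReal * m := by
    gcongr
    have hd : decide (∅ : Finset (Fin n)).Nonempty = false := by simp
    rw [hd]
    have h4 := mul_le_mul_of_nonneg_left ((hj ∅).trans hjm) (h0j false)
    have h5 := mul_le_mul_of_nonneg_left (hi.trans him) (h0j' false)
    calc _ ≤ (J false true).toReal * m + (J false false).toReal * m := add_le_add h4 h5
      _ = m := by rw [← add_mul, hJ, one_mul]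
  have b2 : ∑ u ∈ G, (p {u}).toReal * ((J (decide ({u} : Finset (Fin n)).Nonempty) true).toReal *
      F {u} true + (J (decide ({u} : Finset (Fin n)).Nonempty) false).toReal * F {u} false) ≤
      (∑ u ∈ G, (p {u}).toReal) * (x * fj + y * fs) := by
    rw [Finset.sum_mul]
    refine Finset.sum_le_sum fun u hu => ?_
    have hd : decide ({u} : Finset (Fin n)).Nonempty = true := by simp
    rw [hd]
    have h4 := hj {u}; have h5 := hs u hu
    gcongr
  have b3 : ∑ A ∈ (Finset.univ \ insert ∅ S), (p A).toReal *
      ((J (decide A.Nonempty) true).toReal * F A true +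
      (J (decide A.Nonempty) false).toReal * F A false) ≤ R * (x * fj + y * fb) := by
    rw [hR, Finset.sum_mul]
    refine Finset.sum_le_sum fun A hA => ?_
    have hA0 : A ≠ ∅ := by
      rintro rfl; simp at hA
    have hd : decide A.Nonempty = true := by simpa using Finset.nonempty_iff_ne_empty.2 hA0
    rw [hd]
    have h4 := hj A; have h5 := hb A hA0
    gcongr
  set a := (p ∅).toReal
  set σ := ∑ u ∈ G, (p {u}).toReal
  have hRe : R = 1 - a - σ := by linarith
  have hyx : y = 1 - x := by linarith
  have : a * m + σ * (x * fj + y * fs) + R * (x * fj + y * fb) =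
      x * (a * m + (1 - a) * fj) + y * (a * m + (1 - a - σ) * fb + σ * fs) := by
    rw [hRe, hyx]; ring
  nlinarith [mul_le_mul_of_nonneg_left h1 hx0, mul_le_mul_of_nonneg_left h2 hy0]

end Send

/-! ### Levels of the access probability -/

/-- The parameters of the analysis, with the inequalities between them that it needs. Here `Tj` is
the window size of the jammer. At levels of load less than `U`, successes are frequent enough to pay
for all busy steps that are not jammed. The number of levels of load at least `U` is at most `M`. -/
structure Setup where
  n : ℕ
  pHat : ℝ
  γ : ℝ
  ε : ℝ
  Tj : ℝ
  U : ℝ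
  M : ℝ
  two_le_n : 2 ≤ n
  pHat_pos : 0 < pHat
  pHat_le : pHat ≤ 1 / 24
  γ_pos : 0 < γ
  γ_le : γ ≤ 1 / 10
  ε_pos : 0 < ε
  ε_le : ε ≤ 1
  one_le_εT : 1 ≤ ε * Tj
  U_eq : U = 20000000 / ε ^ 2
  four_U_le : 4 * U ≤ n * pHat
  log_le_M : 3 * Real.log n / γ ≤ M
  Tj_le_exp : 8000 * Tj * (3200 / ε) ≤ Real.exp (1 / (2 * γ))
  M_le_exp : 8 * M + 2 ≤ Real.exp (1 / (2 * γ))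

namespace Setup

variable (P : Setup)

/-- The access probability at level `k`. -/
noncomputable def lev (k : ℕ) : ℝ := P.pHat / (1 + P.γ) ^ k

/-- The load at level `k`: if all nodes have access probability `P.lev k`, then nobody transmits
with probability `exp (-P.load k)`. -/
noncomputable def load (k : ℕ) : ℝ := -(P.n * Real.log (1 - P.lev k))

theorem lev_pos (k : ℕ) : 0 < P.lev k := by
  have := P.γ_pos; have := P.pHat_pos; unfold lev; positivity

theorem lev_le (k : ℕ) : P.lev k ≤ 1 / 24 := by
  have := P.γ_pos; have := P.pHat_pos
  refine le_trans ?_ P.pHat_le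
  exact div_le_self (by positivity) (one_le_pow₀ (by linarith))

theorem lev_succ (k : ℕ) : P.lev k = (1 + P.γ) * P.lev (k + 1) := by
  have := P.γ_pos
  unfold lev; rw [pow_succ]; field_simp

theorem neg_log_bounds {q : ℝ} (h1 : q < 1) :
    q ≤ -Real.log (1 - q) ∧ -Real.log (1 - q) ≤ q / (1 - q) := by
  have hp : 0 < 1 - q := by linarith
  refine ⟨by have := Real.log_le_sub_one_of_pos hp; linarith, ?_⟩
  have := Real.log_le_sub_one_of_pos (inv_pos.2 hp)
  rw [Real.log_inv] at this
  refine this.trans (le_of_eq ?_)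
  field_simp
  ring

theorem n_pos : (0 : ℝ) < P.n := by
  have := P.two_le_n; exact_mod_cast (by omega : 0 < P.n)

theorem le_load (k : ℕ) : P.n * P.lev k ≤ P.load k := by
  have h := (neg_log_bounds (q := P.lev k) (by have := P.lev_le k; linarith)).1
  have := mul_le_mul_of_nonneg_left h P.n_pos.le
  unfold load; linarith

theorem load_le (k : ℕ) : P.load k ≤ P.n * (P.lev k / (1 - P.lev k)) := by
  have h := (neg_log_bounds (q := P.lev k) (by have := P.lev_le k; linarith)).2
  have := mul_le_mul_of_nonneg_left h P.n_pos.le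
  unfold load; linarith

theorem load_pos (k : ℕ) : 0 < P.load k :=
  lt_of_lt_of_le (mul_pos P.n_pos (P.lev_pos k)) (P.le_load k)

theorem load_succ_le (k : ℕ) : P.load (k + 1) ≤ P.load k := by
  have h1 := P.lev_succ k
  have h2 := P.lev_pos (k + 1)
  have h3 := P.lev_le k
  have := P.γ_pos
  unfold load
  have : Real.log (1 - P.lev k) ≤ Real.log (1 - P.lev (k + 1)) :=
    Real.log_le_log (by linarith) (by nlinarith)
  nlinarith [P.n_pos]

theorem load_antitone : Antitone P.load := antitone_nat_of_succ_le P.load_succ_le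

theorem load_le_succ (k : ℕ) : P.load k ≤ (1 + 2 * P.γ) * P.load (k + 1) := by
  have h1 := P.lev_succ k
  have h2 := P.lev_pos (k + 1)
  have h3 := P.lev_le k
  have hγ := P.γ_pos
  have h4 : P.lev (k + 1) < P.lev k := by nlinarith
  have h5 := (neg_log_bounds (q := P.lev (k + 1)) (by linarith)).1
  have hq : 0 < 1 - P.lev k := by linarith
  have hq' : 0 < 1 - P.lev (k + 1) := by linarith
  have h6 : Real.log (1 - P.lev (k + 1)) - Real.log (1 - P.lev k) ≤
      2 * P.γ * P.lev (k + 1) := by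
    rw [← Real.log_div hq'.ne' hq.ne']
    refine (Real.log_le_sub_one_of_pos (div_pos hq' hq)).trans ?_
    rw [div_sub_one hq.ne', div_le_iff₀ hq]
    nlinarith [mul_pos hγ h2]
  have h7 : -Real.log (1 - P.lev k) ≤ (1 + 2 * P.γ) * -Real.log (1 - P.lev (k + 1)) := by
    nlinarith
  unfold load
  have := mul_le_mul_of_nonneg_left h7 P.n_pos.le
  linarith

theorem load_pred_le (k : ℕ) : P.load (k - 1) ≤ (1 + 2 * P.γ) * P.load k := by
  rcases k with _ | k
  · have := P.load_pos 0; have := P.γ_pos; simp only [Nat.zero_sub]; nlinarith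
  · exact P.load_le_succ k

theorem U_ge : 20000000 ≤ P.U := by
  have h1 := P.ε_pos; have h2 := P.ε_le
  rw [P.U_eq, le_div_iff₀ (by positivity)]
  nlinarith

theorem U_mul : P.U * P.ε ^ 2 = 20000000 := by
  have := P.ε_pos; rw [P.U_eq]; field_simp

theorem load_zero_ge : 4 * P.U ≤ P.load 0 :=
  P.four_U_le.trans (le_trans (le_of_eq (by simp [lev])) (P.le_load 0))

theorem log_n_nonneg : (0 : ℝ) ≤ Real.log P.n := Real.log_nonneg (by
  have := P.two_le_n; exact_mod_cast (by omega : 1 ≤ P.n))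

/-- A level of load at least `1` has index at most `M`. -/
theorem le_M_of_one_le_load {k : ℕ} (h : 1 ≤ P.load k) : (k : ℝ) + 1 ≤ P.M := by
  have h1 := P.γ_pos; have h2 := P.γ_le
  have hp := P.lev_le k; have hp0 := P.lev_pos k
  have h3 := h.trans (P.load_le k)
  have h4 : P.lev k / (1 - P.lev k) ≤ 2 * P.lev k := by
    rw [div_le_iff₀ (by linarith)]; nlinarith
  have h5 : 1 ≤ P.n * (2 * P.lev k) := h3.trans (mul_le_mul_of_nonneg_left h4 P.n_pos.le)
  have h6 : (1 + P.γ) ^ k ≤ P.n := by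
    have hpow : 0 < (1 + P.γ) ^ k := by positivity
    unfold lev at h5
    have h7 : P.n * (2 * (P.pHat / (1 + P.γ) ^ k)) = (2 * P.pHat * P.n) / (1 + P.γ) ^ k := by
      field_simp
    rw [h7, le_div_iff₀ hpow] at h5
    nlinarith [P.pHat_le, P.n_pos, P.pHat_pos]
  have h7 : k * Real.log (1 + P.γ) ≤ Real.log P.n := by
    rw [← Real.log_pow]; exact Real.log_le_log (by positivity) h6
  have h8 : P.γ / 2 ≤ Real.log (1 + P.γ) := by
    have := Real.one_sub_inv_le_log_of_pos (show 0 < 1 + P.γ by linarith)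
    refine le_trans ?_ this
    rw [le_sub_iff_add_le, ← le_sub_iff_add_le', inv_le_comm₀ (by linarith) (by linarith),
      inv_le_iff_one_le_mul₀ (by linarith)]
    nlinarith
  have hn : 1 / 2 < Real.log P.n := by
    refine lt_of_lt_of_le (by have := Real.log_two_gt_d9; linarith)
      (Real.log_le_log (by norm_num) (show (2 : ℝ) ≤ P.n by exact_mod_cast P.two_le_n))
  have h9 := P.log_le_M
  rw [div_le_iff₀ h1] at h9
  have hk : (0 : ℝ) ≤ k := Nat.cast_nonneg k
  by_contra hcon
  push Not at hcon
  have : 3 * Real.log P.n < ((k : ℝ) + 1) * P.γ := lt_of_le_of_lt h9 (by gcongr)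
  nlinarith

theorem exists_load_lt : ∃ k, P.load k < P.U := by
  by_contra hcon
  push Not at hcon
  obtain ⟨k, hk⟩ := exists_nat_gt P.M
  have := P.le_M_of_one_le_load (k := k) (by have := hcon k; have := P.U_ge; linarith)
  linarith

open Classical in
/-- The first level of load less than `U`. -/
noncomputable def kU : ℕ := Nat.find P.exists_load_lt

theorem U_le_load {k : ℕ} (h : k < P.kU) : P.U ≤ P.load k := by
  classical
  exact not_lt.1 (Nat.find_min P.exists_load_lt h)

theorem load_lt_U {k : ℕ} (h : P.kU ≤ k) : P.load k < P.U := by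
  classical
  exact lt_of_le_of_lt (P.load_antitone h) (Nat.find_spec P.exists_load_lt)

theorem kU_pos : 0 < P.kU := by
  by_contra h
  have h1 := P.load_lt_U (k := 0) (by omega)
  have h2 := P.load_zero_ge
  have := P.U_ge
  linarith

theorem kU_le_M : (P.kU : ℝ) ≤ P.M := by
  obtain ⟨m, hm⟩ : ∃ m, P.kU = m + 1 := ⟨P.kU - 1, by have := P.kU_pos; omega⟩
  have := P.le_M_of_one_le_load (k := m)
    (by have := P.U_le_load (k := m) (by omega); have := P.U_ge; linarith)
  rw [hm]; push_cast; exact this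

theorem one_le_M : 1 ≤ P.M := le_trans (by exact_mod_cast P.kU_pos) P.kU_le_M

/-! ### The potential -/

/-- The value of one unit of the remaining jamming budget. -/
noncomputable def h₀ : ℝ := 100 / P.ε

/-- The factor in `Setup.x`. It is so large that the slope of a top level pays for a decrease of the
potential by `Setup.κ` in each step of a whole round of the counter. -/
noncomputable def D : ℝ := 3200 / P.ε

/-- The decrease of the potential, by `Setup.phase`, in each step at a top level. -/
noncomputable def κ : ℝ := 200 / P.ε

/-- The scale below which the threshold estimate is ignored. If the estimate is larger, then a round
of the counter is long enough to pay for the change of all slopes when the estimate increases. -/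
noncomputable def y : ℝ := Real.exp P.U + 8 * P.M + 2

/-- The excess of the threshold estimate over `P.y`. -/
noncomputable def z (T : ℕ) : ℝ := max ((T : ℝ) - P.y) 0

/-- The slope of a top level. -/
noncomputable def x (z : ℝ) : ℝ := P.D * (P.y + z)

/-- The increase of the potential when level `j` is reached from level `j + 1`. It is in balance
with the frequency of the idle steps that cause this change, unless these are so rare that it is
cheaper to wait for the nodes to back off, or so frequent that the decrease of the threshold
estimate in idle steps pays for it. -/
noncomputable def slope (j : ℕ) (z : ℝ) : ℝ := min (P.x z) (max (Real.exp (P.load j)) z)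

/-- A level is top if idle steps at it are so rare that the nodes may be expected to back off before
one occurs. -/
def Top (k : ℕ) (z : ℝ) : Prop := P.x z ≤ Real.exp (P.load k)

open Classical in
/-- The additional value of one unit of the remaining jamming budget, at those levels where a change
of the level by one changes the probability of an idle step a lot. -/
noncomputable def extra (k : ℕ) (z : ℝ) : ℝ :=
  if k < P.kU ∧ ¬ P.Top k z ∧ 1 / (2 * P.γ) ≤ P.load k then
    20 / P.ε * Real.exp (-P.load k) * P.x z
  else 0

open Classical in
/-- The part of the potential that accounts for the position of the counter. At a top level, a
second round of the counter may be needed, if the flag `d` indicates that the nodes will not back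
off at the end of the current one. -/
noncomputable def phase (k c T : ℕ) (d : Bool) : ℝ :=
  if P.Top k (P.z T) then P.κ * (T - (c - 1)) + (if d = true then P.κ * T else 0)
  else 9 * (c - 1)

/-- The sum of the slopes of the levels from `k` on that have load at least `U`. -/
noncomputable def climb (k : ℕ) (z : ℝ) : ℝ := ∑ j ∈ Finset.Ico k P.kU, P.slope j z

/-- The potential of a synchronized state, if `cr` is the remaining jamming budget. At levels of
load at least `U`, it decreases by at least `1` per step, in expectation. -/
noncomputable def potential {m : ℕ} (s : SyncState m) (cr : ℝ) : ℝ :=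
  2 * P.z s.T ^ 2 + P.climb s.k (P.z s.T) + P.phase s.k s.c s.T s.dirty
    + (P.h₀ + P.extra s.k (P.z s.T)) * cr

theorem h₀_ge : 100 ≤ P.h₀ := by
  have h1 := P.ε_pos; have h2 := P.ε_le
  unfold h₀; rw [le_div_iff₀ h1]; linarith

theorem ε_mul_h₀ : P.ε * P.h₀ = 100 := by have := P.ε_pos; unfold h₀; field_simp

theorem D_eq : P.D = 32 * P.h₀ := by unfold D h₀; ring

theorem κ_eq : P.κ = 2 * P.h₀ := by unfold κ h₀; ring

theorem exp_U_ge : 20000000 / P.ε ^ 2 ≤ Real.exp P.U := by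
  have := Real.add_one_le_exp P.U; rw [← P.U_eq]; linarith

theorem h₀_le_exp_U : 100000 * P.h₀ ≤ Real.exp P.U := by
  have h1 := P.ε_pos; have h2 := P.ε_le
  refine le_trans ?_ P.exp_U_ge
  unfold h₀
  rw [le_div_iff₀ (by positivity)]
  have : 100000 * (100 / P.ε) * P.ε ^ 2 = 10000000 * P.ε := by field_simp; ring
  rw [this]; linarith

theorem y_ge : Real.exp P.U + 8 * P.M + 2 ≤ P.y := le_rfl

theorem y_pos : 0 < P.y := by
  have := P.y_ge; have := Real.exp_pos P.U; have := P.one_le_M; linarith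

theorem z_nonneg (T : ℕ) : 0 ≤ P.z T := le_max_right _ _

theorem le_y_add_z (T : ℕ) : (T : ℝ) ≤ P.y + P.z T := by
  have := le_max_left ((T : ℝ) - P.y) 0; unfold z; linarith

theorem z_mono {S T : ℕ} (h : S ≤ T) : P.z S ≤ P.z T := by
  unfold z; gcongr

theorem z_add_two_le (T : ℕ) : P.z (T + 2) ≤ P.z T + 2 := by
  unfold z
  push_cast
  refine max_le ?_ ?_
  · have := le_max_left ((T : ℝ) - P.y) 0; linarith
  · have := le_max_right ((T : ℝ) - P.y) 0; linarith

theorem z_eq_zero {T : ℕ} (h : (T : ℝ) ≤ P.y) : P.z T = 0 := max_eq_right (by linarith)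

theorem x_pos {z : ℝ} (hz : 0 ≤ z) : 0 < P.x z := by
  have := P.y_pos; have := P.h₀_ge; unfold x; rw [P.D_eq]; positivity

theorem x_ge {z : ℝ} (hz : 0 ≤ z) : 3200 * (P.y + z) ≤ P.x z := by
  have h1 := P.y_pos; have h2 := P.h₀_ge; unfold x; rw [P.D_eq]; nlinarith

theorem x_ge' {z : ℝ} (hz : 0 ≤ z) : 32 * P.h₀ * Real.exp P.U ≤ P.x z := by
  have h1 := P.y_ge; have h2 := P.h₀_ge; have := P.one_le_M
  unfold x; rw [P.D_eq]
  have : Real.exp P.U ≤ P.y + z := by linarith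
  gcongr

theorem x_mono {z z' : ℝ} (h : z' ≤ z) : P.x z' ≤ P.x z := by
  have h2 := P.h₀_ge; unfold x; rw [P.D_eq]; gcongr

theorem slope_mono {j : ℕ} {z z' : ℝ} (h : z' ≤ z) : P.slope j z' ≤ P.slope j z := by
  unfold slope; exact min_le_min (P.x_mono h) (max_le_max le_rfl h)

theorem slope_nonneg {j : ℕ} {z : ℝ} (hz : 0 ≤ z) : 0 ≤ P.slope j z := by
  unfold slope; exact le_min (P.x_pos hz).le (le_max_of_le_right hz)

theorem slope_antitone {i j : ℕ} (z : ℝ) (h : i ≤ j) : P.slope j z ≤ P.slope i z := by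
  unfold slope
  exact min_le_min le_rfl (max_le_max (Real.exp_le_exp.2 (P.load_antitone h)) le_rfl)

theorem slope_of_not_top {k : ℕ} {z : ℝ} (hz : 0 ≤ z) (h : ¬ P.Top k z) :
    P.slope k z = max (Real.exp (P.load k)) z := by
  unfold slope
  unfold Top at h
  push Not at h
  refine min_eq_right (max_le h.le ?_)
  have := P.x_ge hz; have := P.y_pos; linarith

theorem slope_of_top {k : ℕ} {z : ℝ} (h : P.Top k z) : P.slope k z = P.x z := by
  unfold slope; exact min_eq_left (le_max_of_le_left h)

theorem slope_ge_exp_U {k : ℕ} {z : ℝ} (hz : 0 ≤ z) (h : k < P.kU) :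
    Real.exp P.U ≤ P.slope k z := by
  unfold slope
  refine le_min ?_ (le_max_of_le_left (Real.exp_le_exp.2 (P.U_le_load h)))
  have := P.x_ge' hz; have := P.h₀_ge; have := Real.exp_pos P.U; nlinarith

theorem top_of_le {i j : ℕ} {z z' : ℝ} (h : P.Top j z) (hij : i ≤ j) (hz : z' ≤ z) :
    P.Top i z' :=
  (P.x_mono hz).trans (le_trans h (Real.exp_le_exp.2 (P.load_antitone hij)))

theorem lt_kU_of_top {k : ℕ} {z : ℝ} (hz : 0 ≤ z) (h : P.Top k z) : k < P.kU := by
  by_contra hk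
  have h1 := Real.exp_lt_exp.2 (P.load_lt_U (not_lt.1 hk))
  have h2 := P.x_ge' hz
  have := P.h₀_ge; have := Real.exp_pos P.U
  unfold Top at h; nlinarith

theorem extra_nonneg (k : ℕ) {z : ℝ} (hz : 0 ≤ z) : 0 ≤ P.extra k z := by
  have := P.ε_pos; have := (P.x_pos hz).le
  unfold extra; split_ifs <;> positivity

theorem extra_of_top {k : ℕ} {z : ℝ} (h : P.Top k z) : P.extra k z = 0 := by
  unfold extra; rw [if_neg]; rintro ⟨-, h', -⟩; exact h' h

theorem extra_of_kU_le {k : ℕ} {z : ℝ} (h : P.kU ≤ k) : P.extra k z = 0 := by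
  unfold extra; rw [if_neg]; rintro ⟨h', -, -⟩; omega

/-- At a level that is not top and at which a change of the level matters a lot, the slope is a
considerable fraction of the slope of a top level. -/
theorem x_le_slope {k : ℕ} {z : ℝ} (hz : 0 ≤ z) (hk : k < P.kU) (ht : ¬ P.Top k z)
    (hl : 1 / (2 * P.γ) ≤ P.load k) : P.x z ≤ 4 * P.D * P.slope k z := by
  have hD : 0 < P.D := by have := P.h₀_ge; rw [P.D_eq]; positivity
  have h1 := Real.exp_le_exp.2 (P.U_le_load hk)
  have h2 := P.M_le_exp.trans (Real.exp_le_exp.2 hl)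
  have hy : P.y ≤ 2 * Real.exp (P.load k) := by unfold y; linarith
  rw [P.slope_of_not_top hz ht]
  unfold x
  have h3 := le_max_left (Real.exp (P.load k)) z
  have h4 := le_max_right (Real.exp (P.load k)) z
  have : P.y + z ≤ 4 * max (Real.exp (P.load k)) z := by linarith
  nlinarith

/-- At the levels where `Setup.extra` does not vanish, idle steps are so rare that the whole jamming
budget is worth little compared to the slope. -/
theorem extra_mul_le {k : ℕ} {z : ℝ} (hz : 0 ≤ z) (hk : k < P.kU) :
    P.extra k z * (P.ε * P.Tj) ≤ P.slope k z / 100 := by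
  unfold extra
  split_ifs with h
  · obtain ⟨-, ht, hl⟩ := h
    have h1 := P.x_le_slope hz hk ht hl
    have h2 := P.slope_nonneg (j := k) hz
    have h3 : Real.exp (-P.load k) * Real.exp (1 / (2 * P.γ)) ≤ 1 := by
      rw [← Real.exp_add]; exact Real.exp_le_one_iff.2 (by linarith)
    have h4 := P.Tj_le_exp
    have hε := P.ε_pos
    have hTj : 0 < P.Tj := by
      have := P.one_le_εT; by_contra hc; push Not at hc; nlinarith
    have e : 20 / P.ε * Real.exp (-P.load k) * P.x z * (P.ε * P.Tj) =
        20 * P.Tj * Real.exp (-P.load k) * P.x z := by field_simp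
    rw [e]
    have he := Real.exp_pos (-P.load k)
    calc 20 * P.Tj * Real.exp (-P.load k) * P.x z
        ≤ 20 * P.Tj * Real.exp (-P.load k) * (4 * P.D * P.slope k z) := by gcongr
      _ = (Real.exp (-P.load k) * (8000 * P.Tj * (3200 / P.ε))) * (P.slope k z / 100) := by
        unfold D; ring
      _ ≤ (Real.exp (-P.load k) * Real.exp (1 / (2 * P.γ))) * (P.slope k z / 100) := by gcongr
      _ ≤ 1 * (P.slope k z / 100) := by gcongr
      _ = _ := one_mul _
  · have := P.slope_nonneg (j := k) hz; rw [zero_mul]; positivity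

theorem extra_mul_le' {k : ℕ} {z cr : ℝ} (hz : 0 ≤ z) (hk : k < P.kU) (hcr : cr ≤ P.ε * P.Tj) :
    P.extra k z * cr ≤ P.slope k z / 100 :=
  (mul_le_mul_of_nonneg_left hcr (P.extra_nonneg k hz)).trans (P.extra_mul_le hz hk)

theorem extra_le {k : ℕ} {z : ℝ} (hz : 0 ≤ z) (hk : k < P.kU) :
    P.extra k z ≤ P.slope k z / 100 := by
  simpa using P.extra_mul_le' hz hk P.one_le_εT

theorem climb_mono {k : ℕ} {z z' : ℝ} (h : z' ≤ z) : P.climb k z' ≤ P.climb k z :=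
  Finset.sum_le_sum fun _ _ => P.slope_mono h

theorem climb_succ {k : ℕ} (z : ℝ) (h : k < P.kU) :
    P.climb k z = P.slope k z + P.climb (k + 1) z :=
  Finset.sum_eq_sum_Ico_succ_bot h _

theorem climb_of_kU_le {k : ℕ} (z : ℝ) (h : P.kU ≤ k) : P.climb k z = 0 := by
  unfold climb; rw [Finset.Ico_eq_empty (by omega), Finset.sum_empty]

theorem climb_nonneg (k : ℕ) {z : ℝ} (hz : 0 ≤ z) : 0 ≤ P.climb k z :=
  Finset.sum_nonneg fun _ _ => P.slope_nonneg hz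

theorem climb_succ_le (k : ℕ) {z : ℝ} (hz : 0 ≤ z) : P.climb (k + 1) z ≤ P.climb k z := by
  rcases lt_or_ge k P.kU with h | h
  · rw [P.climb_succ z h]; have := P.slope_nonneg (j := k) hz; linarith
  · rw [P.climb_of_kU_le z h, P.climb_of_kU_le z (by omega)]

theorem climb_le_add {k : ℕ} {z z' b : ℝ} (hb : 0 ≤ b)
    (h : ∀ j ∈ Finset.Ico k P.kU, P.slope j z' ≤ P.slope j z + b) :
    P.climb k z' ≤ P.climb k z + b * P.M := by
  unfold climb
  refine (Finset.sum_le_sum h).trans ?_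
  rw [Finset.sum_add_distrib, Finset.sum_const, nsmul_eq_mul, mul_comm, Nat.card_Ico]
  gcongr
  exact le_trans (by exact_mod_cast Nat.sub_le _ _) P.kU_le_M

theorem slope_le_add {j : ℕ} {z z' : ℝ} (h : z' ≤ z + 2) :
    P.slope j z' ≤ P.slope j z + 2 * P.D := by
  have h1 := P.h₀_ge
  have hD : 1 ≤ P.D := by rw [P.D_eq]; linarith
  have h2 : P.x z' ≤ P.x z + 2 * P.D := by unfold x; nlinarith
  unfold slope
  rw [← min_add_add_right]
  refine min_le_min h2 (max_le ?_ ?_)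
  · have := le_max_left (Real.exp (P.load j)) z; linarith
  · have := le_max_right (Real.exp (P.load j)) z; linarith

theorem slope_le_add_of_not_top {j : ℕ} {z z' : ℝ} (hz : 0 ≤ z) (ht : ¬ P.Top j z)
    (h : z' ≤ z + 2) : P.slope j z' ≤ P.slope j z + 2 := by
  rw [P.slope_of_not_top hz ht]
  refine (min_le_right _ _).trans (max_le ?_ ?_)
  · have := le_max_left (Real.exp (P.load j)) z; linarith
  · have := le_max_right (Real.exp (P.load j)) z; linarith

theorem phase_nonneg {k c T : ℕ} {d : Bool} (h1 : 1 ≤ c) (h2 : c ≤ T) : 0 ≤ P.phase k c T d := by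
  have h1' : (1 : ℝ) ≤ c := by exact_mod_cast h1
  have h2' : (c : ℝ) ≤ T := by exact_mod_cast h2
  have := P.h₀_ge
  have hκ : 0 ≤ P.κ := by rw [P.κ_eq]; linarith
  unfold phase
  split_ifs
  · have := mul_nonneg hκ (show (0 : ℝ) ≤ T - (c - 1) by linarith)
    have := mul_nonneg hκ (show (0 : ℝ) ≤ T by linarith)
    linarith
  · have := mul_nonneg hκ (show (0 : ℝ) ≤ T - (c - 1) by linarith)
    linarith
  · linarith

theorem potential_nonneg {m : ℕ} {s : SyncState m} (hs : s.Valid) {cr : ℝ} (hcr : 0 ≤ cr) :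
    0 ≤ P.potential s cr := by
  have h1 := P.climb_nonneg s.k (P.z_nonneg s.T)
  have h2 := P.phase_nonneg (k := s.k) (d := s.dirty) hs.one_le_c hs.c_le_T
  have h3 := P.extra_nonneg s.k (P.z_nonneg s.T)
  have h4 := P.h₀_ge
  unfold potential
  positivity

end Setup

namespace Setup

variable (P : Setup)

/-! ### Changes of the potential -/

/-- The increase of the quadratic part when the nodes back off, which happens at most once in `T`
steps. -/
theorem two_mul_z_sq_le {T : ℕ} (hT : 1 ≤ T) :
    2 * P.z (T + 2) ^ 2 ≤ 2 * P.z T ^ 2 + 8 * T := by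
  have h0 := P.z_nonneg T
  have h0' := P.z_nonneg (T + 2)
  have h1 := P.z_add_two_le T
  have hy : 1 ≤ P.y := by
    have := P.y_ge; have := Real.exp_pos P.U; have := P.one_le_M; linarith
  have hT' : (1 : ℝ) ≤ T := by exact_mod_cast hT
  have h2 : P.z T ≤ T - 1 := by unfold z; exact max_le (by linarith) (by linarith)
  nlinarith

/-- When the nodes back off at a level that is not top, the slopes of the levels further on increase
by at most `T` altogether, which a round of the counter has paid for. -/
theorem climb_backoff_le {k T : ℕ} (ht : ¬ P.Top k (P.z T)) :
    P.climb (k + 1) (P.z (T + 2)) ≤ P.climb (k + 1) (P.z T) + T := by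
  rcases le_or_gt ((T : ℝ) + 2) P.y with h | h
  · rw [P.z_eq_zero (T := T + 2) (by push_cast; exact h), P.z_eq_zero (T := T) (by linarith)]
    have : (0 : ℝ) ≤ T := Nat.cast_nonneg T
    linarith
  · have h1 := P.climb_le_add (k := k + 1) (z := P.z T) (z' := P.z (T + 2)) (b := 2) (by norm_num)
      (fun j hj => P.slope_le_add_of_not_top (P.z_nonneg T)
        (fun hj' => ht (P.top_of_le hj' (by have := Finset.mem_Ico.1 hj; omega) le_rfl))
        (P.z_add_two_le T))
    have := P.y_ge; have := Real.exp_pos P.U; have := P.one_le_M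
    linarith

/-- The counting part of a step and the change of the jamming budget, at a level that is not top.
The round of the counter that precedes a backing off contributes `9 * (T - 1)` to the potential,
which covers the increase of the other parts by `8 * T` and `T`. -/
theorem potential_count_le_of_not_top {m : ℕ} {s : SyncState m} (h1 : 1 ≤ s.c) (h2 : s.c ≤ s.T)
    (ht : ¬ P.Top s.k (P.z s.T)) {cr cr' : ℝ} (h0 : 0 ≤ cr)
    (hcr' : cr' ≤ P.ε * P.Tj) (hd : cr - 1 ≤ cr') :
    P.potential s.count cr' ≤
      P.potential s cr + 9 + (P.h₀ + P.extra s.k (P.z s.T)) * (cr' - cr) := by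
  have h1' : (1 : ℝ) ≤ s.c := by exact_mod_cast h1
  have h2' : (s.c : ℝ) ≤ s.T := by exact_mod_cast h2
  unfold SyncState.count
  split_ifs with hc hdirty
  · unfold potential phase
    simp only [if_neg ht]
    push_cast
    nlinarith
  · unfold potential
    dsimp only
    have ht2 : ¬ P.Top (s.k + 1) (P.z (s.T + 2)) := fun h =>
      ht (P.top_of_le h (Nat.le_succ _) (P.z_mono (by omega)))
    have e1 : P.phase (s.k + 1) 1 (s.T + 2) false = 0 := by unfold phase; rw [if_neg ht2]; simp
    have e2 : P.phase s.k s.c s.T s.dirty = 9 * (s.c - 1) := by unfold phase; rw [if_neg ht]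
    have hcT : (s.c : ℝ) = s.T := by exact_mod_cast (by omega : s.c = s.T)
    rw [e1, e2, hcT]
    have h3 := P.two_mul_z_sq_le (h1.trans h2)
    have h4 := P.climb_backoff_le ht
    have hz := P.z_nonneg s.T
    have hz2 := P.z_nonneg (s.T + 2)
    have key : P.climb (s.k + 1) (P.z s.T) + P.extra (s.k + 1) (P.z (s.T + 2)) * cr' ≤
        P.climb s.k (P.z s.T) + P.extra s.k (P.z s.T) * cr' := by
      rcases lt_or_ge s.k P.kU with hk | hk
      · rw [P.climb_succ _ hk]
        have h6 : P.extra (s.k + 1) (P.z (s.T + 2)) * cr' ≤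
            (P.slope s.k (P.z s.T) + 2) / 100 := by
          have h7 : P.slope (s.k + 1) (P.z (s.T + 2)) ≤ P.slope s.k (P.z s.T) + 2 :=
            (P.slope_antitone _ (Nat.le_succ _)).trans
              (P.slope_le_add_of_not_top hz ht (P.z_add_two_le _))
          rcases lt_or_ge (s.k + 1) P.kU with hk2 | hk2
          · have := P.extra_mul_le' hz2 hk2 hcr'
            linarith
          · rw [P.extra_of_kU_le hk2, zero_mul]
            have := P.slope_nonneg (j := s.k) hz
            linarith
        have h7 := P.extra_le hz hk
        have h8 := P.slope_ge_exp_U hz hk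
        have h9 := P.h₀_le_exp_U
        have h10 := P.h₀_ge
        have h11 := P.extra_nonneg s.k hz
        have h12 : -P.extra s.k (P.z s.T) ≤ P.extra s.k (P.z s.T) * cr' := by nlinarith
        linarith
      · rw [P.climb_of_kU_le _ hk, P.climb_of_kU_le _ (by omega), P.extra_of_kU_le hk,
          P.extra_of_kU_le (by omega)]
    linarith
  · unfold potential phase
    simp only [if_neg ht]
    push_cast
    nlinarith

/-- The counting part of a step and the change of the jamming budget, at a top level: every step
decreases the potential by `κ`. When the nodes back off, the slope of the level they leave pays for
a new round. -/
theorem potential_count_le_of_top {m : ℕ} {s : SyncState m} (h1 : 1 ≤ s.c) (h2 : s.c ≤ s.T)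
    (ht : P.Top s.k (P.z s.T)) {cr cr' : ℝ} (hcr' : cr' ≤ P.ε * P.Tj) :
    P.potential s.count cr' ≤ P.potential s cr - P.κ + P.h₀ * (cr' - cr) := by
  have h1' : (1 : ℝ) ≤ s.c := by exact_mod_cast h1
  have h2' : (s.c : ℝ) ≤ s.T := by exact_mod_cast h2
  have hκ := P.κ_eq
  have hh := P.h₀_ge
  unfold SyncState.count
  split_ifs with hc hdirty
  · unfold potential phase
    have hcT : (s.c : ℝ) = s.T := by exact_mod_cast (by omega : s.c = s.T)
    simp only [if_pos ht, hdirty.1, if_true, P.extra_of_top ht, hcT]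
    simp
    nlinarith
  · unfold potential
    dsimp only
    have hcT : (s.c : ℝ) = s.T := by exact_mod_cast (by omega : s.c = s.T)
    have hz := P.z_nonneg s.T
    have hz2 := P.z_nonneg (s.T + 2)
    have hy := P.y_ge
    have hM := P.one_le_M
    have hU := P.h₀_le_exp_U
    have hTy := P.le_y_add_z s.T
    have hk := P.lt_kU_of_top hz ht
    have hdf : s.dirty = false := by
      by_contra hd'
      exact hdirty ⟨by simpa using hd', by omega⟩
    have e2 : P.phase s.k s.c s.T s.dirty = P.κ := by
      unfold phase; rw [if_pos ht, hcT, hdf]; simp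
    have e1 : P.phase (s.k + 1) 1 (s.T + 2) false ≤ P.κ * (s.T + 2) := by
      unfold phase
      simp only [Bool.false_eq_true, if_false, Nat.cast_one, sub_self, mul_zero]
      split_ifs with h
      · push_cast; linarith
      · rw [P.κ_eq]; positivity
    have hx : P.x (P.z s.T) = 32 * P.h₀ * (P.y + P.z s.T) := by unfold x; rw [P.D_eq]
    have h3 := P.two_mul_z_sq_le (h1.trans h2)
    have h4 : P.climb (s.k + 1) (P.z (s.T + 2)) ≤
        P.climb (s.k + 1) (P.z s.T) + 2 * P.D * P.M :=
      P.climb_le_add (by rw [P.D_eq]; positivity) fun j _ => P.slope_le_add (P.z_add_two_le _)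
    have h5 := P.climb_succ (P.z s.T) hk
    rw [P.slope_of_top ht] at h5
    have h6 : P.extra (s.k + 1) (P.z (s.T + 2)) * cr' ≤ (P.x (P.z s.T) + 2 * P.D) / 100 := by
      rcases lt_or_ge (s.k + 1) P.kU with hk2 | hk2
      · have h7 := P.extra_mul_le' hz2 hk2 hcr'
        have h8 : P.slope (s.k + 1) (P.z (s.T + 2)) ≤ P.x (P.z s.T) + 2 * P.D :=
          (P.slope_le_add (P.z_add_two_le _)).trans
            (by unfold slope; gcongr; exact min_le_left _ _)
        linarith
      · rw [P.extra_of_kU_le hk2, zero_mul, hx, P.D_eq]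
        have := P.y_pos
        positivity
    rw [e2, P.extra_of_top ht, hcT] at *
    rw [P.D_eq] at h4 h6
    rw [hκ] at *
    have g1 : P.h₀ * P.M ≤ P.h₀ * ((P.y + P.z s.T) / 8) := by gcongr; linarith [Real.exp_pos P.U]
    have g2 : P.h₀ * s.T ≤ P.h₀ * (P.y + P.z s.T) := by gcongr
    have g3 : P.h₀ * 100 ≤ P.h₀ * (P.y + P.z s.T) := by gcongr; linarith
    have g4 : (s.T : ℝ) ≤ P.h₀ * (P.y + P.z s.T) / 100 := by nlinarith
    nlinarith
  · unfold potential phase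
    simp only [if_pos ht, P.extra_of_top ht]
    push_cast
    nlinarith

/-- A success does not change the potential at levels of load less than `U`. -/
theorem potential_success_le {m : ℕ} {k c T : ℕ} {d : Bool} {hi hi' : Option (Fin m)}
    (hk : P.kU ≤ k) (cr : ℝ) :
    P.potential ⟨k + 1, hi', c, T, d⟩ cr ≤ P.potential ⟨k, hi, c, T, d⟩ cr := by
  have hz := P.z_nonneg T
  have ht : ∀ i, P.kU ≤ i → ¬ P.Top i (P.z T) := fun i hi h => by
    have := P.lt_kU_of_top hz h; omega
  unfold potential phase
  simp only [if_neg (ht k hk), if_neg (ht (k + 1) (by omega)), P.climb_of_kU_le _ hk,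
    P.climb_of_kU_le _ (show P.kU ≤ k + 1 by omega), P.extra_of_kU_le hk,
    P.extra_of_kU_le (show P.kU ≤ k + 1 by omega)]
  exact le_rfl

theorem potential_success_le_of_not_top {m : ℕ} {k c T : ℕ} {d : Bool} {hi hi' : Option (Fin m)}
    (hk : k < P.kU) (ht : ¬ P.Top k (P.z T)) {cr : ℝ}
    (h0 : 0 ≤ cr) (hcr : cr ≤ P.ε * P.Tj) :
    P.potential ⟨k + 1, hi', c, T, d⟩ cr ≤
      P.potential ⟨k, hi, c, T, d⟩ cr - 99 / 100 * P.slope k (P.z T) := by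
  have hz := P.z_nonneg T
  have ht' : ¬ P.Top (k + 1) (P.z T) := fun h => ht (P.top_of_le h (Nat.le_succ _) le_rfl)
  have h1 : P.extra (k + 1) (P.z T) * cr ≤ P.slope k (P.z T) / 100 := by
    rcases lt_or_ge (k + 1) P.kU with hk2 | hk2
    · have := P.extra_mul_le' hz hk2 hcr
      have := P.slope_antitone (P.z T) (Nat.le_succ k)
      linarith
    · rw [P.extra_of_kU_le hk2, zero_mul]
      have := P.slope_nonneg (j := k) hz
      linarith
  have h2 := mul_nonneg (P.extra_nonneg k hz) h0
  unfold potential phase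
  simp only [if_neg ht, if_neg ht', P.climb_succ (P.z T) hk]
  linarith

theorem potential_success_le_of_top {m : ℕ} {k c T : ℕ} {d : Bool} {hi hi' : Option (Fin m)}
    (h1 : 1 ≤ c) (h2 : c ≤ T) (ht : P.Top k (P.z T)) {cr : ℝ}
    (hcr : cr ≤ P.ε * P.Tj) :
    P.potential ⟨k + 1, hi', c, T, d⟩ cr ≤
      P.potential ⟨k, hi, c, T, d⟩ cr - P.x (P.z T) / 2 := by
  have hz := P.z_nonneg T
  have hk := P.lt_kU_of_top hz ht
  have hx := P.x_ge hz
  have hTy := P.le_y_add_z T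
  have h3 : P.extra (k + 1) (P.z T) * cr ≤ P.x (P.z T) / 100 := by
    rcases lt_or_ge (k + 1) P.kU with hk2 | hk2
    · have := P.extra_mul_le' hz hk2 hcr
      have : P.slope (k + 1) (P.z T) ≤ P.x (P.z T) := min_le_left _ _
      linarith
    · rw [P.extra_of_kU_le hk2, zero_mul]
      have := P.x_pos hz
      linarith
  have hph : P.phase (k + 1) c T d ≤ P.phase k c T d + 9 * T := by
    have h1' : (1 : ℝ) ≤ c := by exact_mod_cast h1
    have h2' : (c : ℝ) ≤ T := by exact_mod_cast h2
    have hn := P.phase_nonneg (k := k) (d := d) h1 h2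
    by_cases ht' : P.Top (k + 1) (P.z T)
    · have : P.phase (k + 1) c T d = P.phase k c T d := by
        unfold phase; rw [if_pos ht', if_pos ht]
      linarith
    · have : P.phase (k + 1) c T d = 9 * (c - 1) := by unfold phase; rw [if_neg ht']
      linarith
  unfold potential
  simp only [P.climb_succ (P.z T) hk, P.slope_of_top ht, P.extra_of_top ht]
  nlinarith

open Classical in
/-- The increase of the potential that an idle step at level `k` may cause, beyond the value of the
jamming budget. It vanishes if the slope of the next level is compensated by the decrease of the
threshold estimate. -/
noncomputable def jump (k : ℕ) (z : ℝ) : ℝ :=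
  if Real.exp (P.load (k - 1)) ≤ z then 0 else 2 * min (P.x z) (Real.exp (P.load (k - 1)))

theorem jump_nonneg (k : ℕ) {z : ℝ} (hz : 0 ≤ z) : 0 ≤ P.jump k z := by
  have := (P.x_pos hz).le
  unfold jump; split_ifs <;> positivity

/-- In an idle step, the decrease of the quadratic part pays for a slope of size `z`. -/
theorem z_sq_pred_le {T : ℕ} (h1 : 1 ≤ P.z T) (hT : 1 ≤ T) :
    2 * P.z (T - 1) ^ 2 + 2 * P.z T ≤ 2 * P.z T ^ 2 := by
  have h0 := P.z_nonneg (T - 1)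
  have e : P.z T = T - P.y := by
    unfold z at *
    rcases le_total ((T : ℝ) - P.y) 0 with h | h
    · rw [max_eq_right h] at h1; linarith
    · exact max_eq_left h
  have e' : P.z (T - 1) = P.z T - 1 := by
    rw [e]
    unfold z
    rw [Nat.cast_sub hT, max_eq_left (by push_cast; linarith)]
    push_cast; ring
  rw [e']
  nlinarith

/-- The slope of the level reached in an idle step, with the accompanying changes of the other parts
of the potential, is covered by `Setup.jump` and the decrease of the threshold estimate. -/
theorem slope_pred_le_jump {k T : ℕ} (hT : 1 ≤ T) :
    2 * P.z (T - 1) ^ 2 + 3 / 2 * P.slope (k - 1) (P.z (T - 1)) ≤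
      2 * P.z T ^ 2 + P.jump k (P.z T) := by
  have hz := P.z_nonneg T
  have hz' := P.z_nonneg (T - 1)
  have hm := P.z_mono (Nat.sub_le T 1)
  have hx := P.x_pos hz
  unfold jump
  split_ifs with h
  · have h1 : 1 ≤ P.z T := le_trans (Real.one_le_exp (P.load_pos _).le) h
    have h2 := P.z_sq_pred_le h1 hT
    have h3 : P.slope (k - 1) (P.z (T - 1)) ≤ P.z T :=
      (min_le_right _ _).trans (max_le h hm)
    linarith
  · push Not at h
    have h3 : P.slope (k - 1) (P.z (T - 1)) ≤ min (P.x (P.z T)) (Real.exp (P.load (k - 1))) :=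
      min_le_min (P.x_mono hm) (max_le le_rfl (hm.trans h.le))
    have h4 : P.z (T - 1) ^ 2 ≤ P.z T ^ 2 := by gcongr
    have : 0 ≤ min (P.x (P.z T)) (Real.exp (P.load (k - 1))) :=
      le_min hx.le (Real.exp_pos _).le
    linarith

theorem phase_le {k c T : ℕ} {d : Bool} (h1 : 1 ≤ c) (h2 : c ≤ T) :
    P.phase k c T d ≤ 9 * (c - 1) + P.slope k (P.z T) / 8 := by
  have h1' : (1 : ℝ) ≤ c := by exact_mod_cast h1
  have h2' : (c : ℝ) ≤ T := by exact_mod_cast h2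
  have hz := P.z_nonneg T
  have hTy := P.le_y_add_z T
  have hh := P.h₀_ge
  unfold phase
  split_ifs with ht hd
  · rw [P.slope_of_top ht, x, P.D_eq, P.κ_eq]
    nlinarith
  · rw [P.slope_of_top ht, x, P.D_eq, P.κ_eq]
    nlinarith
  · have := P.slope_nonneg (j := k) hz; linarith

theorem extra_mul_le_slope (k : ℕ) {z cr : ℝ} (hz : 0 ≤ z) (hcr : cr ≤ P.ε * P.Tj) :
    P.extra k z * cr ≤ P.slope k z / 100 := by
  rcases lt_or_ge k P.kU with hk | hk
  · exact P.extra_mul_le' hz hk hcr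
  · rw [P.extra_of_kU_le hk, zero_mul]; have := P.slope_nonneg (j := k) hz; linarith

theorem climb_pred_le (k : ℕ) {z : ℝ} (hz : 0 ≤ z) :
    P.climb (k - 1) z ≤ P.slope (k - 1) z + P.climb k z := by
  rcases k with _ | k
  · have := P.slope_nonneg (j := 0) hz; simp only [Nat.zero_sub]; linarith
  · rcases lt_or_ge k P.kU with hk | hk
    · simp only [Nat.add_sub_cancel]; rw [P.climb_succ z hk]
    · simp only [Nat.add_sub_cancel]
      rw [P.climb_of_kU_le z hk]
      have := P.slope_nonneg (j := k) hz; have := P.climb_nonneg (k + 1) hz; linarith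

/-- The potential after an idle step, and after the counting part of that step. The increase by the
slope of the level reached is covered by `Setup.jump`. -/
theorem potential_idle_le {m : ℕ} {k c T : ℕ} {d : Bool} {hi hi' : Option (Fin m)}
    (h1 : 1 ≤ c) (h2 : c ≤ T) {cr cr' : ℝ} (h0 : 0 ≤ cr)
    (hcr' : cr' ≤ P.ε * P.Tj) (hd : cr' ≤ cr + 1) :
    P.potential (SyncState.count ⟨k - 1, hi', c, T - 1, true⟩) cr' ≤
      P.potential ⟨k, hi, c, T, d⟩ cr + P.h₀ + 9 + P.jump k (P.z T) := by
  have h1' : (1 : ℝ) ≤ c := by exact_mod_cast h1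
  have h2' : (c : ℝ) ≤ T := by exact_mod_cast h2
  have hT : 1 ≤ T := h1.trans h2
  have hz := P.z_nonneg T
  have hz' := P.z_nonneg (T - 1)
  have hm := P.z_mono (Nat.sub_le T 1)
  have hh := P.h₀_ge
  have hj := P.slope_pred_le_jump (k := k) hT
  have hE := mul_nonneg (P.extra_nonneg k hz) h0
  have hph := P.phase_nonneg (k := k) (d := d) h1 h2
  rcases Nat.lt_or_ge 1 T with hT1 | hT1
  · -- the threshold estimate stays positive, and the level decreases
    have hcl : P.climb (k - 1) (P.z (T - 1)) ≤
        P.slope (k - 1) (P.z (T - 1)) + P.climb k (P.z T) :=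
      (P.climb_pred_le k hz').trans (by gcongr; exact P.climb_mono hm)
    have hex := P.extra_mul_le_slope (k - 1) hz' hcr'
    have hs := P.slope_nonneg (j := k - 1) hz'
    have hph' : ∀ c' d', 1 ≤ c' → c' ≤ c + 1 → c' ≤ T - 1 →
        P.phase (k - 1) c' (T - 1) d' ≤
          P.phase k c T d + 9 + P.slope (k - 1) (P.z (T - 1)) / 8 := by
      intro c' d' g1 g2 g3
      have g4 := P.phase_le (k := k - 1) (d := d') g1 g3
      have g2' : (c' : ℝ) ≤ c + 1 := by exact_mod_cast g2
      have g3' : (c' : ℝ) ≤ T - 1 := by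
        have : (c' : ℝ) ≤ ((T - 1 : ℕ) : ℝ) := by exact_mod_cast g3
        rwa [Nat.cast_sub hT, Nat.cast_one] at this
      by_cases ht' : P.Top (k - 1) (P.z (T - 1))
      · have e : P.phase (k - 1) c' (T - 1) d' ≤ P.slope (k - 1) (P.z (T - 1)) / 8 := by
          have g1' : (1 : ℝ) ≤ c' := by exact_mod_cast g1
          have hTy := P.le_y_add_z (T - 1)
          rw [Nat.cast_sub hT, Nat.cast_one] at hTy
          unfold phase
          rw [if_pos ht', P.slope_of_top ht', x, P.D_eq, P.κ_eq, Nat.cast_sub hT, Nat.cast_one]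
          split_ifs <;> nlinarith
        linarith
      · have ht : ¬ P.Top k (P.z T) := fun h => ht' (P.top_of_le h (Nat.sub_le _ _) hm)
        have e : P.phase k c T d = 9 * (c - 1) := by unfold phase; rw [if_neg ht]
        rw [e]; linarith
    have hfin : ∀ c' d' hi'', 1 ≤ c' → c' ≤ c + 1 → c' ≤ T - 1 →
        P.potential (m := m) ⟨k - 1, hi'', c', T - 1, d'⟩ cr' ≤
          P.potential ⟨k, hi, c, T, d⟩ cr + P.h₀ + 9 + P.jump k (P.z T) := by
      intro c' d' hi'' g1 g2 g3
      have g := hph' c' d' g1 g2 g3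
      unfold potential
      dsimp only
      nlinarith
    unfold SyncState.count
    dsimp only
    split_ifs with hc hdirty
    · exact hfin _ _ _ le_rfl (by omega) (by omega)
    · exact absurd ⟨rfl, by omega⟩ hdirty
    · exact hfin _ _ _ (by omega) le_rfl (by omega)
  · -- the threshold estimate drops to `0`, and the nodes back off at once
    have hTe : T = 1 := by omega
    have hce : c = 1 := by omega
    subst hTe hce
    have hy := P.y_ge
    have hU := P.h₀_le_exp_U
    have hM := P.one_le_M
    have z1 : P.z 1 = 0 := P.z_eq_zero (by push_cast; linarith)
    have z2 : P.z 2 = 0 := P.z_eq_zero (by push_cast; linarith)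
    have hx := P.x_ge' le_rfl
    have hx0 := P.x_pos le_rfl
    have hcnt : SyncState.count (n := m) ⟨k - 1, hi', 1, 1 - 1, true⟩ =
        ⟨k - 1 + 1, hi', 1, 2, false⟩ := by simp [SyncState.count]
    rw [hcnt]
    have hjump : P.jump k 0 = 2 * min (P.x 0) (Real.exp (P.load (k - 1))) := by
      unfold jump; rw [if_neg (not_le.2 (Real.exp_pos _))]
    have hk' : k ≤ k - 1 + 1 := by omega
    have hcl : P.climb (k - 1 + 1) 0 ≤ P.climb k 0 := by
      rcases k with _ | k
      · simpa using P.climb_succ_le 0 (le_refl (0 : ℝ))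
      · simp
    have hsl : P.slope (k - 1 + 1) 0 ≤ min (P.x 0) (Real.exp (P.load (k - 1))) := by
      refine min_le_min le_rfl (max_le ?_ (Real.exp_pos _).le)
      exact Real.exp_le_exp.2 (P.load_antitone (Nat.le_succ _))
    have hph' : P.phase (k - 1 + 1) 1 2 false ≤ min (P.x 0) (Real.exp (P.load (k - 1))) := by
      unfold phase
      rw [z2]
      simp only [Bool.false_eq_true, if_false, Nat.cast_one, sub_self, mul_zero]
      split_ifs with ht
      · have : P.κ * (((2 : ℕ) : ℝ) - 0) + 0 ≤ P.x 0 := by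
          push_cast; rw [P.κ_eq]; nlinarith
        refine le_min this (this.trans (ht.trans ?_))
        exact Real.exp_le_exp.2 (P.load_antitone (Nat.le_succ _))
      · exact le_min hx0.le (Real.exp_pos _).le
    have hex := P.extra_mul_le_slope (k - 1 + 1) (le_refl 0) hcr'
    unfold potential
    dsimp only
    rw [z1] at hE ⊢
    rw [z2, hjump]
    have g1 : P.h₀ * cr' ≤ P.h₀ * (cr + 1) := by gcongr
    have g2 := P.slope_nonneg (j := k - 1 + 1) (le_refl (0 : ℝ))
    linarith

theorem jump_le_of_top {k : ℕ} {z : ℝ} (hz : 0 ≤ z) : P.jump k z ≤ 2 * P.x z := by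
  have := (P.x_pos hz).le
  unfold jump
  split_ifs
  · positivity
  · have := min_le_left (P.x z) (Real.exp (P.load (k - 1))); linarith

theorem jump_le_exp (k : ℕ) (z : ℝ) : P.jump k z ≤ 2 * Real.exp (P.load (k - 1)) := by
  have := (Real.exp_pos (P.load (k - 1))).le
  unfold jump
  split_ifs
  · positivity
  · have := min_le_right (P.x z) (Real.exp (P.load (k - 1))); linarith

end Setup

/-! ### Outcomes of a step -/

namespace SyncState

variable {n : ℕ} (s : SyncState n)

theorem sense_jammed (A : Finset (Fin n)) : s.sense ⟨A, true⟩ = s := by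
  simp [sense, Round.isIdle, Round.isSuccess]

theorem sense_idle : s.sense ⟨∅, false⟩ =
    ⟨s.k - 1, if s.k ≤ 1 then none else s.hi, s.c, s.T - 1, true⟩ := by
  simp [sense, Round.isIdle]

theorem sense_success_hi {u : Fin n} (h : s.hi = some u) : s.sense ⟨{u}, false⟩ = s := by
  have hs : (⟨{u}, false⟩ : Round n).isSuccess = true := by simp [Round.isSuccess]
  have hu : (⟨{u}, false⟩ : Round n).sender hs = u := by
    have := sender_eq hs; simpa using this.symm
  have hi : ¬ (⟨{u}, false⟩ : Round n).isIdle = true := by simp [Round.isIdle]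
  unfold sense
  rw [if_neg hi, dif_pos hs, hu, if_pos h]

theorem sense_success {u : Fin n} (h : s.hi ≠ some u) :
    s.sense ⟨{u}, false⟩ = ⟨s.k + 1, some u, s.c, s.T, s.dirty⟩ := by
  have hs : (⟨{u}, false⟩ : Round n).isSuccess = true := by simp [Round.isSuccess]
  have hu : (⟨{u}, false⟩ : Round n).sender hs = u := by
    have := sender_eq hs; simpa using this.symm
  have hi : ¬ (⟨{u}, false⟩ : Round n).isIdle = true := by simp [Round.isIdle]
  unfold sense
  rw [if_neg hi, dif_pos hs, hu, if_neg h]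

/-- In a busy step that is not jammed, either nothing changes, or the level goes up by one. -/
theorem sense_busy {A : Finset (Fin n)} (hA : A ≠ ∅) :
    s.sense ⟨A, false⟩ = s ∨ ∃ u, s.sense ⟨A, false⟩ = ⟨s.k + 1, some u, s.c, s.T, s.dirty⟩ := by
  by_cases hs : (⟨A, false⟩ : Round n).isSuccess = true
  · obtain ⟨u, hu⟩ := Round.exists_sender hs
    dsimp only at hu
    subst hu
    by_cases h : s.hi = some u
    · exact Or.inl (s.sense_success_hi h)
    · exact Or.inr ⟨u, s.sense_success h⟩
  · left
    have hi : ¬ (⟨A, false⟩ : Round n).isIdle = true := by simpa [Round.isIdle] using hA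
    unfold sense
    rw [if_neg hi, dif_neg hs]

end SyncState

namespace Setup

variable (P : Setup)

/-! ### Probabilities in a synchronized state -/

section Probabilities

variable {s : SyncState P.n}

theorem prob_eq_lev {v : Fin P.n} (h : s.hi ≠ some v) : s.prob P.γ P.pHat v = P.lev s.k := by
  unfold SyncState.prob lev; rw [if_neg h, mul_one]

theorem prob_hi (hs : s.Valid) {v : Fin P.n} (h : s.hi = some v) :
    s.prob P.γ P.pHat v = (1 + P.γ) * P.lev s.k ∧ (1 + P.γ) * P.lev s.k ≤ 1 / 24 := by
  refine ⟨by unfold SyncState.prob lev; rw [if_pos h, mul_comm], ?_⟩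
  obtain ⟨k, hk⟩ : ∃ k, s.k = k + 1 := ⟨s.k - 1, by have := hs.one_le_k (by simp [h]); omega⟩
  rw [hk, ← P.lev_succ]
  exact P.lev_le k

theorem prob_nonneg (hs : s.Valid) (v : Fin P.n) : 0 ≤ s.prob P.γ P.pHat v := by
  have h1 := P.lev_pos s.k
  have h2 := P.γ_pos
  by_cases h : s.hi = some v
  · rw [(P.prob_hi hs h).1]; positivity
  · rw [P.prob_eq_lev h]; exact h1.le

theorem prob_lt_one (hs : s.Valid) (v : Fin P.n) : s.prob P.γ P.pHat v < 1 := by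
  by_cases h : s.hi = some v
  · have := P.prob_hi hs h; rw [this.1]; linarith
  · rw [P.prob_eq_lev h]; have := P.lev_le s.k; linarith

theorem exp_neg_load (k : ℕ) : Real.exp (-P.load k) = (1 - P.lev k) ^ P.n := by
  have := P.lev_le k
  have h0 : 0 < 1 - P.lev k := by linarith
  unfold load
  rw [neg_neg, Real.exp_nat_mul, Real.exp_log h0]

/-- The probability that nobody transmits is `exp (-load)`, up to the factor `9 / 10` that the
exceptional node may cost. -/
theorem idle_prob_bounds (hs : s.Valid) :
    (sendPMF (s.prob P.γ P.pHat) ∅).toReal ≤ Real.exp (-P.load s.k) ∧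
      9 / 10 * Real.exp (-P.load s.k) ≤ (sendPMF (s.prob P.γ P.pHat) ∅).toReal := by
  rw [sendPMF_empty (P.prob_nonneg hs) fun v => (P.prob_lt_one hs v).le, P.exp_neg_load]
  have hq := P.lev_le s.k
  have hq0 := P.lev_pos s.k
  have hγ := P.γ_pos
  have hγ' := P.γ_le
  have hpow : 0 ≤ (1 - P.lev s.k) ^ P.n := pow_nonneg (by linarith) _
  rcases hhi : s.hi with _ | w
  · have : ∏ v, (1 - s.prob P.γ P.pHat v) = (1 - P.lev s.k) ^ P.n := by
      rw [Finset.prod_congr rfl fun v _ => by rw [P.prob_eq_lev (v := v) (by simp [hhi])]]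
      simp
    rw [this]
    exact ⟨le_rfl, by linarith⟩
  · obtain ⟨h1, h2⟩ := P.prob_hi hs hhi
    have hn : P.n = (P.n - 1) + 1 := by have := P.two_le_n; omega
    have : ∏ v, (1 - s.prob P.γ P.pHat v) =
        (1 - (1 + P.γ) * P.lev s.k) * (1 - P.lev s.k) ^ (P.n - 1) := by
      rw [← Finset.mul_prod_erase Finset.univ _ (Finset.mem_univ w), h1]
      congr 1
      rw [Finset.prod_congr rfl fun v hv => by
        rw [P.prob_eq_lev (v := v) (by
          rw [hhi]; simpa using (Finset.ne_of_mem_erase hv).symm)]]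
      simp
    have e : (1 - P.lev s.k) ^ P.n = (1 - P.lev s.k) * (1 - P.lev s.k) ^ (P.n - 1) := by
      rw [← pow_succ', ← hn]
    have hpow' : 0 ≤ (1 - P.lev s.k) ^ (P.n - 1) := pow_nonneg (by linarith) _
    rw [this, e]
    constructor
    · gcongr; nlinarith
    · rw [← mul_assoc]
      gcongr
      nlinarith

open Classical in
/-- A lower bound for the probability that the only sender is a node that is not exceptional. Only
such transmissions change the level. -/
theorem le_sum_success (hs : s.Valid) :
    P.load s.k / 2 * (sendPMF (s.prob P.γ P.pHat) ∅).toReal ≤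
      ∑ u ∈ Finset.univ.filter (fun u => s.hi ≠ some u),
        (sendPMF (s.prob P.γ P.pHat) {u}).toReal := by
  have hq := P.lev_le s.k
  have hq0 := P.lev_pos s.k
  rw [Finset.sum_congr rfl fun u hu => by
    rw [le_sendPMF_singleton (P.prob_nonneg hs) (P.prob_lt_one hs),
      P.prob_eq_lev (Finset.mem_filter.1 hu).2]]
  rw [Finset.sum_const, nsmul_eq_mul, ← mul_assoc]
  have ha : 0 ≤ (sendPMF (s.prob P.γ P.pHat) ∅).toReal := ENNReal.toReal_nonneg
  refine mul_le_mul_of_nonneg_right ?_ ha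
  have hl := P.load_le s.k
  have hr : 0 ≤ P.lev s.k / (1 - P.lev s.k) := div_nonneg hq0.le (by linarith)
  have hcard : (P.n : ℝ) / 2 ≤ ((Finset.univ.filter (fun u => s.hi ≠ some u)).card : ℝ) := by
    have h1 : P.n ≤ (Finset.univ.filter (fun u => s.hi ≠ some u)).card + 1 := by
      rcases hhi : s.hi with _ | w
      · simp
      · have : (Finset.univ.filter fun u => some w ≠ some u) = Finset.univ.erase w := by
          ext u; simp [eq_comm]
        rw [this, Finset.card_erase_of_mem (Finset.mem_univ w)]
        simp only [Finset.card_univ, Fintype.card_fin]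
        omega
    have h1' : (P.n : ℝ) ≤ ((Finset.univ.filter (fun u => s.hi ≠ some u)).card : ℝ) + 1 := by
      exact_mod_cast h1
    have h2 : (2 : ℝ) ≤ P.n := by exact_mod_cast P.two_le_n
    linarith
  calc P.load s.k / 2 ≤ (P.n : ℝ) / 2 * (P.lev s.k / (1 - P.lev s.k)) := by linarith
    _ ≤ _ := by gcongr

end Probabilities

/-! ### The supermartingale -/

/-- The part of the jamming budget that is used up after a history: the maximal excess of the number
of jammed steps over `(1 - ε) w`, over all windows of size `w ≥ 0` that end at the present. -/
noncomputable def bucket {n : ℕ} (ε : ℝ) : History n → ℝ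
  | [] => 0
  | r :: h => max 0 (bucket ε h + (if r.jammed = true then 1 else 0) - (1 - ε))

theorem bucket_nonneg {n : ℕ} (ε : ℝ) (h : History n) : 0 ≤ bucket ε h := by
  cases h with
  | nil => exact le_rfl
  | cons r h => exact le_max_left _ _

/-- The number by which a step changes the account. At levels of load at least `U`, every step
counts `1`. At levels of smaller load, a busy step that is not jammed counts `1`, and the amounts
subtracted for successes and idle steps make up for the increase of the potential. Idle steps at
level `0` do not lower the level, and the additional amount for them is what
`Setup.countP_add_le_account` then lacks. -/
noncomputable def charge {n : ℕ} (s : SyncState n) (r : Round n) : ℝ :=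
  if s.k < P.kU then
    1 + (if r.isIdle = true ∧ s.k = 0 then 8 * Real.exp (2 * P.U) + 2 else 0)
  else if r.isIdle = true then -(4 * Real.exp (2 * P.U))
  else if r.jammed = true then 0
  else 1 - (if r.isSuccess = true then Real.exp (2 * P.U) else 0)

/-- The sum of the charges of all steps of a history. -/
noncomputable def account {n : ℕ} : History n → ℝ
  | [] => 0
  | r :: h => account h + P.charge (syncState h) r

/-- The sum of potential and account after a history. A multiple of it is the exponent of the
supermartingale. -/
noncomputable def total {n : ℕ} (h : History n) : ℝ :=
  P.potential (syncState h) (P.ε * P.Tj - bucket P.ε h) + P.account h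

section Increments

variable {n : ℕ} {h : History n}

theorem total_cons (r : Round n) : P.total (r :: h) - P.total h =
    P.potential ((syncState h).sense r).count (P.ε * P.Tj - bucket P.ε (r :: h)) -
      P.potential (syncState h) (P.ε * P.Tj - bucket P.ε h) +
      P.charge (syncState h) r := by
  unfold total account
  rw [show syncState (r :: h) = ((syncState h).sense r).count from rfl]
  cases h <;> simp only [account] <;> ring

theorem bucket_jam (A : Finset (Fin n)) :
    bucket P.ε (⟨A, true⟩ :: h) = bucket P.ε h + P.ε := by
  have := bucket_nonneg P.ε h; have := P.ε_pos
  show max 0 (bucket P.ε h + (if true = true then 1 else 0) - (1 - P.ε)) = _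
  rw [if_pos rfl, max_eq_right (by linarith)]; ring

theorem bucket_free (A : Finset (Fin n)) :
    bucket P.ε h - 1 ≤ bucket P.ε (⟨A, false⟩ :: h) := by
  have := P.ε_pos
  show _ ≤ max 0 (bucket P.ε h + (if false = true then 1 else 0) - (1 - P.ε))
  simp only [Bool.false_eq_true, if_false]
  exact le_trans (by linarith) (le_max_right _ _)

theorem bucket_free_le (A : Finset (Fin n)) :
    bucket P.ε (⟨A, false⟩ :: h) ≤ bucket P.ε h + 1 := by
  have := P.ε_pos; have := bucket_nonneg P.ε h; have := P.ε_le
  show max 0 (bucket P.ε h + (if false = true then 1 else 0) - (1 - P.ε)) ≤ _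
  simp only [Bool.false_eq_true, if_false]
  exact max_le (by linarith) (by linarith)

theorem charge_jam_le (A : Finset (Fin n)) : P.charge (syncState h) ⟨A, true⟩ ≤ 1 := by
  unfold charge; simp only [Round.isIdle]; split_ifs <;> simp_all

theorem charge_busy_le {A : Finset (Fin n)} (hA : A ≠ ∅) (j : Bool) :
    P.charge (syncState h) ⟨A, j⟩ ≤ 1 := by
  have := Real.exp_pos (2 * P.U)
  unfold charge
  have : (⟨A, j⟩ : Round n).isIdle = false := by simp [Round.isIdle, hA]
  rw [this]
  split_ifs <;> simp_all; linarith

/-- The additional charge for an idle step at level `0`. -/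
noncomputable def refund (k : ℕ) : ℝ := if k = 0 then 8 * Real.exp (2 * P.U) + 2 else 0

theorem charge_idle_eq (hk : (syncState h).k < P.kU) : P.charge (syncState h) ⟨∅, false⟩ =
    1 + P.refund (syncState h).k := by
  unfold charge refund; simp [Round.isIdle, hk]

theorem total_idle_le (hb : bucket P.ε h ≤ P.ε * P.Tj) : P.total (⟨∅, false⟩ :: h) - P.total h ≤
    P.h₀ + 9 + P.jump (syncState h).k (P.z (syncState h).T) +
        P.charge (syncState h) ⟨∅, false⟩ := by
  have hv := syncState_valid h
  rw [P.total_cons, SyncState.sense_idle]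
  have h1 := bucket_nonneg P.ε (⟨∅, false⟩ :: h)
  have h2 := P.bucket_free (h := h) ∅
  have := P.potential_idle_le (k := (syncState h).k) (d := (syncState h).dirty)
      (hi := (syncState h).hi)
    (hi' := if (syncState h).k ≤ 1 then none else (syncState h).hi) hv.one_le_c hv.c_le_T
    (cr := P.ε * P.Tj - bucket P.ε h) (cr' := P.ε * P.Tj - bucket P.ε (⟨∅, false⟩ :: h))
    (by linarith) (by linarith) (by linarith)
  linarith

theorem total_jam_le_of_not_top (hb : bucket P.ε h ≤ P.ε * P.Tj)
    (ht : ¬ P.Top (syncState h).k (P.z (syncState h).T)) (A : Finset (Fin n)) :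
    P.total (⟨A, true⟩ :: h) - P.total h ≤
      -(91 + P.ε * P.extra (syncState h).k (P.z (syncState h).T)) +
          P.charge (syncState h) ⟨A, true⟩ := by
  have hv := syncState_valid h
  rw [P.total_cons, SyncState.sense_jammed]
  have hε := P.ε_pos
  have hε' := P.ε_le
  have h0 := bucket_nonneg P.ε h
  have h1 := P.bucket_jam (h := h) A
  have h3 := P.ε_mul_h₀
  have := P.potential_count_le_of_not_top hv.one_le_c hv.c_le_T ht
    (cr := P.ε * P.Tj - bucket P.ε h) (cr' := P.ε * P.Tj - bucket P.ε (⟨A, true⟩ :: h))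
    (by linarith) (by linarith) (by linarith)
  have e : (P.ε * P.Tj - bucket P.ε (⟨A, true⟩ :: h)) - (P.ε * P.Tj - bucket P.ε h) = -P.ε := by
    rw [h1]; ring
  rw [e] at this
  nlinarith

theorem total_busy_le_of_not_top_of_eq (hb : bucket P.ε h ≤ P.ε * P.Tj)
    (ht : ¬ P.Top (syncState h).k (P.z (syncState h).T)) {A : Finset (Fin n)}
    (hA : (syncState h).sense ⟨A, false⟩ = (syncState h)) :
    P.total (⟨A, false⟩ :: h) - P.total h ≤
      P.h₀ + 9 + P.extra (syncState h).k (P.z (syncState h).T) +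
          P.charge (syncState h) ⟨A, false⟩ := by
  have hv := syncState_valid h
  rw [P.total_cons, hA]
  have h0 := bucket_nonneg P.ε (⟨A, false⟩ :: h)
  have h1 := P.bucket_free (h := h) A
  have h2 := P.bucket_free_le (h := h) A
  have h3 := P.extra_nonneg (syncState h).k (P.z_nonneg (syncState h).T)
  have h4 := P.h₀_ge
  have := P.potential_count_le_of_not_top hv.one_le_c hv.c_le_T ht
    (cr := P.ε * P.Tj - bucket P.ε h) (cr' := P.ε * P.Tj - bucket P.ε (⟨A, false⟩ :: h))
    (by linarith) (by linarith) (by linarith)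
  have h5 : (P.h₀ + P.extra (syncState h).k (P.z (syncState h).T)) *
      ((P.ε * P.Tj - bucket P.ε (⟨A, false⟩ :: h)) -
      (P.ε * P.Tj - bucket P.ε h)) ≤
          (P.h₀ + P.extra (syncState h).k (P.z (syncState h).T)) * 1 := by
    gcongr; linarith
  linarith

theorem total_success_le_of_not_top (hb : bucket P.ε h ≤ P.ε * P.Tj) (hk : (syncState h).k < P.kU)
    (ht : ¬ P.Top (syncState h).k (P.z (syncState h).T))
    {A : Finset (Fin n)} {u : Fin n}
    (hA : (syncState h).sense ⟨A, false⟩ =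
        ⟨(syncState h).k + 1, some u, (syncState h).c, (syncState h).T, (syncState h).dirty⟩) :
    P.total (⟨A, false⟩ :: h) - P.total h ≤
      P.h₀ + 9 - 98 / 100 * P.slope (syncState h).k (P.z (syncState h).T) +
          P.charge (syncState h) ⟨A, false⟩ := by
  have hv := syncState_valid h
  rw [P.total_cons, hA]
  have h0 := bucket_nonneg P.ε (⟨A, false⟩ :: h)
  have h0' := bucket_nonneg P.ε h
  have h1 := P.bucket_free (h := h) A
  have h2 := P.bucket_free_le (h := h) A
  have hz := P.z_nonneg (syncState h).T
  have h3 := P.extra_nonneg ((syncState h).k + 1) hz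
  have h4 := P.h₀_ge
  have ht' : ¬ P.Top ((syncState h).k + 1) (P.z (syncState h).T) :=
    fun hh => ht (P.top_of_le hh (Nat.le_succ _) le_rfl)
  have g1 := P.potential_success_le_of_not_top (d := (syncState h).dirty) (c := (syncState h).c)
      (hi := (syncState h).hi)
    (hi' := some u) hk ht
    (cr := P.ε * P.Tj - bucket P.ε h) (by linarith) (by linarith)
  have g2 := P.potential_count_le_of_not_top
    (s := ⟨(syncState h).k + 1, some u, (syncState h).c, (syncState h).T, (syncState h).dirty⟩)
        hv.one_le_c hv.c_le_T ht'
    (cr := P.ε * P.Tj - bucket P.ε h) (cr' := P.ε * P.Tj - bucket P.ε (⟨A, false⟩ :: h))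
    (by linarith) (by linarith) (by linarith)
  dsimp only at g2
  have g3 : P.extra ((syncState h).k + 1) (P.z (syncState h).T) ≤
      P.slope (syncState h).k (P.z (syncState h).T) / 100 := by
    have := P.extra_mul_le_slope ((syncState h).k + 1) (cr := 1) hz P.one_le_εT
    have := P.slope_antitone (P.z (syncState h).T) (Nat.le_succ (syncState h).k)
    linarith
  have h5 : (P.h₀ + P.extra ((syncState h).k + 1) (P.z (syncState h).T)) *
      ((P.ε * P.Tj - bucket P.ε (⟨A, false⟩ :: h)) - (P.ε * P.Tj - bucket P.ε h)) ≤
      (P.h₀ + P.extra ((syncState h).k + 1) (P.z (syncState h).T)) * 1 := by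
    gcongr; linarith
  linarith

theorem total_success_le_of_kU_le (hb : bucket P.ε h ≤ P.ε * P.Tj) (hk : P.kU ≤ (syncState h).k)
    {A : Finset (Fin n)} {u : Fin n}
    (hA : (syncState h).sense ⟨A, false⟩ =
        ⟨(syncState h).k + 1, some u, (syncState h).c, (syncState h).T, (syncState h).dirty⟩) :
    P.total (⟨A, false⟩ :: h) - P.total h ≤ P.h₀ + 9 + P.charge (syncState h) ⟨A, false⟩ := by
  have hv := syncState_valid h
  rw [P.total_cons, hA]
  have h0 := bucket_nonneg P.ε (⟨A, false⟩ :: h)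
  have h0' := bucket_nonneg P.ε h
  have h1 := P.bucket_free (h := h) A
  have h2 := P.bucket_free_le (h := h) A
  have hz := P.z_nonneg (syncState h).T
  have h4 := P.h₀_ge
  have ht' : ¬ P.Top ((syncState h).k + 1) (P.z (syncState h).T) := fun hh => by
    have := P.lt_kU_of_top hz hh; omega
  have g1 := P.potential_success_le (T := (syncState h).T) (d := (syncState h).dirty)
      (c := (syncState h).c) (hi := (syncState h).hi)
    (hi' := some u) hk (P.ε * P.Tj - bucket P.ε h)
  have g2 := P.potential_count_le_of_not_top
    (s := ⟨(syncState h).k + 1, some u, (syncState h).c, (syncState h).T, (syncState h).dirty⟩)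
        hv.one_le_c hv.c_le_T ht'
    (cr := P.ε * P.Tj - bucket P.ε h) (cr' := P.ε * P.Tj - bucket P.ε (⟨A, false⟩ :: h))
    (by linarith) (by linarith) (by linarith)
  dsimp only at g2
  rw [P.extra_of_kU_le (by omega), add_zero] at g2
  have h5 : P.h₀ *
      ((P.ε * P.Tj - bucket P.ε (⟨A, false⟩ :: h)) - (P.ε * P.Tj - bucket P.ε h)) ≤
      P.h₀ * 1 := by
    gcongr; linarith
  linarith

theorem total_busy_le_of_not_top (hb : bucket P.ε h ≤ P.ε * P.Tj)
    (ht : ¬ P.Top (syncState h).k (P.z (syncState h).T)) {A : Finset (Fin n)}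
    (hA : A ≠ ∅) :
    P.total (⟨A, false⟩ :: h) - P.total h ≤
      P.h₀ + 9 + P.extra (syncState h).k (P.z (syncState h).T) +
          P.charge (syncState h) ⟨A, false⟩ := by
  have h3 := P.extra_nonneg (syncState h).k (P.z_nonneg (syncState h).T)
  rcases (syncState h).sense_busy hA with h1 | ⟨u, h1⟩
  · exact P.total_busy_le_of_not_top_of_eq hb ht h1
  · rcases lt_or_ge (syncState h).k P.kU with hk | hk
    · have := P.total_success_le_of_not_top hb hk ht h1
      have := P.slope_nonneg (j := (syncState h).k) (P.z_nonneg (syncState h).T)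
      linarith
    · have := P.total_success_le_of_kU_le hb hk h1
      linarith

/-- At a top level, every step that is not idle decreases the potential. -/
theorem total_le_of_top (hb : bucket P.ε h ≤ P.ε * P.Tj)
    (ht : P.Top (syncState h).k (P.z (syncState h).T)) {A : Finset (Fin n)} {j : Bool}
    (hA : j = true ∨ A ≠ ∅) :
    P.total (⟨A, j⟩ :: h) - P.total h ≤ -P.h₀ + P.charge (syncState h) ⟨A, j⟩ := by
  have hv := syncState_valid h
  have h0 := bucket_nonneg P.ε (⟨A, j⟩ :: h)
  have h0' := bucket_nonneg P.ε h
  have hz := P.z_nonneg (syncState h).T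
  have h4 := P.h₀_ge
  have hκ := P.κ_eq
  have hstay : (syncState h).sense ⟨A, j⟩ = (syncState h) → bucket P.ε h - 1 ≤
      bucket P.ε (⟨A, j⟩ :: h) →
      P.total (⟨A, j⟩ :: h) - P.total h ≤ -P.h₀ + P.charge (syncState h) ⟨A, j⟩ := by
    intro h1 h2
    rw [P.total_cons, h1]
    have := P.potential_count_le_of_top hv.one_le_c hv.c_le_T ht
      (cr := P.ε * P.Tj - bucket P.ε h) (cr' := P.ε * P.Tj - bucket P.ε (⟨A, j⟩ :: h))
      (by linarith)
    have h5 : P.h₀ *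
      ((P.ε * P.Tj - bucket P.ε (⟨A, j⟩ :: h)) - (P.ε * P.Tj - bucket P.ε h)) ≤
      P.h₀ * 1 := by
      gcongr; linarith
    linarith
  cases j with
  | true =>
    refine hstay ((syncState h).sense_jammed A) ?_
    rw [P.bucket_jam]; have := P.ε_pos; linarith
  | false =>
    have h2 := P.bucket_free (h := h) A
    have h2' := P.bucket_free_le (h := h) A
    rcases (syncState h).sense_busy (hA.resolve_left (by simp)) with h1 | ⟨u, h1⟩
    · exact hstay h1 h2
    · rw [P.total_cons, h1]
      have g1 := P.potential_success_le_of_top (d := (syncState h).dirty) (hi := (syncState h).hi)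
        (hi' := some u) hv.one_le_c hv.c_le_T ht
        (cr := P.ε * P.Tj - bucket P.ε h) (by linarith)
      have hx := P.x_ge' hz
      have hU := P.h₀_le_exp_U
      have hx' : 100 * P.h₀ ≤ P.x (P.z (syncState h).T) := by nlinarith
      by_cases ht' : P.Top ((syncState h).k + 1) (P.z (syncState h).T)
      · have := P.potential_count_le_of_top
          (s := ⟨(syncState h).k + 1, some u, (syncState h).c, (syncState h).T,
            (syncState h).dirty⟩) hv.one_le_c hv.c_le_T ht'
          (cr := P.ε * P.Tj - bucket P.ε h) (cr' := P.ε * P.Tj - bucket P.ε (⟨A, false⟩ :: h))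
          (by linarith)
        have h5 : P.h₀ *
          ((P.ε * P.Tj - bucket P.ε (⟨A, false⟩ :: h)) - (P.ε * P.Tj - bucket P.ε h)) ≤
          P.h₀ * 1 := by
          gcongr; linarith
        linarith
      · have g2 := P.potential_count_le_of_not_top
          (s := ⟨(syncState h).k + 1, some u, (syncState h).c, (syncState h).T,
            (syncState h).dirty⟩) hv.one_le_c hv.c_le_T ht'
          (cr := P.ε * P.Tj - bucket P.ε h) (cr' := P.ε * P.Tj - bucket P.ε (⟨A, false⟩ :: h))
          (by linarith) (by linarith) (by linarith)
        dsimp only at g2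
        have g3 : P.extra ((syncState h).k + 1) (P.z (syncState h).T) ≤
            P.x (P.z (syncState h).T) / 100 := by
          have := P.extra_mul_le_slope ((syncState h).k + 1) (cr := 1) hz P.one_le_εT
          have : P.slope ((syncState h).k + 1) (P.z (syncState h).T) ≤ P.x (P.z (syncState h).T) :=
              min_le_left _ _
          linarith
        have g4 := P.extra_nonneg ((syncState h).k + 1) hz
        have h5 : (P.h₀ + P.extra ((syncState h).k + 1) (P.z (syncState h).T)) *
          ((P.ε * P.Tj - bucket P.ε (⟨A, false⟩ :: h)) - (P.ε * P.Tj - bucket P.ε h)) ≤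
          (P.h₀ + P.extra ((syncState h).k + 1) (P.z (syncState h).T)) * 1 := by
          gcongr; linarith
        linarith

end Increments

end Setup

/-! ### The one-step estimate -/

theorem exp_mul_le_of_le {l Δ b : ℝ} (hl : 0 ≤ l) (hb : 0 ≤ b) (hlb : l * b ≤ 1 / 2)
    (h : Δ ≤ b) : Real.exp (l * Δ) ≤ 1 + 2 * (l * b) := by
  have h0 : 0 ≤ l * b := mul_nonneg hl hb
  have h1 : Real.exp (l * Δ) ≤ Real.exp (l * b) := Real.exp_le_exp.2 (by gcongr)
  have h2 := Real.abs_exp_sub_one_sub_id_le (x := l * b) (by rw [abs_of_nonneg h0]; linarith)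
  have h3 := (abs_le.1 h2).2
  nlinarith

theorem exp_mul_le_of_le_neg {l Δ b : ℝ} (hl : 0 ≤ l) (hb : 0 ≤ b) (hlb : l * b ≤ 1 / 2)
    (h : Δ ≤ -b) : Real.exp (l * Δ) ≤ 1 - l * b / 2 := by
  have h0 : 0 ≤ l * b := mul_nonneg hl hb
  have h1 : Real.exp (l * Δ) ≤ Real.exp (-(l * b)) :=
    Real.exp_le_exp.2 (by rw [← mul_neg]; gcongr)
  have h2 := Real.abs_exp_sub_one_sub_id_le (x := -(l * b))
    (by rw [abs_neg, abs_of_nonneg h0]; linarith)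
  have h3 := (abs_le.1 h2).2
  nlinarith

theorem top_average_le {l a R b : ℝ} (hl : 0 ≤ l) (ha : a ≤ 1 / 100) (haR : a * R ≤ 3)
    (hb : 99 ≤ b) : a * (1 + 2 * (l * R)) + (1 - a) * (1 - l * b / 2) ≤ 1 := by
  have h1 : 99 / 100 * 99 ≤ (1 - a) * b := by gcongr <;> linarith
  have h2 : 0 ≤ l * ((1 - a) * b / 2 - 2 * (a * R)) := mul_nonneg hl (by linarith)
  linarith

theorem jam_average_le {l a R e : ℝ} (hl : 0 ≤ l) (ha : a ≤ 1 / 100) (he : 0 ≤ e)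
    (haR : a * R ≤ 7 + e / 10) :
    a * (1 + 2 * (l * R)) + (1 - a) * (1 - l * (90 + e) / 2) ≤ 1 := by
  have h1 : 99 / 100 * (90 + e) ≤ (1 - a) * (90 + e) := by gcongr; linarith
  have h2 : 0 ≤ l * ((1 - a) * (90 + e) / 2 - 2 * (a * R)) := mul_nonneg hl (by linarith)
  linarith

theorem free_average_le {l a R S δ b e : ℝ} (hl : 0 ≤ l) (ha : 0 ≤ a) (hS : 0 ≤ S) (hb : 0 ≤ b)
    (haR : a * R ≤ 7 + e / 10) (hδ : 4 * (14 + e / 5 + 2 * b) ≤ S * δ) :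
    a * (1 + 2 * (l * R)) + (1 - a - S) * (1 + 2 * (l * b)) + S * (1 - l * (δ / 2) / 2) ≤ 1 := by
  have h1 : 0 ≤ (a + S) * b := by positivity
  have h2 : 0 ≤ l * (S * δ / 4 - 2 * (a * R) - 2 * (1 - a - S) * b) :=
    mul_nonneg hl (by linarith)
  linarith

namespace Setup

variable (P : Setup)

theorem exp_two_U : Real.exp (2 * P.U) = Real.exp P.U ^ 2 := by
  rw [two_mul, Real.exp_add, sq]

theorem h₀_le_exp_two_U : P.h₀ * 100000 ≤ Real.exp (2 * P.U) := by
  have h1 := P.h₀_le_exp_U; have h2 := P.h₀_ge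
  rw [P.exp_two_U]; nlinarith

theorem refund_nonneg (k : ℕ) : 0 ≤ P.refund k := by
  have := Real.exp_pos (2 * P.U); unfold refund; split_ifs <;> positivity

theorem refund_le (k : ℕ) : P.refund k ≤ 8 * Real.exp (2 * P.U) + 2 := by
  have := Real.exp_pos (2 * P.U); unfold refund; split_ifs <;> linarith

theorem exp_neg_load_mul_h₀_le {k : ℕ} (hk : k < P.kU) :
    Real.exp (-P.load k) * (P.h₀ + 10) ≤ 1 / 100 := by
  have h1 : Real.exp (-P.load k) ≤ Real.exp (-P.U) :=
    Real.exp_le_exp.2 (by have := P.U_le_load hk; linarith)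
  have h2 := P.h₀_le_exp_U
  have h3 := P.h₀_ge
  have h4 : Real.exp (-P.U) * Real.exp P.U = 1 := by rw [← Real.exp_add]; simp
  have h5 := Real.exp_pos (-P.U)
  calc Real.exp (-P.load k) * (P.h₀ + 10) ≤ Real.exp (-P.U) * (P.h₀ + 10) := by gcongr
    _ ≤ Real.exp (-P.U) * (Real.exp P.U / 100) := by gcongr; linarith
    _ = 1 / 100 := by rw [mul_div_assoc', h4]

/-- At level `0` the load is at least `4 * U`, so that the refund, of size `exp (2 * U)`, is
negligible in expectation. -/
theorem exp_neg_load_mul_refund_le (k : ℕ) :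
    Real.exp (-P.load k) * P.refund k ≤ 1 / 100 := by
  unfold refund
  split_ifs with h
  · subst h
    have h1 : Real.exp (-P.load 0) ≤ Real.exp (-P.U) ^ 4 := by
      rw [← Real.exp_nat_mul]
      exact Real.exp_le_exp.2 (by have := P.load_zero_ge; push_cast; linarith)
    have h4 : Real.exp (-P.U) * Real.exp P.U = 1 := by rw [← Real.exp_add]; simp
    have h5 := Real.exp_pos (-P.U)
    have h6 : 10000000 ≤ Real.exp P.U := by
      have := P.h₀_le_exp_U; have := P.h₀_ge; linarith
    have h7 : Real.exp (-P.U) ≤ 1 / 10000000 := by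
      rw [le_div_iff₀ (by norm_num)]; nlinarith
    rw [P.exp_two_U]
    calc Real.exp (-P.load 0) * (8 * Real.exp P.U ^ 2 + 2)
        ≤ Real.exp (-P.U) ^ 4 * (8 * Real.exp P.U ^ 2 + 2) := by gcongr
      _ = 8 * Real.exp (-P.U) ^ 2 * (Real.exp (-P.U) * Real.exp P.U) ^ 2 +
          2 * Real.exp (-P.U) ^ 4 := by ring
      _ = 8 * Real.exp (-P.U) ^ 2 + 2 * Real.exp (-P.U) ^ 4 := by rw [h4]; ring
      _ ≤ 8 * (1 / 10000000) ^ 2 + 2 * (1 / 10000000) ^ 4 := by gcongr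
      _ ≤ 1 / 100 := by norm_num
  · simp

theorem exp_neg_load_mul_jump_le_of_top {k : ℕ} {z : ℝ} (hz : 0 ≤ z) (ht : P.Top k z) :
    Real.exp (-P.load k) * P.jump k z ≤ 2 := by
  have h1 := P.jump_le_of_top (k := k) hz
  have h2 : Real.exp (-P.load k) * Real.exp (P.load k) = 1 := by rw [← Real.exp_add]; simp
  have h3 := Real.exp_pos (-P.load k)
  unfold Top at ht
  calc Real.exp (-P.load k) * P.jump k z ≤ Real.exp (-P.load k) * (2 * Real.exp (P.load k)) := by
        gcongr; linarith
    _ = 2 := by linarith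

/-- At levels of moderate load, one level more or less changes the probability of an idle step by a
constant factor only. At levels of larger load, the increase of the potential is covered by
`Setup.extra`. -/
theorem exp_neg_load_mul_jump_le {k : ℕ} {z : ℝ} (hz : 0 ≤ z) (hk : k < P.kU)
    (ht : ¬ P.Top k z) :
    Real.exp (-P.load k) * P.jump k z ≤ 6 + P.ε * P.extra k z / 10 := by
  have h3 := Real.exp_pos (-P.load k)
  have hε := P.ε_pos
  have hγ := P.γ_pos
  by_cases hl : 1 / (2 * P.γ) ≤ P.load k
  · have e : P.ε * P.extra k z / 10 = Real.exp (-P.load k) * (2 * P.x z) := by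
      unfold extra; rw [if_pos ⟨hk, ht, hl⟩]; field_simp; ring
    rw [e]
    have := P.jump_le_of_top (k := k) hz
    have : Real.exp (-P.load k) * P.jump k z ≤ Real.exp (-P.load k) * (2 * P.x z) := by gcongr
    linarith
  · push Not at hl
    have h4 := P.load_pred_le k
    rw [lt_div_iff₀ (by positivity)] at hl
    have h5 : Real.exp (P.load (k - 1)) ≤ Real.exp 1 * Real.exp (P.load k) := by
      rw [← Real.exp_add]; exact Real.exp_le_exp.2 (by nlinarith)
    have h2 : Real.exp (-P.load k) * Real.exp (P.load k) = 1 := by rw [← Real.exp_add]; simp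
    have h6 := P.jump_le_exp k z
    have h7 := Real.exp_one_lt_d9
    have h8 := P.extra_nonneg k hz
    have h9 : 0 ≤ P.ε * P.extra k z / 10 := by positivity
    calc Real.exp (-P.load k) * P.jump k z
        ≤ Real.exp (-P.load k) * (2 * (Real.exp 1 * Real.exp (P.load k))) := by
          gcongr; linarith
      _ = 2 * Real.exp 1 := by linear_combination (2 * Real.exp 1) * h2
      _ ≤ _ := by linarith

/-- The decrease of the potential by successes compensates the increases. -/
theorem load_mul_slope_ge {k : ℕ} {z : ℝ} (hz : 0 ≤ z) (hk : k < P.kU) (ht : ¬ P.Top k z) :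
    4 * (40 + 2 * P.h₀ + 3 * P.extra k z) ≤
      9 / 20 * P.load k * (Real.exp (-P.load k) * P.slope k z) := by
  have hε := P.ε_pos
  have hε' := P.ε_le
  have h2 : Real.exp (-P.load k) * Real.exp (P.load k) = 1 := by rw [← Real.exp_add]; simp
  have h3 := Real.exp_pos (-P.load k)
  have hs : Real.exp (P.load k) ≤ P.slope k z := by
    rw [P.slope_of_not_top hz ht]; exact le_max_left _ _
  have h1 : 1 ≤ Real.exp (-P.load k) * P.slope k z := by
    rw [← h2]; gcongr
  have hU := P.U_le_load hk
  have hE0 := P.extra_nonneg k hz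
  have hE : P.ε ^ 2 * P.extra k z ≤ 256000 * (Real.exp (-P.load k) * P.slope k z) := by
    by_cases hl : 1 / (2 * P.γ) ≤ P.load k
    · have h5 := P.x_le_slope hz hk ht hl
      have e : P.ε ^ 2 * P.extra k z = 20 * P.ε * (Real.exp (-P.load k) * P.x z) := by
        unfold extra; rw [if_pos ⟨hk, ht, hl⟩]; field_simp
      rw [e]
      have e2 : 20 * P.ε * (4 * P.D) = 256000 := by unfold D; field_simp; ring
      calc 20 * P.ε * (Real.exp (-P.load k) * P.x z)
          ≤ 20 * P.ε * (Real.exp (-P.load k) * (4 * P.D * P.slope k z)) := by gcongr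
        _ = (20 * P.ε * (4 * P.D)) * (Real.exp (-P.load k) * P.slope k z) := by ring
        _ = _ := by rw [e2]
    · have e : P.extra k z = 0 := by
        unfold extra; rw [if_neg]; rintro ⟨-, -, h⟩; exact hl h
      rw [e]; linarith
  set w := Real.exp (-P.load k) * P.slope k z with hw
  have hw0 : 0 ≤ w := by linarith
  have hUε := P.U_mul
  have hU0 : 0 < P.U := by have := P.U_ge; linarith
  -- half of the right-hand side for each of the two kinds of terms
  have g1 : 12 * P.extra k z ≤ 9 / 40 * P.U * w := by
    have : P.ε ^ 2 * (12 * P.extra k z) ≤ P.ε ^ 2 * (9 / 40 * P.U * w) := by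
      have e : P.ε ^ 2 * (9 / 40 * P.U * w) = 9 / 40 * (P.U * P.ε ^ 2) * w := by ring
      rw [e, hUε]; linarith
    exact le_of_mul_le_mul_left this (by positivity)
  have g2 : 4 * (40 + 2 * P.h₀) ≤ 9 / 40 * P.U * w := by
    have h6 : 4 * (40 + 2 * P.h₀) ≤ 9 / 40 * P.U := by
      have : P.ε ^ 2 * (4 * (40 + 2 * P.h₀)) ≤ P.ε ^ 2 * (9 / 40 * P.U) := by
        have e : P.ε ^ 2 * (9 / 40 * P.U) = 9 / 40 * (P.U * P.ε ^ 2) := by ring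
        have e' : P.ε ^ 2 * (4 * (40 + 2 * P.h₀)) = 160 * P.ε ^ 2 + 8 * P.ε * (P.ε * P.h₀) := by
          ring
        rw [e, hUε, e', P.ε_mul_h₀]; nlinarith
      exact le_of_mul_le_mul_left this (by positivity)
    nlinarith
  have g3 : 9 / 20 * P.U * w ≤ 9 / 20 * P.load k * w := by gcongr
  linarith

variable (J : Jammer P.n) {h : History P.n} {l : ℝ}

/-- It suffices to bound the increment of the total in jammed steps, idle steps, busy steps, and
successes of nodes in `G`, and to average these bounds. The jammer is reactive, but it must treat
single transmissions and collisions alike. So it has only the choice between jamming the busy steps,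
as in `h1`, and not jamming them, as in `h2`; jamming an idle step is no better for it than not
jamming it, as `m` bounds both outcomes. -/
theorem stepExpect_le_of (G : Finset (Fin P.n)) {fj fi fb fs m : ℝ}
    (hj : ∀ A, Real.exp (l * (P.total (⟨A, true⟩ :: h) - P.total h)) ≤ fj)
    (hi : Real.exp (l * (P.total (⟨∅, false⟩ :: h) - P.total h)) ≤ fi)
    (hb : ∀ A, A ≠ ∅ → Real.exp (l * (P.total (⟨A, false⟩ :: h) - P.total h)) ≤ fb)
    (hs : ∀ u ∈ G, Real.exp (l * (P.total (⟨{u}, false⟩ :: h) - P.total h)) ≤ fs)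
    (hjm : fj ≤ m) (him : fi ≤ m)
    (h1 : (sendPMF ((syncState h).prob P.γ P.pHat) ∅).toReal * m +
      (1 - (sendPMF ((syncState h).prob P.γ P.pHat) ∅).toReal) * fj ≤ 1)
    (h2 : (sendPMF ((syncState h).prob P.γ P.pHat) ∅).toReal * m +
      (1 - (sendPMF ((syncState h).prob P.γ P.pHat) ∅).toReal -
        ∑ u ∈ G, (sendPMF ((syncState h).prob P.γ P.pHat) {u}).toReal) * fb +
      (∑ u ∈ G, (sendPMF ((syncState h).prob P.γ P.pHat) {u}).toReal) * fs ≤ 1) :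
    stepExpect P.γ P.pHat J h (fun h' => ENNReal.ofReal (Real.exp (l * P.total h'))) ≤
      ENNReal.ofReal (Real.exp (l * P.total h)) := by
  unfold stepExpect
  have e : (fun v => (antiJamState P.γ P.pHat h v).p) = (syncState h).prob P.γ P.pHat := by
    funext v; rw [SyncState.antiJamState_eq P.γ_pos P.pHat_pos]
  rw [e]
  have e2 : ∀ h' : History P.n, ENNReal.ofReal (Real.exp (l * P.total h')) =
      ENNReal.ofReal (Real.exp (l * P.total h)) *
        ENNReal.ofReal (Real.exp (l * (P.total h' - P.total h))) := fun h' => by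
    rw [← ENNReal.ofReal_mul (Real.exp_pos _).le, ← Real.exp_add]; ring_nf
  simp_rw [fun A j => e2 (⟨A, j⟩ :: h)]
  simp only [PMF.expect_const_mul]
  refine (mul_le_mul_right (expect_step_le_one _ (J h)
    (fun A j => Real.exp (l * (P.total (⟨A, j⟩ :: h) - P.total h))) G
    (fun _ _ => (Real.exp_pos _).le) hj hi hb hs hjm him h1 h2) _).trans ?_
  rw [mul_one]

/-- At a top level, the decrease of the potential towards the next backing off outweighs idle
steps. -/
theorem stepExpect_le_of_top (hbk : bucket P.ε h ≤ P.ε * P.Tj) (hl : 0 ≤ l)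
    (hlB : l * (4 * P.x (P.z (syncState h).T) + 20 * Real.exp (2 * P.U)) ≤ 1 / 2)
    (ht : P.Top (syncState h).k (P.z (syncState h).T)) :
    stepExpect P.γ P.pHat J h (fun h' => ENNReal.ofReal (Real.exp (l * P.total h'))) ≤
      ENNReal.ofReal (Real.exp (l * P.total h)) := by
  classical
  have hv := syncState_valid h
  obtain ⟨ha1, ha2⟩ := P.idle_prob_bounds hv
  have hz := P.z_nonneg (syncState h).T
  have hx0 := P.x_pos hz
  have hj0 := P.jump_nonneg (syncState h).k hz
  have hj1 := P.jump_le_of_top (k := (syncState h).k) hz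
  have hh := P.h₀_ge
  have hh2 := P.h₀_le_exp_two_U
  have hE2 := Real.exp_pos (2 * P.U)
  have hR0 := P.refund_nonneg (syncState h).k
  have hR1 := P.refund_le (syncState h).k
  have hε := P.ε_pos
  have hε' := P.ε_le
  have hbound : ∀ b, b ≤ 4 * P.x (P.z (syncState h).T) + 20 * Real.exp (2 * P.U) →
      l * b ≤ 1 / 2 := fun b hb => (mul_le_mul_of_nonneg_left hb hl).trans hlB
  have hidle := P.total_idle_le hbk
  have ha0 : 0 ≤ (sendPMF ((syncState h).prob P.γ P.pHat) ∅).toReal := ENNReal.toReal_nonneg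
  have hk := P.lt_kU_of_top hz ht
  rw [P.charge_idle_eq hk] at hidle
  have n1 := P.exp_neg_load_mul_h₀_le hk
  have n2 := P.exp_neg_load_mul_refund_le (syncState h).k
  -- the bound for an idle step
  have hi : Real.exp (l * (P.total (⟨∅, false⟩ :: h) - P.total h)) ≤
      1 + 2 * (l * (P.h₀ + 10 + P.jump (syncState h).k (P.z (syncState h).T) +
        P.refund (syncState h).k)) :=
    exp_mul_le_of_le hl (by linarith) (hbound _ (by linarith)) (by linarith)
  have hm1 : 0 ≤ l * (P.h₀ + 10 + P.jump (syncState h).k (P.z (syncState h).T) +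
        P.refund (syncState h).k) := mul_nonneg hl (by linarith)
  have ha3 : (sendPMF ((syncState h).prob P.γ P.pHat) ∅).toReal ≤ 1 / 100 := by
    have := Real.exp_pos (-P.load (syncState h).k)
    nlinarith
  have n3 := P.exp_neg_load_mul_jump_le_of_top hz ht
  have hdec : ∀ A j, (j = true ∨ A ≠ ∅) →
      Real.exp (l * (P.total (⟨A, j⟩ :: h) - P.total h)) ≤ 1 - l * (P.h₀ - 1) / 2 := by
    intro A j hAj
    refine exp_mul_le_of_le_neg hl (by linarith) (hbound _ (by linarith)) ?_
    have h1 := P.total_le_of_top hbk ht hAj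
    have h2 : P.charge (syncState h) ⟨A, j⟩ ≤ 1 := by
      rcases hAj with rfl | hA
      · exact P.charge_jam_le A
      · exact P.charge_busy_le hA j
    linarith
  have hld : 0 ≤ l * (P.h₀ - 1) := mul_nonneg hl (by linarith)
  set a := (sendPMF ((syncState h).prob P.γ P.pHat) ∅).toReal
  set R := P.h₀ + 10 + P.jump (syncState h).k (P.z (syncState h).T) +
      P.refund (syncState h).k with hRdef
  have haR : a * R ≤ 3 :=
    calc a * R ≤ Real.exp (-P.load (syncState h).k) * R := by gcongr
      _ = Real.exp (-P.load (syncState h).k) * (P.h₀ + 10) +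
          Real.exp (-P.load (syncState h).k) * P.jump (syncState h).k (P.z (syncState h).T) +
          Real.exp (-P.load (syncState h).k) * P.refund (syncState h).k := by rw [hRdef]; ring
      _ ≤ 3 := by linarith
  have key := top_average_le hl ha3 haR (b := P.h₀ - 1) (by linarith)
  refine P.stepExpect_le_of J ∅ (fun A => hdec A true (Or.inl rfl)) hi
    (fun A hA => hdec A false (Or.inr hA)) (fs := 0) (by simp) (by linarith) le_rfl key ?_
  simpa using key

/-- At a level of load at least `U` that is not top, jammed steps use up valuable jamming budget. If
the busy steps are not jammed, then successes are at least `U / 2` times as frequent as idle steps,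
and outweigh all increases. -/
theorem stepExpect_le_of_not_top (hbk : bucket P.ε h ≤ P.ε * P.Tj) (hl : 0 ≤ l)
    (hlB : l * (4 * P.x (P.z (syncState h).T) + 20 * Real.exp (2 * P.U)) ≤ 1 / 2)
    (hk : (syncState h).k < P.kU) (ht : ¬ P.Top (syncState h).k (P.z (syncState h).T)) :
    stepExpect P.γ P.pHat J h (fun h' => ENNReal.ofReal (Real.exp (l * P.total h'))) ≤
      ENNReal.ofReal (Real.exp (l * P.total h)) := by
  classical
  have hv := syncState_valid h
  obtain ⟨ha1, ha2⟩ := P.idle_prob_bounds hv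
  have hz := P.z_nonneg (syncState h).T
  have hx0 := P.x_pos hz
  have hj0 := P.jump_nonneg (syncState h).k hz
  have hj1 := P.jump_le_of_top (k := (syncState h).k) hz
  have hh := P.h₀_ge
  have hh2 := P.h₀_le_exp_two_U
  have hE2 := Real.exp_pos (2 * P.U)
  have hR0 := P.refund_nonneg (syncState h).k
  have hR1 := P.refund_le (syncState h).k
  have hε := P.ε_pos
  have hε' := P.ε_le
  have hbound : ∀ b, b ≤ 4 * P.x (P.z (syncState h).T) + 20 * Real.exp (2 * P.U) →
      l * b ≤ 1 / 2 := fun b hb => (mul_le_mul_of_nonneg_left hb hl).trans hlB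
  have hidle := P.total_idle_le hbk
  have ha0 : 0 ≤ (sendPMF ((syncState h).prob P.γ P.pHat) ∅).toReal := ENNReal.toReal_nonneg
  rw [P.charge_idle_eq hk] at hidle
  have n1 := P.exp_neg_load_mul_h₀_le hk
  have n2 := P.exp_neg_load_mul_refund_le (syncState h).k
  -- the bound for an idle step
  have hi : Real.exp (l * (P.total (⟨∅, false⟩ :: h) - P.total h)) ≤
      1 + 2 * (l * (P.h₀ + 10 + P.jump (syncState h).k (P.z (syncState h).T) +
        P.refund (syncState h).k)) :=
    exp_mul_le_of_le hl (by linarith) (hbound _ (by linarith)) (by linarith)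
  have hm1 : 0 ≤ l * (P.h₀ + 10 + P.jump (syncState h).k (P.z (syncState h).T) +
        P.refund (syncState h).k) := mul_nonneg hl (by linarith)
  have ha3 : (sendPMF ((syncState h).prob P.γ P.pHat) ∅).toReal ≤ 1 / 100 := by
    have := Real.exp_pos (-P.load (syncState h).k)
    nlinarith
  have n3 := P.exp_neg_load_mul_jump_le hz hk ht
  have n4 := P.load_mul_slope_ge hz hk ht
  have hEx := P.extra_nonneg (syncState h).k hz
  have hEx1 := P.extra_le hz hk
  have hsl : P.slope (syncState h).k (P.z (syncState h).T) ≤ P.x (P.z (syncState h).T) :=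
    min_le_left _ _
  have hsl0 := P.slope_ge_exp_U hz hk
  have hU := P.h₀_le_exp_U
  have hεE : P.ε * P.extra (syncState h).k (P.z (syncState h).T) ≤
      P.extra (syncState h).k (P.z (syncState h).T) := by nlinarith
  have hεE0 : 0 ≤ P.ε * P.extra (syncState h).k (P.z (syncState h).T) := by positivity
  have hj : ∀ A, Real.exp (l * (P.total (⟨A, true⟩ :: h) - P.total h)) ≤
      1 - l * (90 + P.ε * P.extra (syncState h).k (P.z (syncState h).T)) / 2 := by
    intro A
    refine exp_mul_le_of_le_neg hl (by linarith) (hbound _ (by linarith)) ?_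
    have h1 := P.total_jam_le_of_not_top hbk ht A
    have h2 := P.charge_jam_le (h := h) A
    linarith
  have hb : ∀ A, A ≠ ∅ → Real.exp (l * (P.total (⟨A, false⟩ :: h) - P.total h)) ≤
      1 + 2 * (l * (P.h₀ + 10 + P.extra (syncState h).k (P.z (syncState h).T))) := by
    intro A hA
    refine exp_mul_le_of_le hl (by linarith) (hbound _ (by linarith)) ?_
    have h1 := P.total_busy_le_of_not_top hbk ht hA
    have h2 := P.charge_busy_le (h := h) hA false
    linarith
  have hs : ∀ u ∈ Finset.univ.filter (fun u => (syncState h).hi ≠ some u),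
      Real.exp (l * (P.total (⟨{u}, false⟩ :: h) - P.total h)) ≤
        1 - l * (P.slope (syncState h).k (P.z (syncState h).T) / 2) / 2 := by
    intro u hu
    refine exp_mul_le_of_le_neg hl (by linarith) (hbound _ (by linarith)) ?_
    have h1 := P.total_success_le_of_not_top hbk hk ht
      ((syncState h).sense_success (Finset.mem_filter.1 hu).2)
    have h2 := P.charge_busy_le (h := h) (Finset.singleton_ne_empty u) false
    linarith
  have hσ := P.le_sum_success hv
  have hld : 0 ≤ l * (90 + P.ε * P.extra (syncState h).k (P.z (syncState h).T)) :=
    mul_nonneg hl (by linarith)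
  have hσ0 : 0 ≤ ∑ u ∈ Finset.univ.filter (fun u => (syncState h).hi ≠ some u),
      (sendPMF ((syncState h).prob P.γ P.pHat) {u}).toReal :=
    Finset.sum_nonneg fun _ _ => ENNReal.toReal_nonneg
  have hload := P.load_pos (syncState h).k
  set a := (sendPMF ((syncState h).prob P.γ P.pHat) ∅).toReal
  set S := ∑ u ∈ Finset.univ.filter (fun u => (syncState h).hi ≠ some u),
    (sendPMF ((syncState h).prob P.γ P.pHat) {u}).toReal
  set E := P.extra (syncState h).k (P.z (syncState h).T)
  set δ := P.slope (syncState h).k (P.z (syncState h).T)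
  set R := P.h₀ + 10 + P.jump (syncState h).k (P.z (syncState h).T) +
    P.refund (syncState h).k with hRdef
  have haR : a * R ≤ 7 + P.ε * E / 10 :=
    calc a * R ≤ Real.exp (-P.load (syncState h).k) * R := by gcongr
      _ = Real.exp (-P.load (syncState h).k) * (P.h₀ + 10) +
          Real.exp (-P.load (syncState h).k) * P.jump (syncState h).k (P.z (syncState h).T) +
          Real.exp (-P.load (syncState h).k) * P.refund (syncState h).k := by rw [hRdef]; ring
      _ ≤ 7 + P.ε * E / 10 := by linarith
  have hSδ : 4 * (40 + 2 * P.h₀ + 3 * E) ≤ S * δ := by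
    have hδ0 : 0 ≤ δ := by linarith
    have hexp := Real.exp_pos (-P.load (syncState h).k)
    calc _ ≤ 9 / 20 * P.load (syncState h).k *
          (Real.exp (-P.load (syncState h).k) * δ) := n4
      _ = (P.load (syncState h).k / 2 *
          (9 / 10 * Real.exp (-P.load (syncState h).k))) * δ := by ring
      _ ≤ (P.load (syncState h).k / 2 * a) * δ := by gcongr
      _ ≤ S * δ := by gcongr
  exact P.stepExpect_le_of J _ hj hi hb hs (by linarith) le_rfl
    (jam_average_le hl ha3 hεE0 haR)
    (free_average_le hl ha0 hσ0 (by linarith) haR (by linarith))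

/-- At a level of load less than `U`, a busy step is a success with probability at least a multiple
of `exp (-U)`, and idle steps decrease the account by more than they increase the potential. -/
theorem stepExpect_le_of_kU_le (hbk : bucket P.ε h ≤ P.ε * P.Tj) (hl : 0 ≤ l)
    (hlB : l * (4 * P.x (P.z (syncState h).T) + 20 * Real.exp (2 * P.U)) ≤ 1 / 2)
    (hk : P.kU ≤ (syncState h).k) :
    stepExpect P.γ P.pHat J h (fun h' => ENNReal.ofReal (Real.exp (l * P.total h'))) ≤
      ENNReal.ofReal (Real.exp (l * P.total h)) := by
  classical
  have hv := syncState_valid h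
  obtain ⟨ha1, ha2⟩ := P.idle_prob_bounds hv
  have hz := P.z_nonneg (syncState h).T
  have hx0 := P.x_pos hz
  have hj0 := P.jump_nonneg (syncState h).k hz
  have hj1 := P.jump_le_of_top (k := (syncState h).k) hz
  have hh := P.h₀_ge
  have hh2 := P.h₀_le_exp_two_U
  have hE2 := Real.exp_pos (2 * P.U)
  have hR0 := P.refund_nonneg (syncState h).k
  have hR1 := P.refund_le (syncState h).k
  have hε := P.ε_pos
  have hε' := P.ε_le
  have hbound : ∀ b, b ≤ 4 * P.x (P.z (syncState h).T) + 20 * Real.exp (2 * P.U) →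
      l * b ≤ 1 / 2 := fun b hb => (mul_le_mul_of_nonneg_left hb hl).trans hlB
  have hidle := P.total_idle_le hbk
  have ha0 : 0 ≤ (sendPMF ((syncState h).prob P.γ P.pHat) ∅).toReal := ENNReal.toReal_nonneg
  have ht : ¬ P.Top (syncState h).k (P.z (syncState h).T) := fun hh => by
    have := P.lt_kU_of_top hz hh; omega
  have hEx : P.extra (syncState h).k (P.z (syncState h).T) = 0 := P.extra_of_kU_le hk
  have hk' : ¬ (syncState h).k < P.kU := by omega
  have c1 : P.charge (syncState h) ⟨∅, false⟩ = -(4 * Real.exp (2 * P.U)) := by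
    unfold charge; rw [if_neg hk']; simp [Round.isIdle]
  have hload := P.load_lt_U hk
  have hload0 := P.load_pos (syncState h).k
  have hi : Real.exp (l * (P.total (⟨∅, false⟩ :: h) - P.total h)) ≤ 1 := by
    rw [Real.exp_le_one_iff]
    refine mul_nonpos_of_nonneg_of_nonpos hl ?_
    rw [c1] at hidle
    have h1 := P.jump_le_exp (syncState h).k (P.z (syncState h).T)
    have h2 : Real.exp (P.load ((syncState h).k - 1)) ≤ Real.exp (2 * P.U) := by
      refine Real.exp_le_exp.2 ((P.load_pred_le _).trans ?_)
      have := P.γ_le; have := P.γ_pos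
      nlinarith
    linarith
  have hj : ∀ A, Real.exp (l * (P.total (⟨A, true⟩ :: h) - P.total h)) ≤ 1 := by
    intro A
    rw [Real.exp_le_one_iff]
    refine mul_nonpos_of_nonneg_of_nonpos hl ?_
    have h1 := P.total_jam_le_of_not_top hbk ht A
    have h2 := P.charge_jam_le (h := h) A
    rw [hEx] at h1
    linarith
  have hb : ∀ A, A ≠ ∅ → Real.exp (l * (P.total (⟨A, false⟩ :: h) - P.total h)) ≤
      1 + 2 * (l * (P.h₀ + 10)) := by
    intro A hA
    refine exp_mul_le_of_le hl (by linarith) (hbound _ (by linarith)) ?_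
    have h1 := P.total_busy_le_of_not_top hbk ht hA
    have h2 := P.charge_busy_le (h := h) hA false
    rw [hEx] at h1
    linarith
  have hs : ∀ u ∈ (Finset.univ : Finset (Fin P.n)),
      Real.exp (l * (P.total (⟨{u}, false⟩ :: h) - P.total h)) ≤
        1 - l * (Real.exp (2 * P.U) / 2) / 2 := by
    intro u _
    refine exp_mul_le_of_le_neg hl (by linarith) (hbound _ (by linarith)) ?_
    have h1 := P.total_busy_le_of_not_top hbk ht (Finset.singleton_ne_empty u)
    have h2 : P.charge (syncState h) ⟨{u}, false⟩ = 1 - Real.exp (2 * P.U) := by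
      unfold charge; rw [if_neg hk']; simp [Round.isIdle, Round.isSuccess]
    rw [hEx, h2] at h1
    linarith
  have hσ := mul_one_sub_le_sum_sendPMF_singleton (P.prob_nonneg hv) (P.prob_lt_one hv)
  have ha4 : 9 / 10 ≤ (sendPMF ((syncState h).prob P.γ P.pHat) ∅).toReal * Real.exp P.U := by
    have h1 : Real.exp (-P.load (syncState h).k) * Real.exp (P.load (syncState h).k) = 1 := by
      rw [← Real.exp_add]; simp
    have h2 : Real.exp (P.load (syncState h).k) ≤ Real.exp P.U := Real.exp_le_exp.2 hload.le
    calc (9 : ℝ) / 10 = 9 / 10 * Real.exp (-P.load (syncState h).k) *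
          Real.exp (P.load (syncState h).k) := by rw [mul_assoc, h1, mul_one]
      _ ≤ _ := by gcongr
  have hU := P.h₀_le_exp_U
  have h2U := P.exp_two_U
  have ha5 : (sendPMF ((syncState h).prob P.γ P.pHat) ∅).toReal ≤ 1 :=
    (PMF.toReal_nonneg_le_one _ _).2
  refine P.stepExpect_le_of J Finset.univ hj hi hb hs le_rfl le_rfl (by linarith) ?_
  set a := (sendPMF ((syncState h).prob P.γ P.pHat) ∅).toReal
  set S := ∑ u, (sendPMF ((syncState h).prob P.γ P.pHat) {u}).toReal
  have hS0 : 0 ≤ S := Finset.sum_nonneg fun _ _ => ENNReal.toReal_nonneg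
  have e : a * 1 + (1 - a - S) * (1 + 2 * (l * (P.h₀ + 10))) +
      S * (1 - l * (Real.exp (2 * P.U) / 2) / 2) =
      1 + l * (2 * (1 - a - S) * (P.h₀ + 10) - S * Real.exp (2 * P.U) / 4) := by ring
  rw [e]
  have h6 : 9 / 10 * (1 - a) ≤ S * Real.exp P.U := by
    calc 9 / 10 * (1 - a) ≤ (a * Real.exp P.U) * (1 - a) := by gcongr
      _ = (a * (1 - a)) * Real.exp P.U := by ring
      _ ≤ S * Real.exp P.U := by gcongr
  have h7 : 2 * (1 - a) * (P.h₀ + 10) ≤ S * Real.exp (2 * P.U) / 4 := by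
    rw [h2U]
    have h8 : P.h₀ + 10 ≤ Real.exp P.U / 100 := by linarith
    have h9 : 0 ≤ 1 - a := by linarith
    calc 2 * (1 - a) * (P.h₀ + 10) ≤ 2 * (1 - a) * (Real.exp P.U / 100) := by gcongr
      _ = 9 / 10 * (1 - a) * Real.exp P.U / 45 := by ring
      _ ≤ (S * Real.exp P.U) * Real.exp P.U / 45 := by gcongr
      _ ≤ _ := by
        have : 0 ≤ S * Real.exp P.U * Real.exp P.U := by positivity
        rw [sq, ← mul_assoc]; linarith
  have h10 : 0 ≤ S * (P.h₀ + 10) := mul_nonneg hS0 (by linarith)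
  have : 2 * (1 - a - S) * (P.h₀ + 10) - S * Real.exp (2 * P.U) / 4 ≤ 0 := by nlinarith
  nlinarith


/-- The exponential of the total does not increase in conditional expectation. -/
theorem stepExpect_le (hbk : bucket P.ε h ≤ P.ε * P.Tj) (hl : 0 ≤ l)
    (hlB : l * (4 * P.x (P.z (syncState h).T) + 20 * Real.exp (2 * P.U)) ≤ 1 / 2) :
    stepExpect P.γ P.pHat J h (fun h' => ENNReal.ofReal (Real.exp (l * P.total h'))) ≤
      ENNReal.ofReal (Real.exp (l * P.total h)) := by
  rcases lt_or_ge (syncState h).k P.kU with hk | hk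
  · by_cases ht : P.Top (syncState h).k (P.z (syncState h).T)
    · exact P.stepExpect_le_of_top J hbk hl hlB ht
    · exact P.stepExpect_le_of_not_top J hbk hl hlB hk ht
  · exact P.stepExpect_le_of_kU_le J hbk hl hlB hk

end Setup

/-! ### Accounting along an execution -/

theorem SyncState.count_eq (n : ℕ) (s : SyncState n) :
    (s.count.k = s.k ∧ s.count.T = s.T) ∨ (s.count.k = s.k + 1 ∧ s.count.T = s.T + 2) := by
  unfold count; split_ifs <;> simp

/-- The threshold estimate grows at most like the square root of the number of steps: it takes a
full round of the counter to increase it. -/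
theorem syncState_T_sq_le {n : ℕ} (h : History n) :
    (syncState h).T ^ 2 + 4 * (syncState h).c ≤ 8 * h.length + 5 := by
  induction h with
  | nil => simp [syncState]
  | cons r h ih =>
    have hv := syncState_valid h
    obtain ⟨h1, h2, -⟩ := hv
    rw [show syncState (r :: h) = ((syncState h).sense r).count from rfl, List.length_cons]
    generalize syncState h = s at *
    have hc : (s.sense r).c = s.c := by unfold SyncState.sense; split_ifs <;> rfl
    have hT : (s.sense r).T = s.T ∨ (s.sense r).T = s.T - 1 ∧ (s.sense r).dirty = true := by
      unfold SyncState.sense; split_ifs <;> simp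
    generalize s.sense r = s' at *
    obtain ⟨m, hm⟩ : ∃ m, s.T = m + 1 := ⟨s.T - 1, by omega⟩
    unfold SyncState.count
    rcases hT with hT | ⟨hT, hd⟩
    · split_ifs <;> dsimp only <;> rw [hT] <;> nlinarith
    · rw [hm, Nat.add_sub_cancel] at hT
      rw [hm] at ih
      split_ifs with ha hb
      · dsimp only; rw [hT]; nlinarith
      · have : m = 0 := by
          by_contra hne; exact hb ⟨hd, by omega⟩
        dsimp only; rw [hT, this]; nlinarith
      · dsimp only; rw [hT, hc]; nlinarith

theorem syncState_T_le {n t : ℕ} {h : History n} (ht : 1 ≤ t) (hh : h.length ≤ t) :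
    ((syncState h).T : ℝ) ≤ 4 * Real.sqrt t := by
  have h1 := syncState_T_sq_le h
  have h2 : ((syncState h).T : ℝ) ^ 2 ≤ 16 * t := by
    exact_mod_cast (by omega : (syncState h).T ^ 2 ≤ 16 * t)
  refine le_of_sq_le_sq ?_ (by positivity)
  rw [mul_pow, Real.sq_sqrt (by positivity)]
  linarith

/-- The bucket is the excess of the jammed steps over their admissible fraction, in a suitable final
segment of the execution. -/
theorem exists_bucket_eq {n : ℕ} (ε : ℝ) (h : History n) :
    ∃ W, W <+: h ∧ Setup.bucket ε h = (W.countP (fun r => r.jammed) : ℝ) - (1 - ε) * W.length := by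
  induction h with
  | nil => exact ⟨[], List.nil_prefix, by simp [Setup.bucket]⟩
  | cons r h ih =>
    obtain ⟨W, hW, hb⟩ := ih
    rcases le_total (Setup.bucket ε h +
        (if r.jammed = true then 1 else 0) - (1 - ε)) 0 with hle | hle
    · refine ⟨[], List.nil_prefix, ?_⟩
      rw [Setup.bucket, max_eq_left hle]; simp
    · refine ⟨r :: W, by simpa using hW, ?_⟩
      rw [Setup.bucket, max_eq_right hle, hb, List.countP_cons, List.length_cons]
      push_cast
      ring

theorem Jammer.IsBounded.bucket_le {n : ℕ} {J : Jammer n} {γ pHat ε : ℝ} {T t : ℕ}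
    (hJ : J.IsBounded γ pHat T ε) (hε : 0 ≤ ε) {h : History n}
    (hh : h ∈ (antiJamRun γ pHat J t).support) : Setup.bucket ε h ≤ ε * T := by
  obtain ⟨W, hW, hb⟩ := exists_bucket_eq ε h
  rw [hb]
  rcases le_or_gt T W.length with hT | hT
  · have := hJ t h hh W hW.isInfix hT
    have : 0 ≤ ε * T := by positivity
    linarith
  · have h1 : (W.countP (fun r => r.jammed) : ℝ) ≤ W.length := by
      exact_mod_cast List.countP_le_length
    have h2 : ε * W.length ≤ ε * T := by gcongr
    linarith

theorem countP_not_jammed_add {n : ℕ} (h : History n) :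
    (h.countP (fun r => !r.jammed) : ℝ) + (h.countP (fun r => r.jammed) : ℝ) = h.length := by
  have := List.length_eq_countP_add_countP (p := fun r : Round n => r.jammed) (l := h)
  rw [this]
  push_cast
  rw [add_comm]
  congr 3
  funext r
  cases r.jammed <;> simp

theorem Jammer.IsBounded.le_countP {n : ℕ} {J : Jammer n} {γ pHat ε : ℝ} {T t : ℕ}
    (hJ : J.IsBounded γ pHat T ε) (hT : T ≤ t) {h : History n}
    (hh : h ∈ (antiJamRun γ pHat J t).support) :
    ε * t ≤ h.countP (fun r => !r.jammed) := by
  have hl := length_of_mem_support γ pHat J hh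
  have := hJ t h hh h List.infix_rfl (by omega)
  have e := countP_not_jammed_add h
  rw [hl] at this e
  linarith

namespace Setup

variable (P : Setup)

/-- Idle steps decrease the threshold estimate by `1` and (except at level `0`) the level by `1`,
whereas backing off increases them by `2` and `1`, and a success increases the level by at most `1`.
So the number of idle steps is bounded in terms of the threshold estimate and the number of
successes, and the charges add up to almost the number of steps that are not jammed. -/
theorem countP_add_le_account {n : ℕ} (h : History n) :
    (h.countP (fun r => !r.jammed) : ℝ) + 2 * (4 * Real.exp (2 * P.U) + 1) * (syncState h).k ≤
      P.account h + (9 * Real.exp (2 * P.U) + 2) * h.countP (fun r => r.isSuccess) +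
        (4 * Real.exp (2 * P.U) + 1) * ((syncState h).T - 1) := by
  have hE := Real.exp_pos (2 * P.U)
  induction h with
  | nil => simp [account, syncState]
  | cons r h ih =>
    have hv := syncState_valid h
    obtain ⟨h1, h2, -⟩ := hv
    rw [show syncState (r :: h) = ((syncState h).sense r).count from rfl, List.countP_cons,
      List.countP_cons, account]
    suffices H : (if (!r.jammed) = true then (1 : ℝ) else 0) +
        2 * (4 * Real.exp (2 * P.U) + 1) * (((syncState h).sense r).k - (syncState h).k) ≤
        P.charge (syncState h) r +
        (9 * Real.exp (2 * P.U) + 2) * (if r.isSuccess = true then (1 : ℝ) else 0) +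
        (4 * Real.exp (2 * P.U) + 1) * (((syncState h).sense r).T - (syncState h).T) by
      push_cast
      rcases SyncState.count_eq n ((syncState h).sense r) with ⟨e1, e2⟩ | ⟨e1, e2⟩ <;>
        rw [e1, e2] <;> push_cast <;> linarith
    generalize syncState h = s at *
    have hkU := P.kU_pos
    obtain ⟨A, j⟩ := r
    unfold charge
    cases j with
    | true =>
      rw [SyncState.sense_jammed]
      simp only [Round.isIdle, Round.isSuccess]
      split_ifs <;> simp_all
    | false =>
      by_cases hA : A = ∅
      · subst hA
        rw [SyncState.sense_idle]
        obtain ⟨m, hm⟩ : ∃ m, s.T = m + 1 := ⟨s.T - 1, by omega⟩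
        simp only [Round.isIdle, Round.isSuccess, hm]
        rcases Nat.eq_zero_or_pos s.k with hk | hk
        · simp [hk, hkU]; linarith
        · obtain ⟨k, hk'⟩ : ∃ k, s.k = k + 1 := ⟨s.k - 1, by omega⟩
          simp only [hk']
          split_ifs <;> simp_all <;> linarith
      · have hidle : (⟨A, false⟩ : Round n).isIdle = false := by simp [Round.isIdle, hA]
        rw [hidle]
        by_cases hS : (⟨A, false⟩ : Round n).isSuccess = true
        · have hk : ((s.sense ⟨A, false⟩).k : ℝ) - s.k ≤ 1 ∧ (s.sense ⟨A, false⟩).T = s.T := by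
            rcases s.sense_busy hA with h1 | ⟨u, h1⟩ <;> rw [h1] <;> simp
          have : 2 * (4 * Real.exp (2 * P.U) + 1) * (((s.sense ⟨A, false⟩).k : ℝ) - s.k) ≤
            2 * (4 * Real.exp (2 * P.U) + 1) * 1 := by gcongr; exact hk.1
          rw [hk.2, hS]
          split_ifs <;> simp_all <;> linarith
        · have hs : s.sense ⟨A, false⟩ = s := by
            unfold SyncState.sense; rw [hidle, dif_neg hS]; simp
          rw [hs]
          split_ifs <;> simp_all

theorem total_nil_le : P.total ([] : History P.n) ≤ P.D * P.y * (P.M + 2) + 100 * P.Tj := by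
  have hy := P.y_ge
  have hM := P.one_le_M
  have hE := Real.exp_pos P.U
  have hh := P.h₀_ge
  have hz : P.z 1 = 0 := P.z_eq_zero (by push_cast; linarith)
  have hx : P.x 0 = P.D * P.y := by unfold x; ring
  have hx0 := P.x_pos le_rfl
  have h1 : P.climb 0 0 ≤ P.M * P.x 0 := by
    unfold climb
    calc ∑ j ∈ Finset.Ico 0 P.kU, P.slope j 0 ≤ ∑ _j ∈ Finset.Ico 0 P.kU, P.x 0 :=
          Finset.sum_le_sum fun j _ => min_le_left _ _
      _ = P.kU * P.x 0 := by simp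
      _ ≤ _ := by gcongr; exact P.kU_le_M
  have h2 : P.phase 0 1 1 false ≤ P.κ := by
    have : 0 ≤ P.κ := by rw [P.κ_eq]; linarith
    unfold phase; split_ifs <;> simp_all
  have h3 : P.extra 0 0 * (P.ε * P.Tj) ≤ P.x 0 / 100 :=
    (P.extra_mul_le le_rfl P.kU_pos).trans (by
      have : P.slope 0 0 ≤ P.x 0 := min_le_left _ _
      linarith)
  have h4 : P.h₀ * (P.ε * P.Tj) = 100 * P.Tj := by linear_combination P.Tj * P.ε_mul_h₀
  have h5 : P.κ ≤ P.x 0 / 2 := by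
    rw [P.κ_eq, hx, P.D_eq]; nlinarith
  have e : P.total ([] : History P.n) = P.climb 0 0 + P.phase 0 1 1 false +
      (P.h₀ + P.extra 0 0) * (P.ε * P.Tj) := by
    simp [total, account, potential, syncState, bucket, hz]
  rw [e, ← hx]
  linarith

/-- The competitiveness of AntiJam in terms of the parameters of the analysis. By Markov's
inequality for the supermartingale, the account is small except with probability `exp (-L)`; then
all but few of the steps that are not jammed are paid for by successes. -/
theorem competitive (J : Jammer P.n) {T t : ℕ} (hTj : P.Tj = T)
    (hJ : J.IsBounded P.γ P.pHat T P.ε) (ht : 1 ≤ t) (hTt : T ≤ t) {L r : ℝ}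
    (hr : r * (2 * (9 * Real.exp (2 * P.U) + 2)) ≤ 1)
    (hmain : P.D * P.y * (P.M + 2) + 100 * P.Tj +
      2 * L * (4 * (P.D * (P.y + 4 * Real.sqrt t)) + 20 * Real.exp (2 * P.U)) +
      (4 * Real.exp (2 * P.U) + 1) * (4 * Real.sqrt t) ≤ P.ε * t / 2) :
    ENNReal.ofReal (1 - Real.exp (-L)) ≤
      (antiJamRun P.γ P.pHat J t).toOuterMeasure (competitiveHistories P.n r) := by
  have hE := Real.exp_pos (2 * P.U)
  have hε := P.ε_pos
  have hD : 0 < P.D := by have := P.h₀_ge; rw [P.D_eq]; positivity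
  have hy := P.y_pos
  set R : ℝ := 4 * (P.D * (P.y + 4 * Real.sqrt t)) + 20 * Real.exp (2 * P.U) with hR
  have hR0 : 0 < R := by positivity
  set l : ℝ := 1 / (2 * R) with hldef
  have hl : 0 < l := by positivity
  have hlR : l * R = 1 / 2 := by rw [hldef]; field_simp
  -- the growth of the threshold estimate is bounded, and so are the increments of the total
  have hmart : (antiJamRun P.γ P.pHat J t).expect
      (fun h => ENNReal.ofReal (Real.exp (l * P.total h))) ≤
      ENNReal.ofReal (Real.exp (l * P.total ([] : History P.n))) := by
    refine expect_le_of_stepExpect_le _ _ _ _ _ fun s hs h hh => ?_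
    refine P.stepExpect_le J (by rw [hTj]; exact hJ.bucket_le hε.le hh) hl.le ?_
    rw [← hlR]
    have hT := syncState_T_le (t := t) ht (by rw [length_of_mem_support _ _ _ hh]; exact hs.le)
    have hz : P.z (syncState h).T ≤ 4 * Real.sqrt t := max_le (by linarith) (by positivity)
    rw [hR]
    unfold x
    gcongr
  have hmarkov := PMF.one_sub_le_toOuterMeasure (antiJamRun P.γ P.pHat J t)
    (competitiveHistories P.n r)
    (fun h => ENNReal.ofReal (Real.exp (-(l * P.total ([] : History P.n)) - L)) *
      ENNReal.ofReal (Real.exp (l * P.total h))) (ENNReal.ofReal (Real.exp (-L))) ?_ ?_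
  · refine le_trans (le_of_eq ?_) hmarkov
    rw [ENNReal.ofReal_sub _ (Real.exp_pos _).le, ENNReal.ofReal_one]
  · intro h hh hnot
    rw [← ENNReal.ofReal_mul (Real.exp_pos _).le, ← Real.exp_add, ENNReal.one_le_ofReal,
      Real.one_le_exp_iff]
    by_contra hcon
    push Not at hcon
    apply hnot
    show r * _ ≤ _
    have h1 : P.total h ≤ P.total ([] : History P.n) + 2 * R * L := by
      have : l * P.total h ≤ l * (P.total ([] : History P.n) + 2 * R * L) := by
        have e : l * (P.total ([] : History P.n) + 2 * R * L) =
            l * P.total ([] : History P.n) + 2 * (l * R) * L := by ring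
        rw [e, hlR]; linarith
      exact le_of_mul_le_mul_left this hl
    have h2 := P.potential_nonneg (syncState_valid h)
      (cr := P.ε * P.Tj - bucket P.ε h)
      (by rw [hTj]; linarith [hJ.bucket_le hε.le hh])
    have h3 := P.total_nil_le
    have h4 := P.countP_add_le_account h
    have h5 := syncState_T_le (t := t) ht (length_of_mem_support _ _ _ hh).le
    have h6 := hJ.le_countP hTt hh
    have h7 : 0 ≤ 2 * (4 * Real.exp (2 * P.U) + 1) * ((syncState h).k : ℝ) := by positivity
    have h8 : (4 * Real.exp (2 * P.U) + 1) * (((syncState h).T : ℝ) - 1) ≤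
        (4 * Real.exp (2 * P.U) + 1) * (4 * Real.sqrt t) := by gcongr; linarith
    have h9 : P.total h = P.potential (syncState h) (P.ε * P.Tj - bucket P.ε h) + P.account h :=
      rfl
    set X : ℝ := (h.countP (fun r => !r.jammed) : ℝ)
    set S : ℝ := (h.countP (fun r => r.isSuccess) : ℝ)
    have hX : X ≤ 2 * (9 * Real.exp (2 * P.U) + 2) * S := by linarith
    have hS : 0 ≤ S := Nat.cast_nonneg _
    rcases le_or_gt 0 r with hr0 | hr0
    · calc r * X ≤ r * (2 * (9 * Real.exp (2 * P.U) + 2) * S) := by gcongr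
        _ = r * (2 * (9 * Real.exp (2 * P.U) + 2)) * S := by ring
        _ ≤ 1 * S := by gcongr
        _ = S := one_mul S
    · have hX0 : 0 ≤ X := Nat.cast_nonneg _
      nlinarith
  · rw [PMF.expect_const_mul]
    refine (mul_le_mul_right hmart _).trans (le_of_eq ?_)
    rw [← ENNReal.ofReal_mul (Real.exp_pos _).le, ← Real.exp_add]
    congr 2; ring

end Setup

/-! ### Choice of the parameters -/

theorem Jammer.IsBounded.countP_add_le {n : ℕ} {J : Jammer n} {γ pHat ε : ℝ} {T t : ℕ}
    (hJ : J.IsBounded γ pHat T ε) (hε : 0 < ε) (hT : 1 ≤ T) {h : History n}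
    (hh : h ∈ (antiJamRun γ pHat J t).support) (m : ℕ) {W : History n} (hW : W <:+: h)
    (hm : m * T ≤ W.length) : W.countP (fun r => r.jammed) + m ≤ W.length := by
  induction m generalizing W with
  | zero => simpa using List.countP_le_length
  | succ m ih =>
    have hTW : T ≤ W.length := by nlinarith
    have h1 := hJ t h hh (W.take T) ((List.take_prefix T W).isInfix.trans hW) (by simp [hTW])
    have h2 := ih (W := W.drop T) ((List.drop_suffix T W).isInfix.trans hW)
      (by rw [List.length_drop]; rw [Nat.add_mul, one_mul] at hm; omega)
    have h3 : (W.take T).length = T := by simp [hTW]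
    have h4 : (W.take T).countP (fun r => r.jammed) < T := by
      rw [h3] at h1
      have : (1 : ℝ) ≤ T := by exact_mod_cast hT
      have : ((W.take T).countP (fun r => r.jammed) : ℝ) < T := by nlinarith
      exact_mod_cast this
    rw [List.length_drop] at h2
    have h5 : W.countP (fun r => r.jammed) = (W.take T).countP (fun r => r.jammed) +
        (W.drop T).countP (fun r => r.jammed) := by
      rw [← List.countP_append, List.take_append_drop]
    omega

/-- Every window of size `T` contains a step that is not jammed. Hence a tiny `ε` can be replaced by
`1 / (2 * T)`. -/
theorem Jammer.IsBounded.two_mul {n : ℕ} {J : Jammer n} {γ pHat ε : ℝ} {T : ℕ}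
    (hJ : J.IsBounded γ pHat T ε) (hε : 0 < ε) (hT : 1 ≤ T) :
    J.IsBounded γ pHat (2 * T) (1 / ((2 * T : ℕ) : ℝ)) := by
  intro t h hh W hW hTW
  have h1 := hJ.countP_add_le hε hT hh (W.length / T) hW (Nat.div_mul_le_self _ _)
  have h2 : W.length ≤ W.length / T * (2 * T) := by
    have h3 : W.length < (W.length / T + 1) * T := by
      rw [mul_comm]; exact Nat.lt_mul_div_succ _ hT
    have h4 : 2 ≤ W.length / T := (Nat.le_div_iff_mul_le hT).2 hTW
    nlinarith
  have h5 : (0 : ℝ) < ((2 * T : ℕ) : ℝ) := by exact_mod_cast (by omega : 0 < 2 * T)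
  have h6 : (W.length : ℝ) / ((2 * T : ℕ) : ℝ) ≤ ((W.length / T : ℕ) : ℝ) := by
    rw [div_le_iff₀ h5]; exact_mod_cast h2
  have h7 : (W.countP (fun r => r.jammed) : ℝ) + ((W.length / T : ℕ) : ℝ) ≤ W.length := by
    exact_mod_cast h1
  rw [sub_mul, one_mul, one_div_mul_eq_div]
  linarith

/-- With `w = 1 / (2 * γ)`, this bounds the number `3 * log n / γ` of levels in terms of `exp w`, as
`w` is at least `50` times `log (log n)`. -/
theorem exp_ge_of_fifty_le {w : ℝ} (hw : 50 ≤ w) :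
    48 * w * Real.exp (w / 50) + 2 ≤ Real.exp w := by
  have h1 : Real.exp w = Real.exp (w / 50) * Real.exp (49 * w / 200) ^ 4 := by
    rw [← Real.exp_nat_mul, ← Real.exp_add]; congr 1; push_cast; ring
  have h2 : 49 * w / 200 ≤ Real.exp (49 * w / 200) := by
    have := Real.add_one_le_exp (49 * w / 200); linarith
  have h3 : (12 : ℝ) ^ 3 * (49 * w / 200) ≤ Real.exp (49 * w / 200) ^ 4 := by
    calc (12 : ℝ) ^ 3 * (49 * w / 200) ≤ (49 * w / 200) ^ 3 * (49 * w / 200) := by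
          gcongr; linarith
      _ = (49 * w / 200) ^ 4 := by ring
      _ ≤ _ := by gcongr
  have h4 : 1 ≤ Real.exp (w / 50) := Real.one_le_exp (by linarith)
  rw [h1]
  nlinarith

/-- The parameters of the analysis for a jammer with parameters `T` and `ε` such that
`1 ≤ ε * T`. -/
theorem exists_setup {n T : ℕ} {pHat ε γ : ℝ} (hp : 0 < pHat) (hp' : pHat ≤ 1 / 24) (hT : 1 ≤ T)
    (hε : 0 < ε) (hε' : ε ≤ 1) (hεT : 1 ≤ ε * T) (hn : 80000000 / pHat / ε ^ 2 ≤ n)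
    (hγ : 0 < γ) (hlog : 1 ≤ Real.log (Real.log n))
    (hγ' : γ * (100 * (Real.log T + Real.log (Real.log n))) ≤ 1) :
    ∃ P : Setup, P.n = n ∧ P.pHat = pHat ∧ P.γ = γ ∧ P.ε = ε ∧ P.Tj = T ∧
      P.M = 3 * Real.log n / γ := by
  have hT1 : (1 : ℝ) ≤ T := by exact_mod_cast hT
  have hlT : 0 ≤ Real.log T := Real.log_nonneg hT1
  set w : ℝ := 1 / (2 * γ) with hwdef
  have hw : 50 * (Real.log T + Real.log (Real.log n)) ≤ w := by
    rw [hwdef, le_div_iff₀ (by positivity)]; linarith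
  have hn2 : 2 ≤ n := by
    by_contra hn2
    have : n = 0 ∨ n = 1 := by omega
    rcases this with rfl | rfl <;> norm_num at hlog
  have hlogn : 0 < Real.log n := Real.log_pos (by exact_mod_cast (by omega : 1 < n))
  have hγ10 : γ ≤ 1 / 10 := by nlinarith
  have hTexp : 8000 * (T : ℝ) * (3200 / ε) ≤ Real.exp w := by
    have h1 : 1 / ε ≤ T := by rw [div_le_iff₀ hε]; linarith
    have h2 : (2 : ℝ) ^ 50 ≤ Real.exp 50 := by
      have h3 : Real.exp 50 = Real.exp 1 ^ 50 := by rw [← Real.exp_nat_mul]; norm_num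
      rw [h3]
      have := Real.exp_one_gt_d9
      gcongr; linarith
    calc 8000 * (T : ℝ) * (3200 / ε) = 25600000 * (T : ℝ) * (1 / ε) := by ring
      _ ≤ 25600000 * (T : ℝ) * T := by gcongr
      _ ≤ 2 ^ 50 * ((T : ℝ) * T) := by nlinarith
      _ ≤ Real.exp 50 * ((T : ℝ) * T) := by gcongr
      _ = Real.exp (50 + Real.log T + Real.log T) := by
        rw [Real.exp_add, Real.exp_add, Real.exp_log (by linarith), mul_assoc]
      _ ≤ Real.exp w := Real.exp_le_exp.2 (by linarith)
  have hMexp : 8 * (3 * Real.log n / γ) + 2 ≤ Real.exp w := by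
    have h1 : Real.log n ≤ Real.exp (w / 50) := by
      rw [← Real.log_le_iff_le_exp hlogn]; linarith
    have e : 8 * (3 * Real.log n / γ) = 48 * w * Real.log n := by rw [hwdef]; field_simp; ring
    have h2 : 48 * w * Real.log n ≤ 48 * w * Real.exp (w / 50) := by gcongr
    have := exp_ge_of_fifty_le (w := w) (by linarith)
    linarith
  have hU : 4 * (20000000 / ε ^ 2) ≤ n * pHat := by
    rw [div_right_comm, div_le_iff₀ hp] at hn
    exact le_trans (le_of_eq (by ring)) hn
  exact ⟨⟨n, pHat, γ, ε, T, 20000000 / ε ^ 2, 3 * Real.log n / γ, hn2, hp, hp', hγ, hγ10, hε, hε',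
    hεT, rfl, hU, le_rfl, hTexp, hMexp⟩, rfl, rfl, rfl, rfl, rfl, rfl⟩

namespace Setup

variable (P : Setup)

/-- All terms that do not involve the number of successes are small compared to the number of steps
that are not jammed, if the execution is long enough. -/
theorem le_half_of_long {c l t : ℝ} (hM : P.M = 3 * Real.log P.n / P.γ) (hc : 0 ≤ c) (hl : 1 ≤ l)
    (hnl : Real.log P.n ≤ l) (ht : 0 ≤ t) (hTt : 1000 * P.Tj ≤ P.ε * t)
    (hlong : 2000000000000 * (1 + c) ^ 2 * Real.exp P.U ^ 5 * l ^ 2 * (l / P.γ) ^ 2 ≤ P.ε * t) :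
    P.D * P.y * (P.M + 2) + 100 * P.Tj +
      2 * (c * Real.log P.n) * (4 * (P.D * (P.y + 4 * Real.sqrt t)) + 20 * Real.exp (2 * P.U)) +
      (4 * Real.exp (2 * P.U) + 1) * (4 * Real.sqrt t) ≤ P.ε * t / 2 := by
  have hε := P.ε_pos
  have hε' := P.ε_le
  have hγ := P.γ_pos
  have hγ' := P.γ_le
  have hlog := P.log_n_nonneg
  have hy0 := P.y_pos
  set F := Real.exp P.U with hF
  set s := Real.sqrt t with hs
  have hs0 : 0 ≤ s := Real.sqrt_nonneg t
  have hst : s * s = t := Real.mul_self_sqrt ht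
  set q := l / P.γ with hq
  have hq1 : 1 ≤ q := by rw [hq, le_div_iff₀ hγ]; linarith
  have hF2 : 1 / P.ε ^ 2 ≤ F := by
    refine le_trans ?_ P.exp_U_ge
    gcongr; norm_num
  have h1ε : 1 ≤ 1 / P.ε := by rw [le_div_iff₀ hε]; linarith
  have hF1 : 1 / P.ε ≤ F := by
    refine le_trans ?_ hF2
    rw [← one_div_pow]; nlinarith
  have hF0 : 1 ≤ F := h1ε.trans hF1
  have hεF : 1 ≤ P.ε * F := by
    have := (div_le_iff₀ hε).1 hF1; linarith
  have hMq : P.M ≤ 3 * q := by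
    rw [hM, hq, mul_div_assoc]; gcongr
  have hyq : P.y ≤ 27 * (F * q) := by
    have : P.y = F + 8 * P.M + 2 := rfl
    have h1 : F * 1 ≤ F * q := by gcongr
    have h2 : 1 * q ≤ F * q := by gcongr
    linarith
  have hD : P.D ≤ 3200 * F := by
    have : P.D = 3200 * (1 / P.ε) := by unfold D; ring
    rw [this]; gcongr
  have hD0 : 0 < P.D := by unfold D; positivity
  have hE2 : Real.exp (2 * P.U) = F ^ 2 := P.exp_two_U
  have hM1 := P.one_le_M
  have hc1 : 1 ≤ (1 + c) ^ 2 := by nlinarith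
  have hc2 : c ≤ (1 + c) ^ 2 := by nlinarith
  have hl2 : 1 ≤ l ^ 2 := one_le_pow₀ hl
  have hl3 : l ≤ l ^ 2 := by nlinarith
  have hq3 : q ≤ q ^ 2 := by nlinarith
  have hq2 : 1 ≤ q ^ 2 := one_le_pow₀ hq1
  have hF25 : F ^ 2 ≤ F ^ 5 := pow_le_pow_right₀ hF0 (by norm_num)
  -- the individual terms
  have t1 : P.D * P.y * (P.M + 2) ≤ P.ε * t / 10 := by
    calc P.D * P.y * (P.M + 2) ≤ (3200 * F) * (27 * (F * q)) * (5 * q) := by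
          gcongr; linarith
      _ = 432000 * (1 * F ^ 2 * 1 * q ^ 2) := by ring
      _ ≤ 200000000000 * ((1 + c) ^ 2 * F ^ 5 * l ^ 2 * q ^ 2) := by gcongr; norm_num
      _ ≤ _ := by linarith
  have t3 : 2 * (c * Real.log P.n) * (4 * (P.D * P.y)) ≤ P.ε * t / 10 := by
    calc 2 * (c * Real.log P.n) * (4 * (P.D * P.y))
        ≤ 2 * ((1 + c) ^ 2 * l ^ 2) * (4 * ((3200 * F) * (27 * (F * q ^ 2)))) := by
          gcongr
          · exact hnl.trans hl3
          · exact hyq.trans (by gcongr)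
      _ = 691200 * ((1 + c) ^ 2 * F ^ 2 * l ^ 2 * q ^ 2) := by ring
      _ ≤ 200000000000 * ((1 + c) ^ 2 * F ^ 5 * l ^ 2 * q ^ 2) := by gcongr; norm_num
      _ ≤ _ := by linarith
  have t4 : 2 * (c * Real.log P.n) * (20 * F ^ 2) ≤ P.ε * t / 10 := by
    calc 2 * (c * Real.log P.n) * (20 * F ^ 2)
        ≤ 2 * ((1 + c) ^ 2 * l ^ 2) * (20 * F ^ 2) := by
          gcongr; exact hnl.trans hl3
      _ = 40 * ((1 + c) ^ 2 * F ^ 2 * l ^ 2 * 1) := by ring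
      _ ≤ 200000000000 * ((1 + c) ^ 2 * F ^ 5 * l ^ 2 * q ^ 2) := by gcongr; norm_num
      _ ≤ _ := by linarith
  -- the terms with the square root
  set W := 2 * (c * Real.log P.n) * (4 * (P.D * 4)) + (4 * F ^ 2 + 1) * 4 with hW
  have hW0 : 0 ≤ W := by positivity
  have hW1 : W ≤ 102420 * ((1 + c) * l * F ^ 2) := by
    have h1 : 2 * (c * Real.log P.n) * (4 * (P.D * 4)) ≤ 2 * (c * l) * (4 * (3200 * F * 4)) := by
      gcongr
    have h2 : c * l * F ≤ c * l * F ^ 2 := by gcongr; exact le_self_pow₀ hF0 (by norm_num)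
    have h3 : 1 * F ^ 2 ≤ l * F ^ 2 := by gcongr
    have h4 : 0 ≤ c * l * F ^ 2 := by positivity
    have h5 : 1 ≤ F ^ 2 := one_le_pow₀ hF0
    rw [hW]; linarith
  have hW2 : 10 * W ≤ P.ε * s := by
    refine le_of_sq_le_sq ?_ (by positivity)
    calc (10 * W) ^ 2 ≤ (10 * (102420 * ((1 + c) * l * F ^ 2))) ^ 2 := by gcongr
      _ = 1048985640000 * ((1 + c) ^ 2 * F ^ 4 * l ^ 2 * 1 * 1) := by ring
      _ ≤ 2000000000000 * ((1 + c) ^ 2 * F ^ 4 * l ^ 2 * q ^ 2 * (P.ε * F)) := by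
        gcongr; norm_num
      _ = P.ε * (2000000000000 * (1 + c) ^ 2 * F ^ 5 * l ^ 2 * q ^ 2) := by ring
      _ ≤ P.ε * (P.ε * t) := by gcongr
      _ = (P.ε * s) ^ 2 := by rw [← hst]; ring
  have t5 : W * s ≤ P.ε * t / 10 := by
    have : 10 * W * s ≤ P.ε * s * s := by gcongr
    rw [← hst]; linarith
  rw [hE2]
  have e : 2 * (c * Real.log P.n) * (4 * (P.D * (P.y + 4 * s)) + 20 * F ^ 2) +
      (4 * F ^ 2 + 1) * (4 * s) = 2 * (c * Real.log P.n) * (4 * (P.D * P.y)) +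
        2 * (c * Real.log P.n) * (20 * F ^ 2) + W * s := by rw [hW]; ring
  linarith

end Setup

/-- The competitiveness of AntiJam with explicit constants, if the jammer is also bounded with a
parameter `ε'` that is not much smaller than `ε` and is at least `1 / T`. -/
theorem competitive_of_isBounded {n T : ℕ} {pHat ε ε' γ c : ℝ} (hp : 0 < pHat)
    (hp' : pHat ≤ 1 / 24) (hε : 0 < ε) (hT : 1 ≤ T) (hε0 : ε / 2 ≤ ε') (hε1 : ε' ≤ 1)
    (hεT : 1 ≤ ε' * T) (hn : 320000000 / pHat / ε ^ 2 ≤ n) (hγ : 0 < γ)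
    (hlog : 1 ≤ Real.log (Real.log n))
    (hγ' : γ * (100 * (Real.log T + Real.log (Real.log n))) ≤ 1) (hc : 0 < c)
    (J : Jammer n) (hJ : J.IsBounded γ pHat T ε') {t : ℕ} {l : ℝ} (hl : 1 ≤ l)
    (hnl : Real.log n ≤ l) (hTt : 2000 * (T : ℝ) ≤ ε * t) (hTt' : T ≤ t)
    (hlong : 4000000000000 * (1 + c) ^ 2 * Real.exp (400000000 / ε ^ 2) * l ^ 4 / γ ^ 2 ≤ ε * t) :
    ENNReal.ofReal (1 - 1 / (n : ℝ) ^ c) ≤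
      (antiJamRun γ pHat J t).toOuterMeasure
        (competitiveHistories n (Real.exp (-(240000000 / ε ^ 2)))) := by
  have hε2 : 0 < ε' := by linarith
  have hsq : 1 / ε' ^ 2 ≤ 4 / ε ^ 2 := by
    rw [div_le_div_iff₀ (by positivity) (by positivity)]; nlinarith
  have hn' : 80000000 / pHat / ε' ^ 2 ≤ n := by
    refine le_trans ?_ hn
    calc 80000000 / pHat / ε' ^ 2 = 80000000 / pHat * (1 / ε' ^ 2) := by ring
      _ ≤ 80000000 / pHat * (4 / ε ^ 2) := by gcongr
      _ = _ := by ring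
  obtain ⟨P, rfl, rfl, rfl, rfl, hPT, hPM⟩ := exists_setup hp hp' hT hε2 hε1 hεT hn' hγ hlog hγ'
  have ht0 : (0 : ℝ) ≤ t := Nat.cast_nonneg t
  have hεt : ε * t / 2 ≤ P.ε * t := by nlinarith
  have hU : P.U ≤ 80000000 / ε ^ 2 := by
    rw [P.U_eq]
    calc 20000000 / P.ε ^ 2 = 20000000 * (1 / P.ε ^ 2) := by ring
      _ ≤ 20000000 * (4 / ε ^ 2) := by gcongr
      _ = _ := by ring
  have hF5 : Real.exp P.U ^ 5 ≤ Real.exp (400000000 / ε ^ 2) := by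
    rw [← Real.exp_nat_mul]
    refine Real.exp_le_exp.2 ?_
    calc ((5 : ℕ) : ℝ) * P.U ≤ (5 : ℕ) * (80000000 / ε ^ 2) := by gcongr
      _ = _ := by push_cast; ring
  have hmain := P.le_half_of_long (c := c) (l := l) (t := t) hPM hc.le hl hnl ht0
    (by rw [hPT]; linarith) (by
      have e : 4000000000000 * (1 + c) ^ 2 * Real.exp (400000000 / ε ^ 2) * l ^ 4 / P.γ ^ 2 =
          2 * (2000000000000 * (1 + c) ^ 2 * Real.exp (400000000 / ε ^ 2) * l ^ 2 *
            (l / P.γ) ^ 2) := by field_simp; ring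
      calc _ ≤ 2000000000000 * (1 + c) ^ 2 * Real.exp (400000000 / ε ^ 2) * l ^ 2 *
            (l / P.γ) ^ 2 := by gcongr
        _ ≤ _ := by linarith)
  have hr : Real.exp (-(240000000 / ε ^ 2)) * (2 * (9 * Real.exp (2 * P.U) + 2)) ≤ 1 := by
    have h1 : 2 * (9 * Real.exp (2 * P.U) + 2) ≤ Real.exp P.U ^ 3 := by
      have h2 := P.exp_two_U
      have h3 := Real.add_one_le_exp P.U
      have h4 := P.U_ge
      have h5 : 1 ≤ Real.exp P.U ^ 2 := one_le_pow₀ (by linarith)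
      rw [h2, pow_succ]
      nlinarith
    have h6 : Real.exp P.U ^ 3 ≤ Real.exp (240000000 / ε ^ 2) := by
      rw [← Real.exp_nat_mul]
      refine Real.exp_le_exp.2 ?_
      calc ((3 : ℕ) : ℝ) * P.U ≤ (3 : ℕ) * (80000000 / ε ^ 2) := by gcongr
        _ = _ := by push_cast; ring
    rw [Real.exp_neg, inv_mul_le_iff₀ (Real.exp_pos _)]
    linarith
  have hfin := P.competitive J hPT hJ (hT.trans hTt') hTt' hr hmain
  have e : 1 / (P.n : ℝ) ^ c = Real.exp (-(c * Real.log P.n)) := by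
    rw [Real.exp_neg, Real.rpow_def_of_pos P.n_pos, one_div, mul_comm]
  rwa [e]

theorem one_le_log_log {n : ℕ} (hn : 32 ≤ n) : 1 ≤ Real.log (Real.log n) := by
  have h1 : Real.exp 1 ≤ Real.log n := by
    have h2 : Real.log ((2 : ℝ) ^ 5) ≤ Real.log n :=
      Real.log_le_log (by norm_num) (by norm_num; exact_mod_cast hn)
    rw [Real.log_pow] at h2
    have := Real.log_two_gt_d9
    have := Real.exp_one_lt_d9
    push_cast at h2
    linarith
  rwa [Real.le_log_iff_exp_le (lt_of_lt_of_le (Real.exp_pos 1) h1)]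

theorem theorem2 (pHat : ℝ) (hpHat0 : 0 < pHat) (hpHat1 : pHat ≤ 1 / 24) :
    ∃ K > (0 : ℝ), ∃ δ > (0 : ℝ), ∃ γ₀ > (0 : ℝ),
      ∀ c > (0 : ℝ), ∃ B > (0 : ℝ), ∃ C > (0 : ℝ),
        ∀ (n T : ℕ) (ε γ : ℝ), 1 ≤ T → 0 < ε → ε ≤ 1 → B / ε ^ 2 ≤ (n : ℝ) →
          0 < γ → γ ≤ γ₀ / (Real.log (T : ℝ) + Real.log (Real.log (n : ℝ))) →
          ∀ J : Jammer n, J.IsBounded γ pHat T ε →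
          ∀ t : ℕ,
            C * (1 / ε * Real.log ((max T n : ℕ) : ℝ) *
              max (T : ℝ) (Real.exp (δ / ε ^ 2) / (ε * γ ^ 2) *
                Real.log ((max T n : ℕ) : ℝ) ^ 3)) ≤ (t : ℝ) →
            ENNReal.ofReal (1 - 1 / (n : ℝ) ^ c) ≤
              (antiJamRun γ pHat J t).toOuterMeasure
                (competitiveHistories n (Real.exp (-(K / ε ^ 2)))) := by
  refine ⟨240000000, by norm_num, 400000000, by norm_num, 1 / 200, by norm_num, fun c hc =>
    ⟨320000000 / pHat, by positivity, 4000000000000 * (1 + c) ^ 2, by positivity, ?_⟩⟩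
  intro n T ε γ hT hε hε1 hn hγ hγ' J hJ t ht
  have hT1 : (1 : ℝ) ≤ T := by exact_mod_cast hT
  have hlT : 0 ≤ Real.log T := Real.log_nonneg hT1
  have hn32 : 32 ≤ n := by
    have h1 : (320000000 : ℝ) ≤ 320000000 / pHat / ε ^ 2 := by
      rw [div_div, le_div_iff₀ (by positivity)]
      have : pHat * ε ^ 2 ≤ 1 * 1 := by gcongr <;> nlinarith
      linarith
    exact_mod_cast (by linarith : (32 : ℝ) ≤ n)
  have hll := one_le_log_log hn32
  rw [le_div_iff₀ (by linarith)] at hγ'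
  set l := Real.log ((max T n : ℕ) : ℝ) with hldef
  have hnl : Real.log n ≤ l :=
    Real.log_le_log (by exact_mod_cast (by omega : 0 < n)) (by exact_mod_cast le_max_right T n)
  have hl : 1 ≤ l := by
    refine le_trans ?_ hnl
    have : 0 ≤ Real.log n := Real.log_natCast_nonneg n
    by_contra h
    have := Real.log_nonpos this (not_le.1 h).le
    linarith
  have hc1 : 1 ≤ (1 + c) ^ 2 := one_le_pow₀ (by linarith)
  -- the lower bound for `t` gives one bound by each of the two terms of the maximum
  have h1 : 4000000000000 * (T : ℝ) ≤ ε * t := by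
    calc 4000000000000 * (T : ℝ) = 4000000000000 * 1 * (1 * (T : ℝ)) := by ring
      _ ≤ 4000000000000 * (1 + c) ^ 2 * (l * max (T : ℝ) (Real.exp (400000000 / ε ^ 2) /
          (ε * γ ^ 2) * l ^ 3)) := by gcongr; exact le_max_left _ _
      _ = ε * (4000000000000 * (1 + c) ^ 2 * (1 / ε * l * max (T : ℝ)
          (Real.exp (400000000 / ε ^ 2) / (ε * γ ^ 2) * l ^ 3))) := by field_simp
      _ ≤ ε * t := by gcongr
  have h2 : 4000000000000 * (1 + c) ^ 2 * Real.exp (400000000 / ε ^ 2) * l ^ 4 / γ ^ 2 ≤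
      ε * t := by
    calc 4000000000000 * (1 + c) ^ 2 * Real.exp (400000000 / ε ^ 2) * l ^ 4 / γ ^ 2
        = ε * (4000000000000 * (1 + c) ^ 2 * (1 * l *
          (Real.exp (400000000 / ε ^ 2) / (ε * γ ^ 2) * l ^ 3))) := by field_simp
      _ ≤ ε * (4000000000000 * (1 + c) ^ 2 * (1 / ε * l * max (T : ℝ)
          (Real.exp (400000000 / ε ^ 2) / (ε * γ ^ 2) * l ^ 3))) := by
        gcongr
        · rw [le_div_iff₀ hε]; linarith
        · exact le_max_right _ _
      _ ≤ ε * t := by gcongr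
  have htT : 2 * T ≤ t := by
    have : 2 * (T : ℝ) ≤ t := by
      have : ε * (t : ℝ) ≤ 1 * t := by gcongr
      linarith
    exact_mod_cast this
  rcases le_or_gt 1 (ε * T) with hεT | hεT
  · exact competitive_of_isBounded hpHat0 hpHat1 hε hT (by linarith) hε1 hεT hn hγ hll
      (by nlinarith) hc J hJ hl hnl (by linarith) (by omega) h2
  · -- for such a small `ε`, boundedness says less than that every window of size `T` contains a
    -- step that is not jammed
    have hT2 : (0 : ℝ) < ((2 * T : ℕ) : ℝ) := by exact_mod_cast (by omega : 0 < 2 * T)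
    have hlog2 : Real.log ((2 * T : ℕ) : ℝ) ≤ 1 + Real.log T := by
      have := Real.log_two_lt_d9
      push_cast
      rw [Real.log_mul (by norm_num) (by linarith)]
      linarith
    refine competitive_of_isBounded (T := 2 * T) hpHat0 hpHat1 hε (by omega) ?_ ?_ ?_ hn hγ hll
      ?_ hc J (hJ.two_mul hε hT) hl hnl ?_ htT h2
    · rw [le_div_iff₀ hT2]; push_cast; linarith
    · rw [div_le_one hT2]; push_cast; linarith
    · rw [one_div, inv_mul_cancel₀ hT2.ne']
    · calc γ * (100 * (Real.log ((2 * T : ℕ) : ℝ) + Real.log (Real.log n)))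
          ≤ γ * (100 * (2 * (Real.log T + Real.log (Real.log n)))) := by gcongr; linarith
        _ ≤ 1 := by linarith
    · push_cast; linarith
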